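/- All graphs are finite, undirected and simple. For a graph $G=(V,E)$, a vertex dominates itself and its neighbours. A set $D\subseteq V$ is an efficient dominating set (e.d.) of $G$ if every vertex of $G$ is dominated by exactly one vertex of $D$. The problem WED asks, for a graph $G$ with vertex weights $w\colon V\to\mathbb N$, for an e.d. of minimum total weight, or for the information that $G$ has no e.d. The graph $2P_3$ is the disjoint union of two chordless paths with three vertices each. The graph $S_{1,2,2}$ is the tree consisting of a centre and three legs of lengths $1,2,2$ attached to it. A graph is $(2P_3,S_{1,2,2})$-free if it contains neither of them as an induced subgraph. Write $n=|V|$, and let $\delta(G)$ be the minimum degree. Graphs are given by their adjacency matrix. Running times are counted on a random access machine with addition and subtraction of natural numbers, at unit cost. For a vertex $v$, let $N_i=N_i(v)$ be the set of vertices at distance $i$ from $v$. Let $R=V\setminus(\{v\}\cup N_1\cup N_2)$ and $G_v=G[N_2\cup R]$. A set $H$ of at least two vertices, $H\neq V$, is homogeneous if every vertex outside $H$ is adjacent to all or to none of the vertices of $H$. A graph is prime if it has no homogeneous set. For $Q\subseteq R$, let $S(Q)$ be the set of vertices of $N_2$ that have both a neighbour and a non-neighbour in $Q$, and let $U(Q)$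 be the set of vertices of $Q$ that are adjacent to all of $S(Q)$. 1. There is an algorithm that solves WED on all nonempty $(2P_3,S_{1,2,2})$-free graphs in time $O(\max\{1,\delta(G)\}\cdot n^3)$. In particular it takes time $O(\delta(G)\cdot n^3)$ on all such graphs without isolated vertices, for instance on connected ones with $n\ge 2$. 2. There is an algorithm with running time $O(n^3)$ for the following problem. The input is a connected graph $G$ and a vertex $v$ such that $G_v$ is prime, with weights in $\mathbb N\cup\{\infty\}$ that are $\infty$ on $N_2$. The algorithm either returns an e.d. of $G_v$ of finite weight, which has minimum weight if $G$ is $(2P_3,S_{1,2,2})$-free, or it reports failure. Failure occurs only if $G$ is not $(2P_3,S_{1,2,2})$-free or $G_v$ has no e.d. of finite weight. 3. Let $G$ be connected and $(2P_3,S_{1,2,2})$-free, let $v$ be a vertex such that $G_v$ is prime, and let $D$ be an e.d. of $G$ with $v\in D$ and $|D\cap N_3|\ge 3$. Then every connected component $Q$ of $G[R]$ is a clique and contains exactly one vertex $d$ of $D$. Moreover, $Q=\{d\}$, or $S(Q)\neq\emptyset$ and $U(Q)=\{d\}$. The vertex $d$ is forced: $D'\cap Q=\{d\}$ for every e.d.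 $D'$ of $G$ with $v\in D'$. 4. For every graph $G$, vertex $v$, and distinct nonadjacent $x,y\in R$, the set $\{v,x,y\}$ is an e.d. of $G$ if and only if every other vertex of $G_v$ is adjacent to exactly one of $x,y$. There is an algorithm with running time $O(n^3)$ that, given any graph $G$, a vertex $v$, and weights in $\mathbb N\cup\{\infty\}$ that are $\infty$ on $N_2$, finds an e.d. of $G_v$ of minimum weight among those of finite weight with at most two vertices, or reports that there is none. -/

import Mathlib

open scoped Classical

namespace WED

/-! ### Graph notions -/

section Graphs

variable {V : Type*}

/-- `2P₃`, the disjoint union of two chordless paths on three vertices. -/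
def twoP3 : SimpleGraph (Fin 3 ⊕ Fin 3) :=
  (SimpleGraph.pathGraph 3).sum (SimpleGraph.pathGraph 3)

/-- `S_{1,2,2}`: the tree consisting of a centre `0` with one leg of length one (`0-1`) and
two legs of length two (`0-2-3` and `0-4-5`). -/
def S122 : SimpleGraph (Fin 6) :=
  SimpleGraph.fromEdgeSet {s(0, 1), s(0, 2), s(2, 3), s(0, 4), s(4, 5)}

/-- `G` has no induced subgraph isomorphic to `2P₃` or to `S_{1,2,2}`. -/
def IsFree (G : SimpleGraph V) : Prop :=
  ¬ twoP3.IsIndContained G ∧ ¬ S122.IsIndContained G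

/-- `D` is an efficient dominating set: every vertex is dominated by exactly one vertex of `D`,
where a vertex dominates itself and its neighbours. -/
def IsED (G : SimpleGraph V) (D : Finset V) : Prop :=
  ∀ u, ∃! d, d ∈ D ∧ (d = u ∨ G.Adj d u)

/-- The distance level `N_i(v)`. -/
def level (G : SimpleGraph V) (v : V) (i : ℕ) : Set V :=
  {w | G.edist v w = i}

/-- The set `R = V \ ({v} ∪ N₁(v) ∪ N₂(v))`. -/
def rest (G : SimpleGraph V) (v : V) : Set V :=
  ({v} ∪ level G v 1 ∪ level G v 2)ᶜ

/-- The vertex set `N₂(v) ∪ R` of the graph `G_v`. -/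
def gvSet (G : SimpleGraph V) (v : V) : Set V :=
  level G v 2 ∪ rest G v

/-- The graph `G_v = G[N₂(v) ∪ R]`. -/
def gv (G : SimpleGraph V) (v : V) : SimpleGraph (gvSet G v) :=
  G.induce (gvSet G v)

/-- Homogeneous sets: proper vertex sets with at least two elements such that every vertex outside
is adjacent to all or to none of their elements. -/
def IsHomogeneous (G : SimpleGraph V) (H : Set V) : Prop :=
  H.Nontrivial ∧ H ≠ Set.univ ∧
    ∀ u, u ∉ H → (∀ h ∈ H, G.Adj u h) ∨ (∀ h ∈ H, ¬ G.Adj u h)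

/-- A graph is prime if it has no homogeneous set. -/
def IsPrime (G : SimpleGraph V) : Prop :=
  ∀ H : Set V, ¬ IsHomogeneous G H

/-- `Q` is the vertex set of a connected component of `G[R]`. -/
def IsRestComponent (G : SimpleGraph V) (v : V) (Q : Set V) : Prop :=
  ∃ c : (G.induce (rest G v)).ConnectedComponent, Q = Subtype.val '' c.supp

/-- The vertices of `N₂(v)` that distinguish `Q`: they have a neighbour and
a non-neighbour in `Q`. -/
def distinguishing (G : SimpleGraph V) (v : V) (Q : Set V) : Set V :=
  {z | z ∈ level G v 2 ∧ (∃ q ∈ Q, G.Adj z q) ∧ ∃ q ∈ Q, ¬ G.Adj z q}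

/-- The vertices of `Q` that are adjacent to all vertices distinguishing `Q`. -/
def joined (G : SimpleGraph V) (v : V) (Q : Set V) : Set V :=
  {q | q ∈ Q ∧ ∀ z ∈ distinguishing G v Q, G.Adj z q}

end Graphs

/-! ### A random access machine

A machine has registers and a memory, both holding natural numbers; memory cells are addressed by
the contents of registers. Programs are structured, and a program mentions only finitely many
registers. Arithmetic is addition and truncated subtraction. Each executed
instruction and each evaluation of a test costs one time unit. -/

structure State where
  reg : ℕ → ℕ
  mem : ℕ → ℕ

inductive Program where
  /-- `r := k` -/
  | const (r k : ℕ)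
  /-- `r := a + b` -/
  | add (r a b : ℕ)
  /-- `r := a - b` (truncated) -/
  | sub (r a b : ℕ)
  /-- `r := mem[a]` -/
  | load (r a : ℕ)
  /-- `mem[a] := b` -/
  | store (a b : ℕ)
  | seq (p q : Program)
  /-- `if a < b then p else q` -/
  | ifLt (a b : ℕ) (p q : Program)
  /-- `while a < b do p` -/
  | whileLt (a b : ℕ) (p : Program)

def State.setReg (s : State) (r x : ℕ) : State :=
  { s with reg := Function.update s.reg r x }

def State.setMem (s : State) (a x : ℕ) : State :=
  { s with mem := Function.update s.mem a x }

/-- `Run p s t s'`: started in state `s`, the program `p` halts after exactly `t` time units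
in state `s'`. -/
inductive Run : Program → State → ℕ → State → Prop
  | const (s : State) (r k : ℕ) : Run (.const r k) s 1 (s.setReg r k)
  | add (s : State) (r a b : ℕ) : Run (.add r a b) s 1 (s.setReg r (s.reg a + s.reg b))
  | sub (s : State) (r a b : ℕ) : Run (.sub r a b) s 1 (s.setReg r (s.reg a - s.reg b))
  | load (s : State) (r a : ℕ) : Run (.load r a) s 1 (s.setReg r (s.mem (s.reg a)))
  | store (s : State) (a b : ℕ) : Run (.store a b) s 1 (s.setMem (s.reg a) (s.reg b))
  | seq {p q : Program} {s s₁ s₂ : State} {t₁ t₂ : ℕ} :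
      Run p s t₁ s₁ → Run q s₁ t₂ s₂ → Run (.seq p q) s (t₁ + t₂) s₂
  | ifTrue {a b : ℕ} {p q : Program} {s s' : State} {t : ℕ} :
      s.reg a < s.reg b → Run p s t s' → Run (.ifLt a b p q) s (t + 1) s'
  | ifFalse {a b : ℕ} {p q : Program} {s s' : State} {t : ℕ} :
      ¬ s.reg a < s.reg b → Run q s t s' → Run (.ifLt a b p q) s (t + 1) s'
  | whileDone {a b : ℕ} {p : Program} {s : State} :
      ¬ s.reg a < s.reg b → Run (.whileLt a b p) s 1 s
  | whileStep {a b : ℕ} {p : Program} {s s₁ s₂ : State} {t₁ t₂ : ℕ} :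
      s.reg a < s.reg b → Run p s t₁ s₁ → Run (.whileLt a b p) s₁ t₂ s₂ →
        Run (.whileLt a b p) s (t₁ + t₂ + 1) s₂

/-- The initial memory for a graph on `Fin n`: the adjacency matrix, row by row, in the cells
`0, …, n² - 1`, followed by the `n` numbers that represent the vertex weights; all other cells
hold `0`. -/
noncomputable def inputMem {n : ℕ} (G : SimpleGraph (Fin n)) (code : Fin n → ℕ) (a : ℕ) : ℕ :=
  if ∃ i j : Fin n, a = i * n + j ∧ G.Adj i j then 1
  else if h : n * n ≤ a ∧ a - n * n < n then code ⟨a - n * n, h.2⟩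
  else 0

/-- The initial state: register `0` holds `n`, register `1` holds the additional argument `x`,
the memory holds the graph and its weights, everything else is `0`. -/
noncomputable def input {n : ℕ} (G : SimpleGraph (Fin n)) (code : Fin n → ℕ) (x : ℕ) : State where
  reg r := if r = 0 then n else if r = 1 then x else 0
  mem := inputMem G code

/-- A final state reports the vertex set `D`: register `0` holds `1`, and the cells `0, …, n - 1`
hold the characteristic vector of `D`. -/
def Reports {n : ℕ} (s : State) (D : Finset (Fin n)) : Prop :=
  s.reg 0 = 1 ∧ ∀ i : Fin n, s.mem i = if i ∈ D then 1 else 0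

/-- A final state reports that there is no solution. -/
def ReportsNone (s : State) : Prop :=
  s.reg 0 = 0

/-- Encoding of a weight in `ℕ ∪ {∞}` by a natural number. -/
noncomputable def weightCode (w : ℕ∞) : ℕ :=
  if w = ⊤ then 0 else w.toNat + 1

end WED

namespace WED

/-! ### A small language with arrays, bounded sums and bounded loops -/

/-! Write N[x] for the closed neighbourhood of x, and call two vertices far if their closed
neighbourhoods are disjoint, that is, if their distance is at least three. The vertices of an e.d. D
are pairwise far.

Structure. Fix r in D. If a vertex u at distance two from r has a neighbour q far from r, then the
dominator of q also dominates u; otherwise there is an induced S_{1,2,2} with centre u, whose legs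
run to the dominator of u, over q to the dominator of q, and over a common neighbour to r
(`dom_of_adj_of_far`). Excluding 2P_3 makes every vertex at distance two from r adjacent to every
P_3 far from r. Together, the dominator of each vertex at distance two dominates a vertex of each
such P_3 (`exists_dom_of_isP3`). A P_3 far from r whose vertices have few dominators is therefore
impossible if the vertices at distance two have many: with three dominators, the vertices far from r
induce a disjoint union of cliques (`restCliques_of_three`). Applied to v, this gives the structure
of the components of G[R]; primality enters because two vertices of U(Q) would form a homogeneous
set (`joined_subsingleton`).

In general, either the vertices far from some r in D induce disjoint cliques, or at most three
vertices of D lie in components of G that are not cliques (`exists_restCliques_or_card_le`). In both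
cases a small set T, namely {r} or those at most three vertices, determines D up to harmless
exchanges. The vertices far from T induce cliques, each with one vertex d of D, and N[q] ⊆ N[d] for
every q in the clique of d. Hence a vertex of the clique with largest degree, and of least weight
among these, can replace d (`candidate_spec`).

Algorithm. This leaves n + 1 candidates: one for every single vertex, and one for a lightest cover
by at most three vertices of the components that are not cliques. Such a cover is found among all
triples, with a constant time test for each: pairwise far vertices outside the clique components
cover everything else exactly when their numbers of dominated vertices add up correctly
(`exists_dom_of_sum_eq`). Every candidate is tested in quadratic time before it is recorded, so
whatever is reported is an e.d.; that the graph is free of the two subgraphs is needed only for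
optimality and for negative answers.

For G_v the same search runs in G with weight 0 at v and a prohibitive weight on the neighbours of v
and on the vertices of infinite weight. The e.d. of G below the prohibitive weight are v together
with the e.d. of G_v of finite weight. Sets of at most two vertices of G_v become triples of G.

Running time. The algorithms are written in a small language with bounded loops and sums over m = n
+ 1 indices. A compiled command runs in time O(m ^ depth), where the depth is the nesting of loops
and sums (`Cmd.runs_compile`), and the three commands have depth at most three. -/

/-- The memory of the small language: variables, two-dimensional arrays, and the input cells. -/
structure Store where
  var : ℕ → ℕ
  arr : ℕ → ℕ → ℕ → ℕ
  low : ℕ → ℕ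

def Store.set (s : Store) (r x : ℕ) : Store :=
  { s with var := Function.update s.var r x }

/-- `s.setArr k f` replaces the array `k`. -/
def Store.setArr (s : Store) (k : ℕ) (f : ℕ → ℕ → ℕ) : Store :=
  { s with arr := Function.update s.arr k f }

def Store.setLow (s : Store) (a x : ℕ) : Store :=
  { s with low := Function.update s.low a x }

inductive Expr where
  | const (k : ℕ)
  | var (r : ℕ)
  | add (a b : Expr)
  | sub (a b : Expr)
  | lt (a b : Expr)
  | ite (c a b : Expr)
  | get (k : ℕ) (i j : Expr)
  | low (a : Expr)
  | sum (i : ℕ) (a : Expr)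

/-- The value of an expression. Array indices and the index of a sum range below `m`. -/
noncomputable def Expr.eval (m : ℕ) : Expr → Store → ℕ
  | .const k, _ => k
  | .var r, s => s.var r
  | .add a b, s => a.eval m s + b.eval m s
  | .sub a b, s => a.eval m s - b.eval m s
  | .lt a b, s => if a.eval m s < b.eval m s then 1 else 0
  | .ite c a b, s => if c.eval m s = 0 then b.eval m s else a.eval m s
  | .get k i j, s =>
      if i.eval m s < m ∧ j.eval m s < m then s.arr k (i.eval m s) (j.eval m s) else 0
  | .low a, s => if a.eval m s < m * m then s.low (a.eval m s) else 0
  | .sum i a, s => ∑ k ∈ Finset.range m, a.eval m (s.set i k)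

inductive Cmd where
  | set (r : ℕ) (e : Expr)
  | put (k : ℕ) (i j e : Expr)
  | putLow (a e : Expr)
  | seq (p q : Cmd)
  | ite (c : Expr) (p q : Cmd)
  | loop (i : ℕ) (p : Cmd)

/-- The store after performing `f 0, …, f (k - 1)`. -/
def iter (f : ℕ → Store → Store) : ℕ → Store → Store
  | 0, s => s
  | k + 1, s => f k (iter f k s)

/-- The effect of a command. The variable of a loop is local to the loop. -/
noncomputable def Cmd.eval (m : ℕ) : Cmd → Store → Store
  | .set r e, s => s.set r (e.eval m s)
  | .put k i j e, s =>
      if i.eval m s < m ∧ j.eval m s < m then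
        s.setArr k (Function.update (s.arr k) (i.eval m s)
          (Function.update (s.arr k (i.eval m s)) (j.eval m s) (e.eval m s)))
      else s
  | .putLow a e, s => if a.eval m s < m * m then s.setLow (a.eval m s) (e.eval m s) else s
  | .seq p q, s => q.eval m (p.eval m s)
  | .ite c p q, s => if c.eval m s = 0 then q.eval m s else p.eval m s
  | .loop i p, s => (iter (fun k s => p.eval m (s.set i k)) m s).set i (s.var i)

/-! ### Compilation -/

/-- The register for the temporary value number `d`. -/
def tmp (d : ℕ) : ℕ := 2 * d + 9

/-- Adds `k` times the square of the array bound to the temporary value `d`. -/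
def addSquares (d : ℕ) : ℕ → Program
  | 0 => .const 1 0
  | k + 1 => .seq (.add (tmp d) (tmp d) 7) (addSquares d k)

/-- Computes the address of the entry of the array `k` whose indices are the temporary values
`d` and `d + 1`. -/
def addressOf (k d : ℕ) : Program :=
  .seq (.add (tmp d) (tmp d) 7) (.seq (.load (tmp d) (tmp d))
    (.seq (.add (tmp d) (tmp d) (tmp (d + 1))) (addSquares d (k + 2))))

/-- The value is left in the temporary `d`, and the temporaries below `d` survive. Registers `3`,
`5`, `7` permanently hold `1`, `m`, `m * m`; thus comparing with register `3` tests for zero.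
Copying is clearing followed by adding. -/
def Expr.compile : Expr → ℕ → Program
  | .const k, d => .const (tmp d) k
  | .var r, d => .seq (.const (tmp d) 0) (.add (tmp d) (tmp d) (2 * r))
  | .add a b, d => .seq (a.compile d) (.seq (b.compile (d + 1))
      (.add (tmp d) (tmp d) (tmp (d + 1))))
  | .sub a b, d => .seq (a.compile d) (.seq (b.compile (d + 1))
      (.sub (tmp d) (tmp d) (tmp (d + 1))))
  | .lt a b, d => .seq (a.compile d) (.seq (b.compile (d + 1))
      (.ifLt (tmp d) (tmp (d + 1)) (.const (tmp d) 1) (.const (tmp d) 0)))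
  | .ite c a b, d => .seq (c.compile d) (.ifLt (tmp d) 3 (b.compile d) (a.compile d))
  | .get k i j, d => .seq (i.compile d) (.seq (j.compile (d + 1))
      (.ifLt (tmp d) 5
        (.ifLt (tmp (d + 1)) 5 (.seq (addressOf k d) (.load (tmp d) (tmp d))) (.const (tmp d) 0))
        (.const (tmp d) 0)))
  | .low a, d => .seq (a.compile d)
      (.ifLt (tmp d) 7 (.load (tmp d) (tmp d)) (.const (tmp d) 0))
  | .sum i a, d =>
      .seq (.const (tmp d) 0) (.seq (.const (tmp (d + 1)) 0)
        (.seq (.const (tmp (d + 2)) 0) (.seq (.add (tmp (d + 2)) (tmp (d + 2)) (2 * i))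
          (.seq (.whileLt (tmp (d + 1)) 5
            (.seq (.const (2 * i) 0) (.seq (.add (2 * i) (2 * i) (tmp (d + 1)))
              (.seq (a.compile (d + 3)) (.seq (.add (tmp d) (tmp d) (tmp (d + 3)))
                (.add (tmp (d + 1)) (tmp (d + 1)) 3))))))
            (.seq (.const (2 * i) 0) (.add (2 * i) (2 * i) (tmp (d + 2))))))))

def Cmd.compile : Cmd → ℕ → Program
  | .set r e, d => .seq (e.compile d) (.seq (.const (2 * r) 0) (.add (2 * r) (2 * r) (tmp d)))
  | .put k i j e, d => .seq (i.compile d) (.seq (j.compile (d + 1)) (.seq (e.compile (d + 2))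
      (.ifLt (tmp d) 5
        (.ifLt (tmp (d + 1)) 5 (.seq (addressOf k d) (.store (tmp d) (tmp (d + 2)))) (.const 1 0))
        (.const 1 0))))
  | .putLow a e, d => .seq (a.compile d) (.seq (e.compile (d + 1))
      (.ifLt (tmp d) 7 (.store (tmp d) (tmp (d + 1))) (.const 1 0)))
  | .seq p q, d => .seq (p.compile d) (q.compile d)
  | .ite c p q, d => .seq (c.compile d) (.ifLt (tmp d) 3 (q.compile d) (p.compile d))
  | .loop i p, d =>
      .seq (.const (tmp d) 0) (.seq (.const (tmp (d + 1)) 0)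
        (.seq (.add (tmp (d + 1)) (tmp (d + 1)) (2 * i))
          (.seq (.whileLt (tmp d) 5
            (.seq (.const (2 * i) 0) (.seq (.add (2 * i) (2 * i) (tmp d))
              (.seq (p.compile (d + 2)) (.add (tmp d) (tmp d) 3)))))
            (.seq (.const (2 * i) 0) (.add (2 * i) (2 * i) (tmp (d + 1)))))))

/-- The nesting depth of the sums. -/
def Expr.depth : Expr → ℕ
  | .const _ => 0
  | .var _ => 0
  | .add a b => max a.depth b.depth
  | .sub a b => max a.depth b.depth
  | .lt a b => max a.depth b.depth
  | .ite c a b => max c.depth (max a.depth b.depth)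
  | .get _ i j => max i.depth j.depth
  | .low a => a.depth
  | .sum _ a => a.depth + 1

/-- The nesting depth of the sums and loops. -/
def Cmd.depth : Cmd → ℕ
  | .set _ e => e.depth
  | .put _ i j e => max i.depth (max j.depth e.depth)
  | .putLow a e => max a.depth e.depth
  | .seq p q => max p.depth q.depth
  | .ite c p q => max c.depth (max p.depth q.depth)
  | .loop _ p => p.depth + 1

/-- `Runs p s T Q`: started in `s`, the program `p` halts after at most `T` time units in a state
that satisfies `Q`. -/
def Runs (p : Program) (s : State) (T : ℕ) (Q : State → Prop) : Prop :=
  ∃ t s', Run p s t s' ∧ t ≤ T ∧ Q s'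

/-! ### Rules for bounding the time of machine programs -/

namespace Runs

variable {p q : Program} {s : State} {T T₁ T₂ : ℕ} {Q Q' : State → Prop} {r k a b : ℕ}

theorem mono (h : Runs p s T₁ Q') (hT : T₁ ≤ T) (hQ : ∀ s, Q' s → Q s) : Runs p s T Q := by
  obtain ⟨t, s', h₁, h₂, h₃⟩ := h
  exact ⟨t, s', h₁, h₂.trans hT, hQ _ h₃⟩

theorem const (h : Q (s.setReg r k)) : Runs (.const r k) s 1 Q := ⟨1, _, .const .., le_rfl, h⟩

theorem add (h : Q (s.setReg r (s.reg a + s.reg b))) : Runs (.add r a b) s 1 Q :=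
  ⟨1, _, .add .., le_rfl, h⟩

theorem sub (h : Q (s.setReg r (s.reg a - s.reg b))) : Runs (.sub r a b) s 1 Q :=
  ⟨1, _, .sub .., le_rfl, h⟩

theorem load (h : Q (s.setReg r (s.mem (s.reg a)))) : Runs (.load r a) s 1 Q :=
  ⟨1, _, .load .., le_rfl, h⟩

theorem store (h : Q (s.setMem (s.reg a) (s.reg b))) : Runs (.store a b) s 1 Q :=
  ⟨1, _, .store .., le_rfl, h⟩

theorem seq (h : Runs p s T₁ fun s' => Runs q s' T₂ Q) : Runs (.seq p q) s (T₁ + T₂) Q := by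
  obtain ⟨t, s', h₁, h₂, t', s'', h₃, h₄, h₅⟩ := h
  exact ⟨_, _, .seq h₁ h₃, by omega, h₅⟩

theorem ifLt (h₁ : s.reg a < s.reg b → Runs p s T Q) (h₂ : ¬ s.reg a < s.reg b → Runs q s T Q) :
    Runs (.ifLt a b p q) s (T + 1) Q := by
  by_cases h : s.reg a < s.reg b
  · obtain ⟨t, s', h₃, h₄, h₅⟩ := h₁ h
    exact ⟨_, _, .ifTrue h h₃, by omega, h₅⟩
  · obtain ⟨t, s', h₃, h₄, h₅⟩ := h₂ h
    exact ⟨_, _, .ifFalse h h₃, by omega, h₅⟩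

/-- A loop that counts up to `m`. -/
theorem whileLt {m : ℕ} (I : ℕ → State → Prop)
    (hI : ∀ k s, I k s → s.reg a = k ∧ s.reg b = m)
    (step : ∀ k < m, ∀ s, I k s → Runs p s T (I (k + 1))) (h : I 0 s) :
    Runs (.whileLt a b p) s (m * (T + 1) + 1) (I m) := by
  -- Induction on the number `l` of remaining rounds; each round costs its body and one test, and
  -- the last test fails.
  suffices H : ∀ l k, k + l = m → ∀ s, I k s →
      Runs (.whileLt a b p) s (l * (T + 1) + 1) (I m) from H m 0 (by omega) s h
  intro l
  induction l with
  | zero =>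
    intro k hk s hs
    obtain ⟨h₁, h₂⟩ := hI k s hs
    obtain rfl : k = m := by omega
    exact ⟨1, s, .whileDone (by omega), by omega, hs⟩
  | succ l ih =>
    intro k hk s hs
    obtain ⟨h₁, h₂⟩ := hI k s hs
    obtain ⟨t, s', h₃, h₄, h₅⟩ := step k (by omega) s hs
    obtain ⟨t', s'', h₆, h₇, h₈⟩ := ih (k + 1) (by omega) s' h₅
    exact ⟨_, _, .whileStep (by omega) h₃ h₆, by rw [Nat.succ_mul]; omega, h₈⟩

end Runs

/-- The machine state `s` represents the store `σ`, whose arrays have the bound `m`. -/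
structure Sim (m : ℕ) (σ : Store) (s : State) : Prop where
  one : s.reg 3 = 1
  bound : s.reg 5 = m
  square : s.reg 7 = m * m
  var : ∀ r, s.reg (2 * r) = σ.var r
  low : ∀ a < m * m, s.mem a = σ.low a
  row : ∀ i < m, s.mem (m * m + i) = i * m
  arr : ∀ k, ∀ i < m, ∀ j < m, s.mem ((k + 2) * (m * m) + (i * m + j)) = σ.arr k i j

/-! ### Correctness and running time of compiled programs -/

section Simulation

variable {m : ℕ} {σ : Store} {s : State}

theorem Sim.setTmp (h : Sim m σ s) (d x : ℕ) : Sim m σ (s.setReg (tmp d) x) := by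
  obtain ⟨h₁, h₂, h₃, h₄, h₅, h₆, h₇⟩ := h
  refine ⟨?_, ?_, ?_, fun r => ?_, h₅, h₆, h₇⟩ <;> simp only [State.setReg, tmp] <;>
    rw [Function.update_of_ne (by omega)] <;> simp [*]

theorem Sim.setVar (h : Sim m σ s) (r x : ℕ) : Sim m (σ.set r x) (s.setReg (2 * r) x) := by
  obtain ⟨h₁, h₂, h₃, h₄, h₅, h₆, h₇⟩ := h
  refine ⟨?_, ?_, ?_, fun r' => ?_, h₅, h₆, h₇⟩
  · simp only [State.setReg]; rw [Function.update_of_ne (by omega)]; simp [*]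
  · simp only [State.setReg]; rw [Function.update_of_ne (by omega)]; simp [*]
  · simp only [State.setReg]; rw [Function.update_of_ne (by omega)]; simp [*]
  · by_cases hr : r' = r
    · subst hr; simp [State.setReg, Store.set]
    · simp only [State.setReg, Store.set]
      rw [Function.update_of_ne (by omega), Function.update_of_ne hr, h₄]

/-- Register `1` takes no part in the representation, so writing to it serves as the empty
instruction. -/
theorem Sim.setScratch (h : Sim m σ s) (x : ℕ) : Sim m σ (s.setReg 1 x) := by
  obtain ⟨h₁, h₂, h₃, h₄, h₅, h₆, h₇⟩ := h
  refine ⟨?_, ?_, ?_, fun r => ?_, h₅, h₆, h₇⟩ <;> simp only [State.setReg] <;>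
    rw [Function.update_of_ne (by omega)] <;> simp [*]

theorem entry_lt {i j : ℕ} (hi : i < m) (hj : j < m) : i * m + j < m * m := by
  have : (i + 1) * m ≤ m * m := Nat.mul_le_mul_right m hi
  rw [Nat.succ_mul] at this
  omega

/-- Division with remainder. It is used for the two indices of an entry and, with `m * m` in place
of `m`, for the number of an array and the position in it. -/
theorem entry_inj {i j i' j' : ℕ} (hj : j < m) (hj' : j' < m) (h : i * m + j = i' * m + j') :
    i = i' ∧ j = j' := by
  have hm : 0 < m := by omega
  have h₁ := congrArg (· / m) h
  have h₂ := congrArg (· % m) h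
  simp only [Nat.mul_comm _ m, Nat.mul_add_div hm, Nat.mul_add_mod, Nat.div_eq_of_lt hj,
    Nat.div_eq_of_lt hj', Nat.mod_eq_of_lt hj, Nat.mod_eq_of_lt hj'] at h₁ h₂
  exact ⟨by omega, h₂⟩

theorem Sim.setLow (h : Sim m σ s) {a : ℕ} (ha : a < m * m) (x : ℕ) :
    Sim m (σ.setLow a x) (s.setMem a x) := by
  obtain ⟨h₁, h₂, h₃, h₄, h₅, h₆, h₇⟩ := h
  refine ⟨h₁, h₂, h₃, h₄, fun b hb => ?_, fun i hi => ?_, fun k i hi j hj => ?_⟩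
  · simp only [State.setMem, Store.setLow, Function.update_apply, h₅ b hb]
  · simp only [State.setMem]
    rw [Function.update_of_ne (by omega), h₆ i hi]
  · simp only [State.setMem, Store.setLow]
    rw [Function.update_of_ne (by rw [Nat.add_mul]; omega), h₇ k i hi j hj]

/-- The input cells end before `m * m`, the row table before `2 * (m * m)`, and the arrays follow in
blocks of size `m * m`; two applications of `entry_inj` separate distinct entries. -/
theorem Sim.setArr (h : Sim m σ s) (k : ℕ) {i j : ℕ} (hi : i < m) (hj : j < m) (x : ℕ) :
    Sim m (σ.setArr k (Function.update (σ.arr k) i (Function.update (σ.arr k i) j x)))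
      (s.setMem ((k + 2) * (m * m) + (i * m + j)) x) := by
  obtain ⟨h₁, h₂, h₃, h₄, h₅, h₆, h₇⟩ := h
  have hm : m ≤ m * m := Nat.le_mul_self m
  refine ⟨h₁, h₂, h₃, h₄, fun b hb => ?_, fun i' hi' => ?_, fun k' i' hi' j' hj' => ?_⟩
  · simp only [State.setMem, Store.setArr]
    rw [Function.update_of_ne (by rw [Nat.add_mul]; omega), h₅ b hb]
  · simp only [State.setMem]
    rw [Function.update_of_ne (by rw [Nat.add_mul]; omega), h₆ i' hi']
  · simp only [State.setMem, Store.setArr]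
    by_cases hk : k' = k
    · subst hk
      by_cases hij : i' = i ∧ j' = j
      · obtain ⟨rfl, rfl⟩ := hij
        simp
      · rw [Function.update_of_ne, h₇ k' i' hi' j' hj', Function.update_self]
        · by_cases hii : i' = i
          · subst hii
            rw [Function.update_self, Function.update_of_ne (fun h => hij ⟨rfl, h⟩)]
          · rw [Function.update_of_ne hii]
        · intro h
          exact hij (entry_inj hj' hj (by omega))
    · rw [Function.update_of_ne, h₇ k' i' hi' j' hj', Function.update_of_ne hk]
      intro h
      have := entry_inj (m := m * m) (entry_lt hi' hj') (entry_lt hi hj) h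
      omega

theorem State.setReg_self (s : State) (r x : ℕ) : (s.setReg r x).reg r = x := by
  simp [State.setReg]

theorem State.setReg_ne (s : State) {r r' : ℕ} (x : ℕ) (h : r' ≠ r) :
    (s.setReg r x).reg r' = s.reg r' := by
  simp [State.setReg, h]

theorem State.setReg_mem (s : State) (r x : ℕ) : (s.setReg r x).mem = s.mem := rfl

theorem tmp_ne {d d' : ℕ} (h : d ≠ d') : tmp d ≠ tmp d' := by simp [tmp, h]

theorem tmp_ne_var (d r : ℕ) : tmp d ≠ 2 * r := by simp only [tmp]; omega

/-- After a computation at level `d` the state represents `σ`, and the temporary values below `d`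
are those of `s`. -/
def Keeps (m : ℕ) (σ : Store) (s : State) (d : ℕ) (s' : State) : Prop :=
  Sim m σ s' ∧ ∀ d' < d, s'.reg (tmp d') = s.reg (tmp d')

theorem runs_addSquares (h : Sim m σ s) (d k : ℕ) :
    Runs (addSquares d k) s (k + 1) fun s' =>
      Sim m σ s' ∧ s'.reg (tmp d) = s.reg (tmp d) + k * (m * m) ∧
        ∀ d' ≠ d, s'.reg (tmp d') = s.reg (tmp d') := by
  induction k generalizing s with
  | zero =>
    refine .const ⟨h.setScratch 0, ?_, fun d' _ => ?_⟩ <;>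
      rw [State.setReg_ne _ _ (by simp only [tmp]; omega)]
    omega
  | succ k ih =>
    rw [show k + 1 + 1 = 1 + (k + 1) by omega]
    refine .seq (.add ((ih (h.setTmp d _)).mono le_rfl ?_))
    rintro s' ⟨h₁, h₂, h₃⟩
    refine ⟨h₁, ?_, fun d' hd' => ?_⟩
    · rw [h₂, State.setReg_self, h.square, Nat.succ_mul]; omega
    · rw [h₃ d' hd', State.setReg_ne _ _ (tmp_ne hd')]

/-- The machine cannot multiply. Adding `m * m` to the row index gives the table cell that holds the
row address; the column index and `k + 2` squares are then added, in time that depends only on `k`.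
-/
theorem runs_addressOf (h : Sim m σ s) (k d : ℕ) (hd : s.reg (tmp d) < m) :
    Runs (addressOf k d) s (k + 6) fun s' =>
      Sim m σ s' ∧
        s'.reg (tmp d) = (k + 2) * (m * m) + (s.reg (tmp d) * m + s.reg (tmp (d + 1))) ∧
        ∀ d' ≠ d, s'.reg (tmp d') = s.reg (tmp d') := by
  rw [show k + 6 = 1 + (1 + (1 + (k + 2 + 1))) by omega]
  refine .seq (.add (.seq (.load (.seq (.add
    ((runs_addSquares (m := m) (σ := σ) ?_ d (k + 2)).mono le_rfl ?_))))))
  · exact ((h.setTmp d _).setTmp d _).setTmp d _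
  · rintro s' ⟨h₁, h₂, h₃⟩
    refine ⟨h₁, ?_, fun d' hd' => ?_⟩
    · rw [h₂]
      simp only [State.setReg_self, State.setReg_mem, h.square,
        State.setReg_ne _ _ (tmp_ne (show d + 1 ≠ d by omega))]
      rw [Nat.add_comm (s.reg (tmp d)), h.row _ hd]
      omega
    · rw [h₃ d' hd']
      simp only [State.setReg_ne _ _ (tmp_ne hd')]

/-- Since `m ≥ 1`, smaller powers and additive constants are absorbed by the coefficient of a larger
power. -/
theorem le_mul_pow {t a b K e f : ℕ} (hm : 1 ≤ m) (h : t ≤ a * m ^ e) (hK : a + b ≤ K)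
    (hf : e ≤ f) : t + b ≤ K * m ^ f := by
  have h₁ : a * m ^ e ≤ a * m ^ f := Nat.mul_le_mul_left _ (Nat.pow_le_pow_right hm hf)
  have h₂ : b * 1 ≤ b * m ^ f := Nat.mul_le_mul_left _ (Nat.one_le_pow _ _ hm)
  have h₃ : (a + b) * m ^ f ≤ K * m ^ f := Nat.mul_le_mul_right _ hK
  rw [Nat.add_mul] at h₃
  omega

/-- The expression `e` is computed in time `O(m ^ e.depth)`. -/
theorem Expr.runs_compile (e : Expr) : ∃ K, ∀ {m : ℕ} {σ : Store} {s : State} (d : ℕ), 1 ≤ m →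
    Sim m σ s → Runs (e.compile d) s (K * m ^ e.depth) fun s' =>
      Keeps m σ s d s' ∧ s'.reg (tmp d) = e.eval m σ := by
  -- The second operand is computed at level `d + 1`, which preserves the value of the first one in
  -- the temporary `d`.
  have binary : ∀ {a b : Expr} {p : ℕ → Program} {K₁ K₂ c : ℕ} {f : ℕ → ℕ → ℕ},
      (∀ {m : ℕ} {σ : Store} {s : State} (d : ℕ), 1 ≤ m →
        Sim m σ s → Runs (a.compile d) s (K₁ * m ^ a.depth) fun s' =>
          Keeps m σ s d s' ∧ s'.reg (tmp d) = a.eval m σ) →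
      (∀ {m : ℕ} {σ : Store} {s : State} (d : ℕ), 1 ≤ m →
        Sim m σ s → Runs (b.compile d) s (K₂ * m ^ b.depth) fun s' =>
          Keeps m σ s d s' ∧ s'.reg (tmp d) = b.eval m σ) →
      (∀ {m : ℕ} {σ : Store} {s : State} (d : ℕ), Sim m σ s → Runs (p d) s c fun s' =>
        Keeps m σ s d s' ∧ s'.reg (tmp d) = f (s.reg (tmp d)) (s.reg (tmp (d + 1)))) →
      ∀ {m : ℕ} {σ : Store} {s : State} (d : ℕ), 1 ≤ m → Sim m σ s →
        Runs (.seq (a.compile d) (.seq (b.compile (d + 1)) (p d))) s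
          ((K₁ + K₂ + c) * m ^ max a.depth b.depth) fun s' =>
          Keeps m σ s d s' ∧ s'.reg (tmp d) = f (a.eval m σ) (b.eval m σ) := by
    intro a b p K₁ K₂ c f ha hb hp m σ s d hm h
    refine (Runs.seq (T₂ := K₂ * m ^ b.depth + c) ((ha d hm h).mono le_rfl ?_)).mono ?_
      fun _ h => h
    · rintro s₁ ⟨⟨h₁, h₂⟩, h₃⟩
      refine .seq ((hb (d + 1) hm h₁).mono le_rfl ?_)
      rintro s₂ ⟨⟨h₄, h₅⟩, h₆⟩
      refine (hp d h₄).mono le_rfl ?_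
      rintro s₃ ⟨⟨h₇, h₈⟩, h₉⟩
      refine ⟨⟨h₇, fun d' hd' => ?_⟩, ?_⟩
      · rw [h₈ d' hd', h₅ d' (by omega), h₂ d' hd']
      · rw [h₉, h₆, h₅ d (by omega), h₃]
    · have h₁ := le_mul_pow (b := 0) hm (le_refl (K₁ * m ^ a.depth)) le_rfl
        (le_max_left a.depth b.depth)
      have h₂ := le_mul_pow (b := c) hm (le_refl (K₂ * m ^ b.depth)) le_rfl
        (le_max_right a.depth b.depth)
      rw [Nat.add_zero] at h₁
      rw [Nat.add_assoc, Nat.add_mul]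
      exact Nat.add_le_add h₁ h₂
  have keep : ∀ {m : ℕ} {σ : Store} {s : State} (d x : ℕ), Sim m σ s →
      Keeps m σ s d (s.setReg (tmp d) x) := fun d x h =>
    ⟨h.setTmp d x, fun d' hd' => State.setReg_ne _ _ (tmp_ne (by omega))⟩
  have result : ∀ {m : ℕ} {σ : Store} {s : State} {d x y : ℕ}, Sim m σ s → x = y →
      Keeps m σ s d (s.setReg (tmp d) x) ∧ (s.setReg (tmp d) x).reg (tmp d) = y :=
    fun h hxy => ⟨keep _ _ h, by rw [State.setReg_self, hxy]⟩
  induction e with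
  | const k =>
    exact ⟨1, fun d hm h => Runs.mono (.const (result h rfl)) (by simp [depth]) fun _ h => h⟩
  | var r =>
    refine ⟨2, fun {m σ s} d hm h => Runs.mono (.seq (.const (.add ?_))) (by simp [depth])
      fun _ h => h⟩
    refine ⟨⟨(h.setTmp d _).setTmp d _, fun d' hd' => ?_⟩, ?_⟩
    · simp only [State.setReg_ne _ _ (tmp_ne (show d' ≠ d by omega))]
    · rw [State.setReg_self, State.setReg_self, State.setReg_ne _ _ (tmp_ne_var d r).symm, h.var,
        Nat.zero_add, eval]
  | add a b iha ihb =>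
    obtain ⟨K₁, ha⟩ := iha
    obtain ⟨K₂, hb⟩ := ihb
    exact ⟨_, fun d hm h => binary (f := fun x y => x + y) ha hb
      (fun d h => .add (result h rfl)) d hm h⟩
  | sub a b iha ihb =>
    obtain ⟨K₁, ha⟩ := iha
    obtain ⟨K₂, hb⟩ := ihb
    exact ⟨_, fun d hm h => binary (f := fun x y => x - y) ha hb
      (fun d h => .sub (result h rfl)) d hm h⟩
  | lt a b iha ihb =>
    obtain ⟨K₁, ha⟩ := iha
    obtain ⟨K₂, hb⟩ := ihb
    exact ⟨_, fun d hm h => binary (f := fun x y => if x < y then 1 else 0) ha hb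
      (fun d h => .ifLt (fun hlt => .const (result h (if_pos hlt).symm))
        fun hlt => .const (result h (if_neg hlt).symm)) d hm h⟩
  | get k i j iha ihb =>
    obtain ⟨K₁, ha⟩ := iha
    obtain ⟨K₂, hb⟩ := ihb
    refine ⟨K₁ + K₂ + (k + 6 + 1 + 1 + 1), fun {m σ s} d hm h => ?_⟩
    refine (Runs.seq ((ha d hm h).mono le_rfl (Q := fun s₁ => Runs _ s₁ (K₂ * m ^ j.depth +
      (k + 6 + 1 + 1 + 1)) fun s' => Keeps m σ s d s' ∧ s'.reg (tmp d) = (get k i j).eval m σ)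
      ?_)).mono ?_ fun _ h => h
    · rintro s₁ ⟨⟨h₁, h₂⟩, h₃⟩
      refine .seq ((hb (d + 1) hm h₁).mono le_rfl ?_)
      rintro s₂ ⟨⟨h₄, h₅⟩, h₆⟩
      have hd : s₂.reg (tmp d) = i.eval m σ := by rw [h₅ d (by omega), h₃]
      have fin : ∀ x, x = (get k i j).eval m σ → Keeps m σ s d (s₂.setReg (tmp d) x) ∧
          (s₂.setReg (tmp d) x).reg (tmp d) = (get k i j).eval m σ := by
        refine fun x hx => ⟨⟨h₄.setTmp d x, fun d' hd' => ?_⟩, by rw [State.setReg_self, hx]⟩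
        rw [State.setReg_ne _ _ (tmp_ne (show d' ≠ d by omega)), h₅ d' (by omega), h₂ d' hd']
      have zero : ¬ (i.eval m σ < m ∧ j.eval m σ < m) → ∀ T, 1 ≤ T →
          Runs (.const (tmp d) 0) s₂ T fun s' =>
            Keeps m σ s d s' ∧ s'.reg (tmp d) = (get k i j).eval m σ := fun hn T hT =>
        Runs.mono (.const (fin 0 (by rw [eval, if_neg hn]))) hT fun _ h => h
      refine .ifLt (fun hi => .ifLt (fun hj => ?_) fun hj => zero ?_ _ (by omega))
        fun hi => zero ?_ _ (by omega)
      · rw [h₄.bound] at hi hj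
        refine Runs.seq (T₁ := k + 6) (T₂ := 1) ((runs_addressOf h₄ k d hi).mono le_rfl ?_)
        rintro s₃ ⟨h₇, h₈, h₉⟩
        refine .load ⟨⟨h₇.setTmp d _, fun d' hd' => ?_⟩, ?_⟩
        · rw [State.setReg_ne _ _ (tmp_ne (show d' ≠ d by omega)), h₉ d' (by omega),
            h₅ d' (by omega), h₂ d' hd']
        · rw [State.setReg_self, h₈, h₇.arr k _ hi _ hj, eval, if_pos, hd, h₆]
          rw [← hd, ← h₆]
          exact ⟨hi, hj⟩
      · rw [h₄.bound, h₆] at hj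
        exact fun h => hj h.2
      · rw [h₄.bound, hd] at hi
        exact fun h => hi h.1
    · have h₁ := le_mul_pow (b := 0) hm (le_refl (K₁ * m ^ i.depth)) le_rfl
        (le_max_left i.depth j.depth)
      have h₂ := le_mul_pow (b := k + 6 + 1 + 1 + 1) hm (le_refl (K₂ * m ^ j.depth)) le_rfl
        (le_max_right i.depth j.depth)
      rw [Nat.add_zero] at h₁
      rw [Nat.add_assoc K₁, Nat.add_mul]
      exact Nat.add_le_add h₁ h₂
  | ite c a b ihc iha ihb =>
    obtain ⟨K₁, hc⟩ := ihc
    obtain ⟨K₂, ha⟩ := iha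
    obtain ⟨K₃, hb⟩ := ihb
    refine ⟨K₁ + (K₂ + K₃ + 1), fun {m σ s} d hm h => ?_⟩
    set D := (ite c a b).depth with hD
    have hle₁ : c.depth ≤ D := by simp [hD, depth]
    have hle₂ : a.depth ≤ D := by simp [hD, depth]
    have hle₃ : b.depth ≤ D := by simp [hD, depth]
    have h₁ := le_mul_pow (b := 0) hm (le_refl (K₁ * m ^ c.depth)) le_rfl hle₁
    have h₂ := le_mul_pow (b := 0) hm (le_refl (K₂ * m ^ a.depth)) le_rfl hle₂
    have h₃ := le_mul_pow (b := 0) hm (le_refl (K₃ * m ^ b.depth)) le_rfl hle₃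
    have h₄ : 1 ≤ m ^ D := Nat.one_le_pow _ _ hm
    rw [Nat.add_zero, Nat.add_zero] at h₁ h₂ h₃
    refine (Runs.seq ((hc d hm h).mono le_rfl (Q := fun s₁ => Runs _ s₁ (K₂ * m ^ D + K₃ * m ^ D
      + 1) fun s' => Keeps m σ s d s' ∧ s'.reg (tmp d) = (ite c a b).eval m σ)
      ?_)).mono ?_ fun _ h => h
    · rintro s₁ ⟨⟨h₅, h₆⟩, h₇⟩
      refine .ifLt (fun hlt => (hb d hm h₅).mono (by omega) ?_)
        fun hlt => (ha d hm h₅).mono (by omega) ?_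
      · rintro s₂ ⟨⟨h₈, h₉⟩, h₁₀⟩
        refine ⟨⟨h₈, fun d' hd' => by rw [h₉ d' hd', h₆ d' hd']⟩, ?_⟩
        rw [h₅.one, h₇] at hlt
        rw [h₁₀, eval, if_pos (by omega)]
      · rintro s₂ ⟨⟨h₈, h₉⟩, h₁₀⟩
        refine ⟨⟨h₈, fun d' hd' => by rw [h₉ d' hd', h₆ d' hd']⟩, ?_⟩
        rw [h₅.one, h₇] at hlt
        rw [h₁₀, eval, if_neg (by omega)]
    · simp only [Nat.add_mul, Nat.one_mul]
      omega
  | low a iha =>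
    obtain ⟨K, ha⟩ := iha
    refine ⟨K + 2, fun {m σ s} d hm h => ?_⟩
    refine (Runs.seq ((ha d hm h).mono le_rfl (Q := fun s₁ => Runs _ s₁ 2
      fun s' => Keeps m σ s d s' ∧ s'.reg (tmp d) = (low a).eval m σ)
      ?_)).mono (le_mul_pow hm le_rfl le_rfl le_rfl) fun _ h => h
    rintro s₁ ⟨⟨h₁, h₂⟩, h₃⟩
    have fin : ∀ x, x = (low a).eval m σ → Keeps m σ s d (s₁.setReg (tmp d) x) ∧
        (s₁.setReg (tmp d) x).reg (tmp d) = (low a).eval m σ := by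
      refine fun x hx => ⟨⟨h₁.setTmp d x, fun d' hd' => ?_⟩, by rw [State.setReg_self, hx]⟩
      rw [State.setReg_ne _ _ (tmp_ne (show d' ≠ d by omega)), h₂ d' hd']
    refine .ifLt (fun hlt => .load (fin _ ?_)) fun hlt => .const (fin _ ?_)
    · rw [h₁.square] at hlt
      rw [h₁.low _ hlt, h₃, eval, if_pos (h₃ ▸ hlt)]
    · rw [h₁.square, h₃] at hlt
      rw [eval, if_neg hlt]
  | sum i a iha =>
    obtain ⟨K, ha⟩ := iha
    -- A round costs five units besides the summand, and seven units are spent outside the loop.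
    refine ⟨K + 12, fun {m σ s} d hm h => ?_⟩
    have n₁ : ∀ {d₁ d₂}, d₁ ≠ d₂ → ∀ (s : State) (x : ℕ),
        (s.setReg (tmp d₂) x).reg (tmp d₁) = s.reg (tmp d₁) :=
      fun hne s x => State.setReg_ne _ _ (tmp_ne hne)
    have n₂ : ∀ d₁ r (s : State) (x : ℕ),
        (s.setReg (2 * r) x).reg (tmp d₁) = s.reg (tmp d₁) :=
      fun d₁ r s x => State.setReg_ne _ _ (tmp_ne_var d₁ r)
    have n₃ : ∀ d₁ r (s : State) (x : ℕ),
        (s.setReg (tmp d₁) x).reg (2 * r) = s.reg (2 * r) :=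
      fun d₁ r s x => State.setReg_ne _ _ (tmp_ne_var d₁ r).symm
    have set_set : ∀ (s : Store) (r x y : ℕ), (s.set r x).set r y = s.set r y := by
      intro s r x y
      simp [Store.set]
    -- The temporaries `d`, `d + 1`, `d + 2` hold the partial sum, the counter, and the saved value
    -- of the index variable, whose present value `x` does not matter.
    let I : ℕ → State → Prop := fun k s' =>
      (∃ x, Sim m (σ.set i x) s') ∧ (∀ d' < d, s'.reg (tmp d') = s.reg (tmp d')) ∧
        s'.reg (tmp d) = ∑ k ∈ Finset.range k, a.eval m (σ.set i k) ∧
        s'.reg (tmp (d + 1)) = k ∧ s'.reg (tmp (d + 2)) = σ.var i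
    have loop : ∀ s', I 0 s' → Runs (.whileLt (tmp (d + 1)) 5
            (.seq (.const (2 * i) 0) (.seq (.add (2 * i) (2 * i) (tmp (d + 1)))
              (.seq (a.compile (d + 3)) (.seq (.add (tmp d) (tmp d) (tmp (d + 3)))
                (.add (tmp (d + 1)) (tmp (d + 1)) 3)))))) s'
                (m * ((1 + (1 + (K * m ^ a.depth + (1 + 1)))) + 1) + 1) (I m) := by
      intro s' hs'
      refine .whileLt I ?_ ?_ hs'
      · rintro k s₁ ⟨⟨x, h₁⟩, -, -, h₂, -⟩
        exact ⟨h₂, h₁.bound⟩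
      · rintro k hk s₁ ⟨⟨x, h₁⟩, h₂, h₃, h₄, h₅⟩
        have hsim := (h₁.setVar i 0).setVar i (0 + k)
        rw [set_set, set_set, Nat.zero_add] at hsim
        refine .seq (.const (.seq (.add ?_)))
        rw [State.setReg_self, n₂, h₄, Nat.zero_add]
        refine .seq ((ha (d + 3) hm hsim).mono le_rfl ?_)
        rintro s₂ ⟨⟨h₆, h₇⟩, h₈⟩
        refine .seq (.add (.add ⟨⟨k, (h₆.setTmp _ _).setTmp _ _⟩, fun d' hd' => ?_, ?_, ?_, ?_⟩))
        · rw [n₁ (by omega), n₁ (by omega), h₇ d' (by omega), n₂, n₂, h₂ d' hd']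
        · rw [n₁ (by omega), State.setReg_self, h₇ d (by omega), n₂, n₂, h₃, h₈,
            Finset.sum_range_succ]
        · rw [State.setReg_self, n₁ (by omega), h₇ _ (by omega), n₂, n₂, h₄,
            (h₆.setTmp _ _).one]
        · rw [n₁ (by omega), n₁ (by omega), h₇ _ (by omega), n₂, n₂, h₅]
    refine Runs.mono (T₁ := 1 + (1 + (1 + (1 +
      ((m * ((1 + (1 + (K * m ^ a.depth + (1 + 1)))) + 1) + 1) + (1 + 1))))))
      (.seq (.const (.seq (.const (.seq (.const (.seq (.add
        (.seq ((loop _ ?_).mono le_rfl ?_)))))))))) ?_ fun _ h => h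
    · refine ⟨⟨σ.var i, ?_⟩, fun d' hd' => ?_, ?_, ?_, ?_⟩
      · have : σ.set i (σ.var i) = σ := by simp [Store.set]
        rw [this]
        exact (((h.setTmp _ _).setTmp _ _).setTmp _ _).setTmp _ _
      · rw [n₁ (by omega), n₁ (by omega), n₁ (by omega), n₁ (by omega)]
      · rw [n₁ (by omega), n₁ (by omega), n₁ (by omega), State.setReg_self]
        simp
      · rw [n₁ (by omega), n₁ (by omega), State.setReg_self]
      · rw [State.setReg_self, State.setReg_self, n₃, n₃, n₃, h.var, Nat.zero_add]
    · rintro s₁ ⟨⟨x, h₁⟩, h₂, h₃, h₄, h₅⟩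
      refine .seq (.const (.add ⟨⟨?_, fun d' hd' => ?_⟩, ?_⟩))
      · rw [State.setReg_self, n₂, h₅, Nat.zero_add]
        have hsim := (h₁.setVar i 0).setVar i (σ.var i)
        rw [set_set, set_set, show σ.set i (σ.var i) = σ by simp [Store.set]] at hsim
        exact hsim
      · rw [n₂, n₂, h₂ d' hd']
      · rw [n₂, n₂, h₃, eval]
    · have h₁ : 1 ≤ m ^ a.depth := Nat.one_le_pow _ _ hm
      have h₂ : m * 1 ≤ m * m ^ a.depth := Nat.mul_le_mul_left _ h₁
      rw [depth, Nat.pow_succ, Nat.mul_comm (m ^ a.depth) m]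
      have : m * (1 + (1 + (K * m ^ a.depth + (1 + 1))) + 1) =
        K * (m * m ^ a.depth) + 5 * m := by ring
      rw [this, Nat.add_mul]
      omega

theorem setReg_tmp_ne {d₁ d₂ : ℕ} (hne : d₁ ≠ d₂) (s : State) (x : ℕ) :
    (s.setReg (tmp d₂) x).reg (tmp d₁) = s.reg (tmp d₁) :=
  State.setReg_ne _ _ (tmp_ne hne)

theorem setReg_var_tmp (d r : ℕ) (s : State) (x : ℕ) :
    (s.setReg (2 * r) x).reg (tmp d) = s.reg (tmp d) :=
  State.setReg_ne _ _ (tmp_ne_var d r)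

theorem setReg_tmp_var (d r : ℕ) (s : State) (x : ℕ) :
    (s.setReg (tmp d) x).reg (2 * r) = s.reg (2 * r) :=
  State.setReg_ne _ _ (tmp_ne_var d r).symm

theorem Store.set_set (s : Store) (r x y : ℕ) : (s.set r x).set r y = s.set r y := by
  simp [Store.set]

/-- The command `c` is performed in time `O(m ^ c.depth)`. -/
theorem Cmd.runs_compile (c : Cmd) : ∃ K, ∀ {m : ℕ} {σ : Store} {s : State} (d : ℕ), 1 ≤ m →
    Sim m σ s → Runs (c.compile d) s (K * m ^ c.depth) (Keeps m (c.eval m σ) s d) := by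
  induction c with
  | set r e =>
    obtain ⟨K, he⟩ := e.runs_compile
    refine ⟨K + (1 + 1), fun {m σ s} d hm h => ?_⟩
    refine (Runs.seq ((he d hm h).mono le_rfl (Q := fun s₁ => Runs _ s₁ (1 + 1)
      (Keeps m ((set r e).eval m σ) s d)) ?_)).mono (le_mul_pow hm le_rfl le_rfl le_rfl)
      fun _ h => h
    rintro s₁ ⟨⟨h₁, h₂⟩, h₃⟩
    refine .seq (.const (.add ⟨?_, fun d' hd' => ?_⟩))
    · rw [State.setReg_self, setReg_var_tmp, h₃, Nat.zero_add, eval]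
      have hsim := (h₁.setVar r 0).setVar r (e.eval m σ)
      rwa [Store.set_set] at hsim
    · rw [setReg_var_tmp, setReg_var_tmp, h₂ d' hd']
  | put k i j e =>
    obtain ⟨K₁, hi⟩ := i.runs_compile
    obtain ⟨K₂, hj⟩ := j.runs_compile
    obtain ⟨K₃, he⟩ := e.runs_compile
    refine ⟨K₁ + (K₂ + (K₃ + (k + 9))), fun {m σ s} d hm h => ?_⟩
    set D := (put k i j e).depth with hD
    have b₁ := le_mul_pow (b := 0) hm (le_refl (K₁ * m ^ i.depth)) le_rfl
      (show i.depth ≤ D by simp [hD, depth])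
    have b₂ := le_mul_pow (b := 0) hm (le_refl (K₂ * m ^ j.depth)) le_rfl
      (show j.depth ≤ D by simp [hD, depth])
    have b₃ := le_mul_pow (b := 0) hm (le_refl (K₃ * m ^ e.depth)) le_rfl
      (show e.depth ≤ D by simp [hD, depth])
    rw [Nat.add_zero, Nat.add_zero] at b₁ b₂ b₃
    have b₄ : (k + 9) * 1 ≤ (k + 9) * m ^ D :=
      Nat.mul_le_mul_left _ (Nat.one_le_pow _ _ hm)
    refine Runs.mono (T₁ := K₁ * m ^ i.depth + (K₂ * m ^ j.depth + (K₃ * m ^ e.depth +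
      (k + 6 + 1 + 1 + 1)))) (.seq ((hi d hm h).mono le_rfl ?_))
      (by simp only [Nat.add_mul] at *; omega) fun _ h => h
    rintro s₁ ⟨⟨h₁, h₂⟩, h₃⟩
    refine .seq ((hj (d + 1) hm h₁).mono le_rfl ?_)
    rintro s₂ ⟨⟨h₄, h₅⟩, h₆⟩
    refine .seq ((he (d + 2) hm h₄).mono le_rfl ?_)
    rintro s₃ ⟨⟨h₇, h₈⟩, h₉⟩
    have v₁ : s₃.reg (tmp d) = i.eval m σ := by rw [h₈ d (by omega), h₅ d (by omega), h₃]
    have v₂ : s₃.reg (tmp (d + 1)) = j.eval m σ := by rw [h₈ _ (by omega), h₆]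
    have zero : ¬ (i.eval m σ < m ∧ j.eval m σ < m) → ∀ T, 1 ≤ T →
        Runs (.const 1 0) s₃ T (Keeps m ((put k i j e).eval m σ) s d) := by
      refine fun hn T hT => Runs.mono (.const ⟨?_, fun d' hd' => ?_⟩) hT fun _ h => h
      · rw [eval, if_neg hn]
        exact h₇.setScratch 0
      · rw [State.setReg_ne _ _ (by simp only [tmp]; omega), h₈ d' (by omega), h₅ d' (by omega),
          h₂ d' hd']
    refine .ifLt (fun hi => .ifLt (fun hj => ?_) fun hj => zero ?_ _ (by omega))
      fun hi => zero ?_ _ (by omega)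
    · rw [h₇.bound] at hi hj
      refine Runs.seq (T₁ := k + 6) (T₂ := 1) ((runs_addressOf h₇ k d hi).mono le_rfl ?_)
      rintro s₄ ⟨h₁₀, h₁₁, h₁₂⟩
      refine .store ⟨?_, fun d' hd' => ?_⟩
      · rw [h₁₁, h₁₂ _ (by omega), h₉, v₁, v₂]
        rw [v₁] at hi
        rw [v₂] at hj
        rw [eval, if_pos ⟨hi, hj⟩]
        exact h₁₀.setArr k hi hj _
      · change s₄.reg (tmp d') = _
        rw [h₁₂ d' (by omega), h₈ d' (by omega), h₅ d' (by omega), h₂ d' hd']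
    · rw [h₇.bound, v₂] at hj
      exact fun h => hj h.2
    · rw [h₇.bound, v₁] at hi
      exact fun h => hi h.1
  | putLow a e =>
    obtain ⟨K₁, ha⟩ := a.runs_compile
    obtain ⟨K₂, he⟩ := e.runs_compile
    refine ⟨K₁ + (K₂ + 2), fun {m σ s} d hm h => ?_⟩
    set D := (putLow a e).depth with hD
    have b₁ := le_mul_pow (b := 0) hm (le_refl (K₁ * m ^ a.depth)) le_rfl
      (show a.depth ≤ D by simp [hD, depth])
    have b₂ := le_mul_pow (b := 0) hm (le_refl (K₂ * m ^ e.depth)) le_rfl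
      (show e.depth ≤ D by simp [hD, depth])
    rw [Nat.add_zero, Nat.add_zero] at b₁ b₂
    have b₃ : 2 * 1 ≤ 2 * m ^ D := Nat.mul_le_mul_left _ (Nat.one_le_pow _ _ hm)
    refine Runs.mono (T₁ := K₁ * m ^ a.depth + (K₂ * m ^ e.depth + (1 + 1)))
      (.seq ((ha d hm h).mono le_rfl ?_)) (by simp only [Nat.add_mul]; omega) fun _ h => h
    rintro s₁ ⟨⟨h₁, h₂⟩, h₃⟩
    refine .seq ((he (d + 1) hm h₁).mono le_rfl ?_)
    rintro s₂ ⟨⟨h₄, h₅⟩, h₆⟩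
    have v₁ : s₂.reg (tmp d) = a.eval m σ := by rw [h₅ d (by omega), h₃]
    refine .ifLt (fun hlt => .store ⟨?_, fun d' hd' => ?_⟩) fun hlt =>
      .const ⟨?_, fun d' hd' => ?_⟩
    · rw [h₄.square, v₁] at hlt
      rw [v₁, h₆, eval, if_pos hlt]
      exact h₄.setLow hlt _
    · change s₂.reg (tmp d') = _
      rw [h₅ d' (by omega), h₂ d' hd']
    · rw [h₄.square, v₁] at hlt
      rw [eval, if_neg hlt]
      exact h₄.setScratch 0
    · rw [State.setReg_ne _ _ (by simp only [tmp]; omega), h₅ d' (by omega), h₂ d' hd']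
  | seq p q ihp ihq =>
    obtain ⟨K₁, hp⟩ := ihp
    obtain ⟨K₂, hq⟩ := ihq
    refine ⟨K₁ + K₂, fun {m σ s} d hm h => ?_⟩
    refine (Runs.seq ((hp d hm h).mono le_rfl (Q := fun s₁ => Runs _ s₁ (K₂ * m ^ q.depth)
      (Keeps m ((seq p q).eval m σ) s d)) ?_)).mono ?_ fun _ h => h
    · rintro s₁ ⟨h₁, h₂⟩
      refine (hq d hm h₁).mono le_rfl ?_
      rintro s₂ ⟨h₃, h₄⟩
      exact ⟨h₃, fun d' hd' => by rw [h₄ d' hd', h₂ d' hd']⟩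
    · rw [Nat.add_mul]
      exact Nat.add_le_add (le_mul_pow (b := 0) hm le_rfl le_rfl (le_max_left _ _))
        (le_mul_pow (b := 0) hm le_rfl le_rfl (le_max_right _ _))
  | ite c p q ihp ihq =>
    obtain ⟨K₁, hc⟩ := c.runs_compile
    obtain ⟨K₂, hp⟩ := ihp
    obtain ⟨K₃, hq⟩ := ihq
    refine ⟨K₁ + (K₂ + K₃ + 1), fun {m σ s} d hm h => ?_⟩
    set D := (ite c p q).depth with hD
    have b₁ := le_mul_pow (b := 0) hm (le_refl (K₁ * m ^ c.depth)) le_rfl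
      (show c.depth ≤ D by simp [hD, depth])
    have b₂ := le_mul_pow (b := 0) hm (le_refl (K₂ * m ^ p.depth)) le_rfl
      (show p.depth ≤ D by simp [hD, depth])
    have b₃ := le_mul_pow (b := 0) hm (le_refl (K₃ * m ^ q.depth)) le_rfl
      (show q.depth ≤ D by simp [hD, depth])
    rw [Nat.add_zero, Nat.add_zero] at b₁ b₂ b₃
    have b₄ : 1 ≤ m ^ D := Nat.one_le_pow _ _ hm
    refine Runs.mono (T₁ := K₁ * m ^ c.depth + (K₂ * m ^ D + K₃ * m ^ D + 1))
      (.seq ((hc d hm h).mono le_rfl ?_)) (by simp only [Nat.add_mul]; omega) fun _ h => h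
    rintro s₁ ⟨⟨h₅, h₆⟩, h₇⟩
    refine .ifLt (fun hlt => (hq d hm h₅).mono (by omega) ?_)
      fun hlt => (hp d hm h₅).mono (by omega) ?_ <;> rw [h₅.one, h₇] at hlt
    · rintro s₂ ⟨h₈, h₉⟩
      rw [eval, if_pos (by omega)]
      exact ⟨h₈, fun d' hd' => by rw [h₉ d' hd', h₆ d' hd']⟩
    · rintro s₂ ⟨h₈, h₉⟩
      rw [eval, if_neg (by omega)]
      exact ⟨h₈, fun d' hd' => by rw [h₉ d' hd', h₆ d' hd']⟩
  | loop i p ihp =>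
    obtain ⟨K, hp⟩ := ihp
    -- A round costs four units besides the body, and six units are spent outside the loop. The
    -- counter lives in a temporary and is copied to the loop variable in each round, so the body
    -- may overwrite that variable.
    refine ⟨K + 10, fun {m σ s} d hm h => ?_⟩
    let f : ℕ → Store → Store := fun k s => p.eval m (s.set i k)
    let I : ℕ → State → Prop := fun k s' =>
      Sim m (iter f k σ) s' ∧ (∀ d' < d, s'.reg (tmp d') = s.reg (tmp d')) ∧
        s'.reg (tmp d) = k ∧ s'.reg (tmp (d + 1)) = σ.var i
    have loop : ∀ s', I 0 s' → Runs (.whileLt (tmp d) 5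
            (.seq (.const (2 * i) 0) (.seq (.add (2 * i) (2 * i) (tmp d))
              (.seq (p.compile (d + 2)) (.add (tmp d) (tmp d) 3))))) s'
                (m * ((1 + (1 + (K * m ^ p.depth + 1))) + 1) + 1) (I m) := by
      intro s' hs'
      refine .whileLt I ?_ ?_ hs'
      · rintro k s₁ ⟨h₁, -, h₂, -⟩
        exact ⟨h₂, h₁.bound⟩
      · rintro k hk s₁ ⟨h₁, h₂, h₃, h₄⟩
        have hsim := (h₁.setVar i 0).setVar i (0 + k)
        rw [Store.set_set, Nat.zero_add] at hsim
        refine .seq (.const (.seq (.add ?_)))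
        rw [State.setReg_self, setReg_var_tmp, h₃, Nat.zero_add]
        refine .seq ((hp (d + 2) hm hsim).mono le_rfl ?_)
        rintro s₂ ⟨h₆, h₇⟩
        refine .add ⟨h₆.setTmp _ _, fun d' hd' => ?_, ?_, ?_⟩
        · rw [setReg_tmp_ne (by omega), h₇ d' (by omega), setReg_var_tmp, setReg_var_tmp,
            h₂ d' hd']
        · rw [State.setReg_self, h₇ d (by omega), setReg_var_tmp, setReg_var_tmp, h₃, h₆.one]
        · rw [setReg_tmp_ne (by omega), h₇ _ (by omega), setReg_var_tmp, setReg_var_tmp, h₄]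
    refine Runs.mono (T₁ := 1 + (1 + (1 +
      ((m * ((1 + (1 + (K * m ^ p.depth + 1))) + 1) + 1) + (1 + 1)))))
      (.seq (.const (.seq (.const (.seq (.add
        (.seq ((loop _ ?_).mono le_rfl ?_)))))))) ?_ fun _ h => h
    · refine ⟨((h.setTmp _ _).setTmp _ _).setTmp _ _, fun d' hd' => ?_, ?_, ?_⟩
      · rw [setReg_tmp_ne (by omega), setReg_tmp_ne (by omega), setReg_tmp_ne (by omega)]
      · rw [setReg_tmp_ne (by omega), setReg_tmp_ne (by omega), State.setReg_self]
      · rw [State.setReg_self, State.setReg_self, setReg_tmp_var, setReg_tmp_var, h.var,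
          Nat.zero_add]
    · rintro s₁ ⟨h₁, h₂, h₃, h₄⟩
      refine .seq (.const (.add ⟨?_, fun d' hd' => ?_⟩))
      · rw [State.setReg_self, setReg_var_tmp, h₄, Nat.zero_add]
        have hsim := (h₁.setVar i 0).setVar i (σ.var i)
        rwa [Store.set_set] at hsim
      · rw [setReg_var_tmp, setReg_var_tmp, h₂ d' hd']
    · have h₁ : 1 ≤ m ^ p.depth := Nat.one_le_pow _ _ hm
      have h₂ : m * 1 ≤ m * m ^ p.depth := Nat.mul_le_mul_left _ h₁
      rw [depth, Nat.pow_succ, Nat.mul_comm (m ^ p.depth) m]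
      have : m * (1 + (1 + (K * m ^ p.depth + 1)) + 1) =
        K * (m * m ^ p.depth) + 4 * m := by ring
      rw [this, Nat.add_mul]
      omega

/-- Prepares the registers and the table of row addresses, for the bound `n + 1`. -/
def setup : Program :=
  .seq (.const 3 1) (.seq (.add 5 0 3) (.seq (.add 2 1 7) (.seq
    (.whileLt 9 5 (.seq (.add 7 7 5) (.add 9 9 3)))
    (.seq (.const 9 0) (.seq (.add 13 7 9)
      (.whileLt 9 5 (.seq (.store 13 11) (.seq (.add 11 11 5)
        (.seq (.add 13 13 3) (.add 9 9 3))))))))))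

/-- The store at the beginning of a computation with the arguments `n` and `x`. -/
def initialStore (n x : ℕ) (low : ℕ → ℕ) : Store where
  var r := if r = 0 then n else if r = 1 then x else 0
  arr _ _ _ := 0
  low := low

/-- The numbers `m * m` and `i * m` are produced by repeated addition of `m`. The argument moves
from register `1` to register `2`, which represents variable `1`; register `7` is still `0` at that
moment. As the memory vanishes from `(n + 1) * (n + 1)` on, all arrays start as zero. -/
theorem runs_setup {s : State} {n x : ℕ}
    (hs : ∀ r, s.reg r = if r = 0 then n else if r = 1 then x else 0)
    (hmem : ∀ a, (n + 1) * (n + 1) ≤ a → s.mem a = 0) :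
    Runs setup s (20 * (n + 1)) (Sim (n + 1) (initialStore n x s.mem)) := by
  set m := n + 1 with hm
  have even : ∀ (s : State) (k x r : ℕ), (s.setReg (2 * k + 1) x).reg (2 * r) = s.reg (2 * r) :=
    fun s k x r => State.setReg_ne _ _ (by omega)
  let I : ℕ → State → Prop := fun k s' => s'.mem = s.mem ∧ s'.reg 3 = 1 ∧ s'.reg 5 = m ∧
    s'.reg 7 = k * m ∧ s'.reg 9 = k ∧ s'.reg 11 = 0 ∧
      ∀ r, s'.reg (2 * r) = (initialStore n x s.mem).var r
  let J : ℕ → State → Prop := fun k s' => (∀ a < m * m, s'.mem a = s.mem a) ∧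
    (∀ i < k, s'.mem (m * m + i) = i * m) ∧ (∀ a, 2 * (m * m) ≤ a → s'.mem a = 0) ∧
      s'.reg 3 = 1 ∧ s'.reg 5 = m ∧ s'.reg 7 = m * m ∧ s'.reg 9 = k ∧ s'.reg 11 = k * m ∧
        s'.reg 13 = m * m + k ∧ ∀ r, s'.reg (2 * r) = (initialStore n x s.mem).var r
  have loopI : ∀ s', I 0 s' → Runs (.whileLt 9 5 (.seq (.add 7 7 5) (.add 9 9 3))) s'
      (m * ((1 + 1) + 1) + 1) (I m) := by
    intro s' hs'
    refine .whileLt I ?_ ?_ hs'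
    · rintro k s₁ ⟨-, -, h₅, -, h₉, -⟩
      exact ⟨h₉, h₅⟩
    · rintro k hk s₁ ⟨h, h₃, h₅, h₇, h₉, h₁₁, h₂⟩
      refine .seq (.add (.add ⟨h, ?_, ?_, ?_, ?_, ?_, fun r => ?_⟩))
      · simpa [State.setReg] using h₃
      · simpa [State.setReg] using h₅
      · simp [State.setReg, h₇, h₅, Nat.succ_mul]
      · simp [State.setReg, h₉, h₃]
      · simpa [State.setReg] using h₁₁
      · rw [even _ 4, even _ 3, h₂]
  have loopJ : ∀ s', J 0 s' → Runs (.whileLt 9 5 (.seq (.store 13 11) (.seq (.add 11 11 5)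
        (.seq (.add 13 13 3) (.add 9 9 3))))) s' (m * ((1 + (1 + (1 + 1))) + 1) + 1) (J m) := by
    intro s' hs'
    refine .whileLt J ?_ ?_ hs'
    · rintro k s₁ ⟨-, -, -, -, h₅, -, h₉, -⟩
      exact ⟨h₉, h₅⟩
    · rintro k hk s₁ ⟨ha, hb, hc, h₃, h₅, h₇, h₉, h₁₁, h₁₃, h₂⟩
      have hmm : m ≤ m * m := Nat.le_mul_self m
      refine .seq (.store (.seq (.add (.seq (.add (.add
        ⟨fun a ha' => ?_, fun i hi => ?_, fun a ha' => ?_, ?_, ?_, ?_, ?_, ?_, ?_,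
          fun r => ?_⟩))))))
      · simp only [State.setReg_mem, State.setMem, h₁₃]
        rw [Function.update_of_ne (by omega), ha a ha']
      · simp only [State.setReg_mem, State.setMem, h₁₃, h₁₁]
        by_cases hik : i = k
        · rw [hik, Function.update_self]
        · rw [Function.update_of_ne (by omega), hb i (by omega)]
      · simp only [State.setReg_mem, State.setMem, h₁₃]
        rw [Function.update_of_ne (by omega), hc a ha']
      · simpa [State.setReg, State.setMem] using h₃
      · simpa [State.setReg, State.setMem] using h₅
      · simpa [State.setReg, State.setMem] using h₇
      · simp [State.setReg, State.setMem, h₉, h₃]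
      · simp [State.setReg, State.setMem, h₁₁, h₅, Nat.succ_mul]
      · simp [State.setReg, State.setMem, h₁₃, h₃, Nat.add_assoc]
      · rw [even _ 4, even _ 6, even _ 5]
        exact h₂ r
  refine Runs.mono (T₁ := 1 + (1 + (1 + ((m * ((1 + 1) + 1) + 1) + (1 + (1 +
    (m * ((1 + (1 + (1 + 1))) + 1) + 1)))))))
    (.seq (.const (.seq (.add (.seq (.add (.seq ((loopI _ ?_).mono le_rfl ?_)))))))) (by omega)
    fun _ h => h
  · refine ⟨rfl, ?_, ?_, ?_, ?_, ?_, fun r => ?_⟩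
    · simp [State.setReg]
    · simp [State.setReg, hs, hm]
    · simp [State.setReg, hs]
    · simp [State.setReg, hs]
    · simp [State.setReg, hs]
    · by_cases hr : r = 1
      · subst hr
        simp [State.setReg, hs, initialStore]
      · rw [State.setReg_ne _ _ (by omega), even _ 2, even _ 1, hs]
        simp only [initialStore]
        split_ifs <;> first | rfl | omega
  · rintro s₁ ⟨h, h₃, h₅, h₇, h₉, h₁₁, h₂⟩
    refine .seq (.const (.seq (.add ((loopJ _ ?_).mono le_rfl ?_))))
    · refine ⟨fun a _ => by simp [State.setReg, h], fun i hi => by omega, fun a ha => ?_,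
        ?_, ?_, ?_, ?_, ?_, ?_, fun r => ?_⟩
      · simp only [State.setReg_mem, h]
        exact hmem a (by omega)
      · simpa [State.setReg] using h₃
      · simpa [State.setReg] using h₅
      · simpa [State.setReg] using h₇
      · simp [State.setReg]
      · simp [State.setReg, h₁₁]
      · simp [State.setReg, h₇]
      · rw [even _ 6, even _ 4, h₂]
    · rintro s₂ ⟨ha, hb, hc, h₃', h₅', h₇', -, -, -, h₂'⟩
      refine ⟨h₃', h₅', h₇', h₂', ha, hb, fun k i hi j hj => hc _ ?_⟩
      rw [Nat.add_mul k 2]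
      omega

end Simulation

/-- The program that solves a problem with the command `c`. -/
def Cmd.program (c : Cmd) : Program := .seq setup (c.compile 0)

theorem inputMem_eq_zero {n : ℕ} (G : SimpleGraph (Fin n)) (code : Fin n → ℕ) {a : ℕ}
    (ha : n * n + n ≤ a) : inputMem G code a = 0 := by
  rw [inputMem, if_neg, dif_neg (by omega)]
  rintro ⟨i, j, rfl, -⟩
  have := entry_lt i.2 j.2
  omega

/-- A command of depth at most three runs in cubic time. -/
theorem Cmd.exists_run (c : Cmd) (hc : c.depth ≤ 3) : ∃ C, ∀ (n : ℕ) (G : SimpleGraph (Fin n))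
    (code : Fin n → ℕ) (x : ℕ), 0 < n → ∃ t s, Run c.program (input G code x) t s ∧
      t ≤ C * n ^ 3 ∧
      s.reg 0 = (c.eval (n + 1) (initialStore n x (inputMem G code))).var 0 ∧
      ∀ i < n, s.mem i = (c.eval (n + 1) (initialStore n x (inputMem G code))).low i := by
  obtain ⟨K, hK⟩ := c.runs_compile
  -- `20` pays for the setup, and `8` comes from `(n + 1) ^ 3 ≤ (2 * n) ^ 3`. With the bound `n +
  -- 1`, the `n * n + n` input cells fit into the first block.
  refine ⟨(20 + K) * 8, fun n G code x hn => ?_⟩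
  have hset := runs_setup (s := input G code x) (n := n) (x := x) (fun r => rfl)
    fun a ha => inputMem_eq_zero G code (by rw [Nat.succ_mul, Nat.mul_succ] at ha; omega)
  obtain ⟨t₁, s₁, r₁, b₁, h₁⟩ := hset
  obtain ⟨t₂, s₂, r₂, b₂, h₂, -⟩ := hK 0 (by omega) h₁
  refine ⟨_, _, .seq r₁ r₂, ?_, ?_, fun i hi => ?_⟩
  · have e₁ : (n + 1) ^ c.depth ≤ (n + 1) ^ 3 := Nat.pow_le_pow_right (by omega) hc
    have e₂ : (n + 1) ^ 1 ≤ (n + 1) ^ 3 := Nat.pow_le_pow_right (by omega) (by omega)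
    have e₃ : (n + 1) ^ 3 ≤ (2 * n) ^ 3 := Nat.pow_le_pow_left (by omega) 3
    have e₄ := Nat.mul_le_mul_left K e₁
    have e₅ := Nat.mul_le_mul_left (20 + K) e₃
    rw [Nat.mul_pow, ← Nat.mul_assoc] at e₅
    rw [Nat.add_mul 20 K ((n + 1) ^ 3)] at e₅
    rw [pow_one] at e₂
    norm_num at e₅ ⊢
    omega
  · exact h₂.var 0
  · have : n ≤ n * n := Nat.le_mul_self n
    refine h₂.low i ?_
    rw [Nat.succ_mul, Nat.mul_succ]
    omega


/-! ### Domination in graphs -/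

section Domination

variable {V : Type*} {G : SimpleGraph V}

/-- A vertex dominates itself and its neighbours. -/
def Dom (G : SimpleGraph V) (a b : V) : Prop := a = b ∨ G.Adj a b

/-- Two vertices are far if no vertex is dominated by both. -/
def Far (G : SimpleGraph V) (a b : V) : Prop := ∀ u, Dom G a u → ¬ Dom G b u

/-- The component of `u` is a clique. -/
def InCliqueComponent (G : SimpleGraph V) (u : V) : Prop :=
  ∀ a, Dom G u a → ∀ b, Dom G a b ↔ Dom G u b

/-- The vertices that are far from `r` induce a disjoint union of cliques. -/
def RestCliques (G : SimpleGraph V) (r : V) : Prop :=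
  ∀ a b c, Far G r a → Far G r b → Far G r c → Dom G a b → Dom G b c → Dom G a c

/-- `a - b - c` is a chordless path. -/
structure IsP3 (G : SimpleGraph V) (a b c : V) : Prop where
  left : G.Adj a b
  right : G.Adj b c
  not_dom : ¬ Dom G a c

theorem Dom.refl (a : V) : Dom G a a := .inl rfl

theorem Dom.symm {a b : V} (h : Dom G a b) : Dom G b a := h.imp Eq.symm G.adj_symm

theorem Far.not_dom {a b : V} (h : Far G a b) : ¬ Dom G a b := fun h₁ => h b h₁ (.refl b)

theorem not_far_self (a : V) : ¬ Far G a a := fun h => h.not_dom (.refl a)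

theorem not_far_iff {a b : V} : ¬ Far G a b ↔ ∃ u, Dom G a u ∧ Dom G b u := by
  simp [Far]

/-- Distinct vertices at distance two have a common neighbour. -/
theorem exists_adj_of_not_far {r z : V} (h : ¬ Far G r z) (hz : ¬ Dom G r z) :
    ∃ y, G.Adj r y ∧ G.Adj y z := by
  obtain ⟨y, h₁, h₂⟩ := not_far_iff.1 h
  rcases h₁ with rfl | h₁
  · exact absurd h₂.symm hz
  · rcases h₂ with rfl | h₂
    · exact absurd (.inr h₁) hz
    · exact ⟨y, h₁, h₂.symm⟩

theorem not_far_of_dom_dom {r y z : V} (h₁ : Dom G r y) (h₂ : Dom G y z) : ¬ Far G r z :=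
  fun h => h y h₁ h₂.symm

theorem IsFree.twoP3 (hG : IsFree G) {a b c a' b' c' : V} (h : IsP3 G a b c)
    (h' : IsP3 G a' b' c')
    (hn : ∀ x ∈ ({a, b, c} : Set V), ∀ y ∈ ({a', b', c'} : Set V), ¬ Dom G x y) : False := by
  obtain ⟨h₁, h₂, h₃⟩ := h
  obtain ⟨h₁', h₂', h₃'⟩ := h'
  simp only [Dom, not_or, Set.mem_insert_iff, Set.mem_singleton_iff, forall_eq_or_imp,
    forall_eq] at h₃ h₃' hn
  have := h₁.ne
  have := h₂.ne
  have := h₁'.ne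
  have := h₂'.ne
  have inj : Function.Injective (Sum.elim ![a, b, c] ![a', b', c']) := by
    simp only [Function.Injective, Sum.forall, Fin.forall_fin_succ]
    simp
    grind
  have key : ∀ i j, G.Adj (Sum.elim ![a, b, c] ![a', b', c'] i)
      (Sum.elim ![a, b, c] ![a', b', c'] j) ↔ WED.twoP3.Adj i j := by
    rintro (i | i) (j | j) <;> fin_cases i <;> fin_cases j <;>
      simp [WED.twoP3, SimpleGraph.pathGraph_adj] <;> grind [SimpleGraph.adj_comm]
  exact hG.1 ⟨⟨⟨_, inj⟩, fun {i j} => key i j⟩⟩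

/-- Distinctness of the six vertices need not be assumed: no two vertices of `S122` have the same
neighbours, so the adjacencies already force injectivity. -/
theorem IsFree.s122 (hG : IsFree G) {u p q q' y r : V} (up : G.Adj u p) (uq : G.Adj u q)
    (qq : G.Adj q q') (uy : G.Adj u y) (yr : G.Adj y r) (uq' : ¬ G.Adj u q') (ur : ¬ G.Adj u r)
    (pq : ¬ G.Adj p q) (pq' : ¬ G.Adj p q') (py : ¬ G.Adj p y) (pr : ¬ G.Adj p r)
    (qy : ¬ G.Adj q y) (qr : ¬ G.Adj q r) (qy' : ¬ G.Adj q' y) (qr' : ¬ G.Adj q' r) : False := by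
  have key : ∀ i j, G.Adj (![u, p, q, q', y, r] i) (![u, p, q, q', y, r] j) ↔ S122.Adj i j := by
    intro i j
    fin_cases i <;> fin_cases j <;> simp [S122] <;> grind [SimpleGraph.adj_comm]
  refine hG.2 ⟨⟨⟨![u, p, q, q', y, r], fun i j hij => ?_⟩, fun {i j} => key i j⟩⟩
  have : ∀ k, S122.Adj i k ↔ S122.Adj j k := fun k => by rw [← key, ← key, hij]
  revert this
  fin_cases i <;> fin_cases j <;> simp [S122, Fin.forall_fin_succ]

variable {D : Finset V}

theorem IsED.eq_of_dom (hD : IsED G D) {d d' u : V} (hd : d ∈ D) (hd' : d' ∈ D)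
    (h : Dom G d u) (h' : Dom G d' u) : d = d' :=
  (hD u).unique ⟨hd, h⟩ ⟨hd', h'⟩

theorem IsED.exists_dom (hD : IsED G D) (u : V) : ∃ d ∈ D, Dom G d u :=
  let ⟨d, ⟨h₁, h₂⟩, _⟩ := hD u
  ⟨d, h₁, h₂⟩

theorem isED_iff : IsED G D ↔ (∀ u, ∃ d ∈ D, Dom G d u) ∧
    ∀ d ∈ D, ∀ d' ∈ D, ∀ u, Dom G d u → Dom G d' u → d = d' := by
  refine ⟨fun h => ⟨h.exists_dom, fun d hd d' hd' u => h.eq_of_dom hd hd'⟩, fun h u => ?_⟩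
  obtain ⟨d, h₁, h₂⟩ := h.1 u
  exact ⟨d, ⟨h₁, h₂⟩, fun d' h' => h.2 d' h'.1 d h₁ u h'.2 h₂⟩

theorem IsED.far (hD : IsED G D) {d d' : V} (hd : d ∈ D) (hd' : d' ∈ D) (h : d ≠ d') :
    Far G d d' :=
  fun _ h₁ h₂ => h (hD.eq_of_dom hd hd' h₁ h₂)

theorem IsED.far_of_dom (hD : IsED G D) {r q d : V} (hr : r ∈ D) (hq : Far G r q) (hd : d ∈ D)
    (h : Dom G d q) : Far G r d := by
  refine hD.far hr hd ?_
  rintro rfl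
  exact hq.not_dom h

/-! ### Efficient dominating sets in (2P₃, S_{1,2,2})-free graphs -/

section Free

variable (hG : IsFree G) (hD : IsED G D)

include hG hD

/-- A vertex near `r` that has a neighbour `q` far from `r` is dominated by the dominator
of `q`. -/
theorem dom_of_adj_of_far {r q u d : V} (hr : r ∈ D) (hq : Far G r q) (hd : d ∈ D)
    (hdq : Dom G d q) (hqu : G.Adj q u) (hu : ¬ Far G r u) : Dom G d u := by
  obtain ⟨d', hd', hdu⟩ := hD.exists_dom u
  by_contra hn
  have hne : d' ≠ d := by rintro rfl; exact hn hdu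
  have hru : ¬ Dom G r u := fun h => hq u h (.inr hqu)
  obtain ⟨y, ry, yu⟩ := exists_adj_of_not_far hu hru
  have hfd := hD.far_of_dom hr hq hd hdq
  have hfd' : Far G r d' := by
    refine hD.far hr hd' ?_
    rintro rfl
    exact hru hdu
  have hud' : G.Adj u d' := by
    rcases hdu with rfl | h
    · exact absurd hfd' hu
    · exact h.symm
  have hqd : G.Adj q d := by
    rcases hdq with rfl | h
    · exact absurd (.inr hqu) hn
    · exact h.symm
  have far : ∀ {x}, Far G r x → ¬ G.Adj x y ∧ ¬ G.Adj x r := fun h =>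
    ⟨fun h' => h y (.inr ry) (.inr h'), fun h' => h.not_dom (.inr h'.symm)⟩
  -- The centre is `u`, with the legs `d'`, `q - d` and `y - r`. An edge from `d'` to `q` or `d`
  -- would give that vertex two dominators, and vertices far from `r` are adjacent neither to `y`
  -- nor to `r`.
  refine hG.s122 hud' hqu.symm hqd yu.symm ry.symm (fun h => hn (.inr h.symm))
    (fun h => hru (.inr h.symm)) (fun h => hne ?_) (fun h => hne ?_) (far hfd').1 (far hfd').2
    (far hq).1 (far hq).2 (far hfd).1 (far hfd).2
  · exact hD.eq_of_dom hd' hd (.inr h) hdq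
  · exact hD.eq_of_dom hd' hd (.inr h) (.refl d)

omit hD in
/-- Chordless paths far from `r` are hit by the vertices at distance two from `r`. -/
theorem adj_of_isP3 {r z a b c : V} (hz : ¬ Far G r z) (hz' : ¬ Dom G r z) (h : IsP3 G a b c)
    (hf : ∀ x ∈ ({a, b, c} : Set V), Far G r x) : ∃ x ∈ ({a, b, c} : Set V), G.Adj x z := by
  obtain ⟨y, ry, yz⟩ := exists_adj_of_not_far hz hz'
  by_contra! hn
  -- The second chordless path is `r - y - z`; only `z` can be in contact with vertices far from
  -- `r`.
  refine hG.twoP3 h ⟨ry, yz, hz'⟩ fun x hx w hw hxw => ?_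
  rcases hw with rfl | rfl | rfl
  · exact (hf x hx).not_dom hxw.symm
  · exact hf x hx w (.inr ry) hxw
  · rcases hxw with rfl | hxw
    · exact hz (hf x hx)
    · exact hn x hx hxw

omit hD in
/-- If some chordless path is far from `r`, the neighbourhood of `r` is a clique. -/
theorem dom_of_isP3 {r a b c y y' : V} (h : IsP3 G a b c)
    (hf : ∀ x ∈ ({a, b, c} : Set V), Far G r x) (hy : Dom G r y) (hy' : Dom G r y') :
    Dom G y y' := by
  by_contra hn
  rcases hy with rfl | hy
  · exact hn hy'
  rcases hy' with rfl | hy'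
  · exact hn (.inr hy.symm)
  -- Nonadjacent neighbours of `r` would give the second chordless path `y - r - y'`, all of whose
  -- vertices avoid the first one.
  refine hG.twoP3 h ⟨hy.symm, hy', hn⟩ fun x hx w hw hxw => ?_
  rcases hw with rfl | rfl | rfl
  · exact hf x hx w (.inr hy) hxw
  · exact (hf x hx).not_dom hxw.symm
  · exact hf x hx w (.inr hy') hxw

/-- The dominator of a vertex at distance two from `r` hits every chordless path that is far
from `r`. -/
theorem exists_dom_of_isP3 {r z d a b c : V} (hr : r ∈ D) (hz : ¬ Far G r z) (hz' : ¬ Dom G r z)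
    (hd : d ∈ D) (hdz : Dom G d z) (h : IsP3 G a b c)
    (hf : ∀ x ∈ ({a, b, c} : Set V), Far G r x) : ∃ x ∈ ({a, b, c} : Set V), Dom G d x := by
  obtain ⟨x, hx, hxz⟩ := adj_of_isP3 hG hz hz' h hf
  obtain ⟨e, he, hex⟩ := hD.exists_dom x
  obtain rfl := hD.eq_of_dom hd he hdz (dom_of_adj_of_far hG hD hr (hf x hx) he hex hxz hz)
  exact ⟨x, hx, hex⟩

/-- If the vertices at distance two from `r` have two dominators, then vertices far from `r` with
the same dominator are adjacent. -/
theorem dom_of_dom_of_dom {r z₁ z₂ d₁ d₂ d q q' : V} (hr : r ∈ D) (hz₁ : ¬ Far G r z₁)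
    (hz₁' : ¬ Dom G r z₁) (hd₁ : d₁ ∈ D) (hdz₁ : Dom G d₁ z₁) (hz₂ : ¬ Far G r z₂)
    (hz₂' : ¬ Dom G r z₂) (hd₂ : d₂ ∈ D) (hdz₂ : Dom G d₂ z₂) (hne : d₁ ≠ d₂) (hd : d ∈ D)
    (hq : Far G r q) (hq' : Far G r q') (hdq : Dom G d q) (hdq' : Dom G d q') : Dom G q q' := by
  by_contra hn
  have hfd := hD.far_of_dom hr hq hd hdq
  have key : ∀ x ∈ ({q, d, q'} : Set V), Dom G d x := by
    rintro x (rfl | rfl | rfl)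
    exacts [hdq, .refl _, hdq']
  rcases hdq with rfl | hdq
  · exact hn hdq'
  rcases hdq' with rfl | hdq'
  · exact hn (.inr hdq.symm)
  -- All vertices of this path have the dominator `d`, while `d₁` and `d₂` each have to dominate one
  -- of them.
  have hP : IsP3 G q d q' := ⟨hdq.symm, hdq', hn⟩
  have hf : ∀ x ∈ ({q, d, q'} : Set V), Far G r x := by
    rintro x (rfl | rfl | rfl) <;> assumption
  obtain ⟨x, hx, h₁⟩ := exists_dom_of_isP3 hG hD hr hz₁ hz₁' hd₁ hdz₁ hP hf
  obtain ⟨y, hy, h₂⟩ := exists_dom_of_isP3 hG hD hr hz₂ hz₂' hd₂ hdz₂ hP hf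
  exact hne ((hD.eq_of_dom hd₁ hd h₁ (key x hx)).trans (hD.eq_of_dom hd₂ hd h₂ (key y hy)).symm)

/-- The dominators of an edge far from `r` include those of the vertices at distance two
from `r`. -/
theorem eq_or_eq_of_adj {r z₁ d₁ d d' a b : V} (hr : r ∈ D) (hz₁ : ¬ Far G r z₁)
    (hz₁' : ¬ Dom G r z₁) (hd₁ : d₁ ∈ D) (hdz₁ : Dom G d₁ z₁) (ha : Far G r a) (hb : Far G r b)
    (hab : G.Adj a b) (hd : d ∈ D) (hd' : d' ∈ D) (hda : Dom G d a) (hdb : Dom G d' b)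
    (hne : d ≠ d') : d₁ = d ∨ d₁ = d' := by
  have hfd := hD.far_of_dom hr ha hd hda
  have hdb' : ¬ Dom G d b := fun h => hne (hD.eq_of_dom hd hd' h hdb)
  have hda' : G.Adj d a := by
    rcases hda with rfl | h
    · exact absurd (.inr hab) hdb'
    · exact h
  have hf : ∀ x ∈ ({d, a, b} : Set V), Far G r x := by
    rintro x (rfl | rfl | rfl) <;> assumption
  -- The vertices of the chordless path `d - a - b` have no dominators besides `d` and `d'`.
  obtain ⟨x, hx, h₁⟩ := exists_dom_of_isP3 hG hD hr hz₁ hz₁' hd₁ hdz₁ ⟨hda', hab, hdb'⟩ hf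
  rcases hx with rfl | rfl | rfl
  · exact .inl (hD.eq_of_dom hd₁ hd h₁ (.refl _))
  · exact .inl (hD.eq_of_dom hd₁ hd h₁ hda)
  · exact .inr (hD.eq_of_dom hd₁ hd' h₁ hdb)

/-- If the vertices at distance two from `r` have three dominators, then the vertices far from `r`
induce a disjoint union of cliques. -/
theorem restCliques_of_three {r z₁ z₂ z₃ d₁ d₂ d₃ : V} (hr : r ∈ D) (hz₁ : ¬ Far G r z₁)
    (hz₁' : ¬ Dom G r z₁) (hd₁ : d₁ ∈ D) (hdz₁ : Dom G d₁ z₁) (hz₂ : ¬ Far G r z₂)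
    (hz₂' : ¬ Dom G r z₂) (hd₂ : d₂ ∈ D) (hdz₂ : Dom G d₂ z₂) (hz₃ : ¬ Far G r z₃)
    (hz₃' : ¬ Dom G r z₃) (hd₃ : d₃ ∈ D) (hdz₃ : Dom G d₃ z₃) (h₁₂ : d₁ ≠ d₂) (h₁₃ : d₁ ≠ d₃)
    (h₂₃ : d₂ ≠ d₃) : RestCliques G r := by
  intro a b c ha hb hc hab hbc
  have same : ∀ {a b d}, Far G r a → Far G r b → Dom G a b → d ∈ D → Dom G d a → Dom G d b := by
    intro a b d ha hb hab hd hda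
    rcases hab with rfl | hab
    · exact hda
    obtain ⟨e, he, heb⟩ := hD.exists_dom b
    by_cases hne : d = e
    · exact hne ▸ heb
    have e₁ := eq_or_eq_of_adj hG hD hr hz₁ hz₁' hd₁ hdz₁ ha hb hab hd he hda heb hne
    have e₂ := eq_or_eq_of_adj hG hD hr hz₂ hz₂' hd₂ hdz₂ ha hb hab hd he hda heb hne
    have e₃ := eq_or_eq_of_adj hG hD hr hz₃ hz₃' hd₃ hdz₃ ha hb hab hd he hda heb hne
    -- The three distinct vertices `d₁`, `d₂`, `d₃` cannot all lie in `{d, e}`. Hence an edge far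
    -- from `r` has a common dominator.
    grind
  obtain ⟨d, hd, hda⟩ := hD.exists_dom a
  exact dom_of_dom_of_dom hG hD hr hz₁ hz₁' hd₁ hdz₁ hz₂ hz₂' hd₂ hdz₂ h₁₂ hd ha hc hda
    (same hb hc hbc hd (same ha hb hab hd hda))

omit hG hD in
theorem exists_isP3_of_not_restCliques {r : V} (h : ¬ RestCliques G r) :
    ∃ a b c, IsP3 G a b c ∧ ∀ x ∈ ({a, b, c} : Set V), Far G r x := by
  simp only [RestCliques, not_forall] at h
  obtain ⟨a, b, c, ha, hb, hc, hab, hbc, hac⟩ := h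
  refine ⟨a, b, c, ⟨?_, ?_, hac⟩, ?_⟩
  · rcases hab with rfl | h
    · exact absurd hbc hac
    · exact h
  · rcases hbc with rfl | h
    · exact absurd hab hac
    · exact h
  · rintro x (rfl | rfl | rfl) <;> assumption

/-- Either the vertices far from some vertex of an e.d. induce a disjoint union of cliques,
or at most three vertices of the e.d. lie in components that are not cliques. -/
theorem exists_restCliques_or_card_le : (∃ r ∈ D, RestCliques G r) ∨
    (D.filter fun d => ¬ InCliqueComponent G d).card ≤ 3 := by
  by_contra! hcon
  obtain ⟨hnot, hcard⟩ := hcon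
  obtain ⟨r, hr⟩ : (D.filter fun d => ¬ InCliqueComponent G d).Nonempty :=
    Finset.card_pos.1 (by omega)
  obtain ⟨hr, hrc⟩ := Finset.mem_filter.1 hr
  obtain ⟨a, b, c, hP, hPf⟩ := exists_isP3_of_not_restCliques (hnot r hr)
  have clique : ∀ {y y'}, Dom G r y → Dom G r y' → Dom G y y' := fun h h' =>
    dom_of_isP3 hG hP hPf h h'
  -- Without vertices at distance two, the component of `r` would be N[r], which is a clique because
  -- some chordless path is far from `r`.
  obtain ⟨z₁, hz₁, hz₁'⟩ : ∃ z, ¬ Far G r z ∧ ¬ Dom G r z := by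
    by_contra! hno
    exact hrc fun a ha b => ⟨fun h => hno b (not_far_of_dom_dom ha h), fun h => clique ha h⟩
  obtain ⟨d₁, hd₁, hdz₁⟩ := hD.exists_dom z₁
  -- If `d₁` dominated all vertices at distance two from `r`, the vertices far from `d₁` would lie
  -- in N[r] or far from `r`, without edges between the two kinds. Those in N[r] form a clique, and
  -- a chordless path of the other kind would be hit by `d₁`. So `d₁` could serve as the vertex in
  -- the first alternative.
  obtain ⟨z₂, hz₂, hz₂', d₂, hd₂, hdz₂, hne⟩ : ∃ z, ¬ Far G r z ∧ ¬ Dom G r z ∧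
      ∃ d ∈ D, Dom G d z ∧ d₁ ≠ d := by
    by_contra! hno
    have cases : ∀ x, Far G d₁ x → Dom G r x ∨ Far G r x := by
      intro x hx
      by_contra! hn
      obtain ⟨e, he, hex⟩ := hD.exists_dom x
      exact hx.not_dom (hno x hn.2 hn.1 e he hex ▸ hex)
    refine hnot d₁ hd₁ fun a b c ha hb hc hab hbc => ?_
    rcases cases b hb with hrb | hrb
    · have h : ∀ {x}, Dom G b x → Far G d₁ x → Dom G r x := fun hbx hx =>
        (cases _ hx).resolve_right (not_far_of_dom_dom hrb hbx)
      exact clique (h hab.symm ha) (h hbc hc)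
    · have h : ∀ {x}, Dom G b x → Far G d₁ x → Far G r x := fun hbx hx =>
        (cases _ hx).resolve_left fun hrx => hrb _ hrx hbx
      have ha' := h hab.symm ha
      have hc' := h hbc hc
      by_contra hac
      rcases hab with rfl | hab
      · exact hac hbc
      rcases hbc with rfl | hbc
      · exact hac (.inr hab)
      have hf : ∀ x ∈ ({a, b, c} : Set V), Far G r x := by
        rintro x (rfl | rfl | rfl) <;> assumption
      obtain ⟨x, hx, hdx⟩ :=
        exists_dom_of_isP3 hG hD hr hz₁ hz₁' hd₁ hdz₁ ⟨hab, hbc, hac⟩ hf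
      rcases hx with rfl | rfl | rfl
      exacts [ha.not_dom hdx, hb.not_dom hdx, hc.not_dom hdx]
  have two : ∀ z, ¬ Far G r z → ¬ Dom G r z → ∀ d ∈ D, Dom G d z → d = d₁ ∨ d = d₂ := by
    intro z hz hz' d hd hdz
    by_contra! hn
    exact hnot r hr (restCliques_of_three hG hD hr hz₁ hz₁' hd₁ hdz₁ hz₂ hz₂' hd₂ hdz₂ hz hz' hd
      hdz hne hn.1.symm hn.2.symm)
  -- For any other `d` in `D`, all of N[d] is far from `r`, as the vertices at distance two have
  -- only the dominators `d₁` and `d₂`. Then N[d] is a clique. No edge leaves it: an outer end far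
  -- from `r` would have a dominator equal to both `d₁` and `d₂`, and an outer end at distance two
  -- would be dominated by `d`.
  have sub : (D.filter fun d => ¬ InCliqueComponent G d) ⊆ {r, d₁, d₂} := by
    intro d hd
    obtain ⟨hd, hdc⟩ := Finset.mem_filter.1 hd
    simp only [Finset.mem_insert, Finset.mem_singleton]
    by_contra! hn
    obtain ⟨hdr, hdd₁, hdd₂⟩ := hn
    have far : ∀ u, Dom G d u → Far G r u := by
      intro u hu
      by_contra hfu
      have hru : ¬ Dom G r u := fun h => hdr (hD.eq_of_dom hd hr hu h)
      rcases two u hfu hru d hd hu with h | h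
      exacts [hdd₁ h, hdd₂ h]
    refine hdc fun a ha b => ⟨fun hab => ?_, fun hdb => ?_⟩
    · rcases hab with rfl | hab
      · exact ha
      by_cases hfb : Far G r b
      · obtain ⟨e, he, heb⟩ := hD.exists_dom b
        by_cases hne' : d = e
        · exact hne' ▸ heb
        have e₁ := eq_or_eq_of_adj hG hD hr hz₁ hz₁' hd₁ hdz₁ (far a ha) hfb hab hd he ha heb hne'
        have e₂ := eq_or_eq_of_adj hG hD hr hz₂ hz₂' hd₂ hdz₂ (far a ha) hfb hab hd he ha heb hne'
        grind
      · exact dom_of_adj_of_far hG hD hr (far a ha) hd ha hab hfb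
    · exact dom_of_dom_of_dom hG hD hr hz₁ hz₁' hd₁ hdz₁ hz₂ hz₂' hd₂ hdz₂ hne hd (far a ha)
        (far b hdb) ha hdb
  have := (Finset.card_le_card sub).trans Finset.card_le_three
  omega

end Free

end Domination


/-! ### Distance levels, components of G[R], and the graph G_v -/

section Levels

variable {V : Type*} {G : SimpleGraph V} {v w : V}

theorem mem_level_one : w ∈ level G v 1 ↔ G.Adj v w := by
  simp [level, SimpleGraph.edist_eq_one_iff_adj]

theorem mem_level_two : w ∈ level G v 2 ↔ ¬ Far G v w ∧ ¬ Dom G v w := by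
  have : w ∈ level G v 2 ↔ G.edist v w = 2 := Iff.rfl
  rw [this, SimpleGraph.edist_eq_two_iff]
  constructor
  · rintro ⟨h₁, h₂, y, h₃⟩
    obtain ⟨h₃, h₄⟩ := (SimpleGraph.mem_commonNeighbors _).1 h₃
    exact ⟨not_far_of_dom_dom (.inr h₃) (.inr h₄.symm), not_or.2 ⟨h₁, h₂⟩⟩
  · rintro ⟨h₁, h₂⟩
    obtain ⟨y, h₃, h₄⟩ := exists_adj_of_not_far h₁ h₂
    exact ⟨fun h => h₂ (.inl h), fun h => h₂ (.inr h), y,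
      (SimpleGraph.mem_commonNeighbors _).2 ⟨h₃, h₄.symm⟩⟩

theorem mem_rest : w ∈ rest G v ↔ Far G v w := by
  rw [rest, Set.mem_compl_iff, Set.mem_union, Set.mem_union, mem_level_one, mem_level_two,
    Set.mem_singleton_iff]
  constructor
  · intro h
    by_contra hf
    exact h (.inr ⟨hf, fun hd => h (.inl (hd.imp Eq.symm id))⟩)
  · rintro h ((h' | h') | h')
    · exact h.not_dom (.inl h'.symm)
    · exact h.not_dom (.inr h')
    · exact h'.1 h

theorem mem_gvSet : w ∈ gvSet G v ↔ ¬ Dom G v w := by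
  rw [gvSet, Set.mem_union, mem_level_two, mem_rest]
  exact ⟨fun h => h.elim And.right Far.not_dom, fun h => (em _).symm.imp (⟨·, h⟩) id⟩

theorem exists_of_mem_level_three (h : w ∈ level G v 3) : ∃ z ∈ level G v 2, G.Adj z w := by
  have h : G.edist v w = (3 : ℕ) := h
  obtain ⟨p, hp⟩ := SimpleGraph.exists_walk_of_edist_eq_coe h
  match p, hp with
  | .cons (v := a) h₁ (.cons (v := b) h₂ (.cons h₃ .nil)), _ =>
    refine ⟨b, mem_level_two.2 ⟨not_far_of_dom_dom (.inr h₁) (.inr h₂), ?_⟩, h₃⟩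
    rintro (rfl | hb)
    · have := SimpleGraph.edist_le (.cons h₃ .nil)
      rw [h] at this
      norm_num at this
    · have := SimpleGraph.edist_le (.cons hb (.cons h₃ .nil))
      rw [h] at this
      norm_num at this

/-- Domination is transitive among the vertices far from `v`, so every walk in G[R] shortens to at
most one edge. -/
theorem RestCliques.component_eq (hv : RestCliques G v) {Q : Set V}
    (hQ : IsRestComponent G v Q) {q : V} (hq : q ∈ Q) : Q = {x | Far G v x ∧ Dom G q x} := by
  obtain ⟨c, rfl⟩ := hQ
  obtain ⟨⟨q, hqv⟩, hqc, rfl⟩ := hq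
  have walk : ∀ {a b : rest G v}, (G.induce (rest G v)).Walk a b → Dom G a.1 b.1 := by
    intro a b p
    induction p with
    | nil => exact .refl _
    | @cons a c b h p ih =>
      exact hv _ _ _ (mem_rest.1 a.2) (mem_rest.1 c.2) (mem_rest.1 b.2) (.inr h) ih
  ext x
  constructor
  · rintro ⟨⟨x, hx⟩, hxc, rfl⟩
    obtain ⟨p⟩ := SimpleGraph.ConnectedComponent.exact (hqc.trans hxc.symm)
    exact ⟨mem_rest.1 hx, walk p⟩
  · rintro ⟨h₁, rfl | h₂⟩
    · exact ⟨_, hqc, rfl⟩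
    · refine ⟨⟨x, mem_rest.2 h₁⟩, ?_, rfl⟩
      refine Eq.trans ?_ hqc
      refine SimpleGraph.ConnectedComponent.sound (SimpleGraph.Adj.reachable ?_)
      exact h₂.symm

theorem IsRestComponent.nonempty {Q : Set V} (hQ : IsRestComponent G v Q) : Q.Nonempty := by
  obtain ⟨c, rfl⟩ := hQ
  exact c.nonempty_supp.image _

/-- A clique component of the vertices far from `v` contains exactly one vertex of every e.d. that
contains `v`, and this vertex is adjacent to all vertices that distinguish the component. -/
theorem exists_inter_component_eq (hG : IsFree G) (hv : RestCliques G v) {Q : Set V}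
    (hQ : IsRestComponent G v Q) {D : Finset V} (hD : IsED G D) (hvD : v ∈ D) :
    ∃ d, (D : Set V) ∩ Q = {d} ∧
      ∀ z ∈ level G v 2, (∃ q ∈ Q, G.Adj z q) → G.Adj z d := by
  obtain ⟨q, hq⟩ := hQ.nonempty
  have hQq := hv.component_eq hQ hq
  obtain ⟨d, hd, hdq⟩ := hD.exists_dom q
  have hqv : Far G v q := (hQq ▸ hq : q ∈ {x | Far G v x ∧ Dom G q x}).1
  have hdv := hD.far_of_dom hvD hqv hd hdq
  have hdQ : d ∈ Q := by
    rw [hQq]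
    exact ⟨hdv, hdq.symm⟩
  have hQd := hv.component_eq hQ hdQ
  refine ⟨d, ?_, fun z hz hzq => ?_⟩
  · ext e
    refine ⟨fun he => ?_, ?_⟩
    · have he' : e ∈ {x | Far G v x ∧ Dom G d x} := hQd ▸ he.2
      exact hD.eq_of_dom he.1 hd (.refl e) he'.2
    · rintro rfl
      exact ⟨hd, hdQ⟩
  · obtain ⟨q', hq', hzq'⟩ := hzq
    rw [hQd] at hq'
    rw [mem_level_two] at hz
    rcases dom_of_adj_of_far hG hD hvD hq'.1 hd hq'.2 hzq'.symm hz.1 with rfl | h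
    · exact absurd hdv hz.1
    · exact h.symm

/-- In a prime graph `G_v`, a clique component of the vertices far from `v` has at most one vertex
that is adjacent to all vertices that distinguish the component. -/
theorem joined_subsingleton (hv : RestCliques G v) (hprime : IsPrime (gv G v))
    (hne : (level G v 2).Nonempty) {Q : Set V} (hQ : IsRestComponent G v Q) :
    (joined G v Q).Subsingleton := by
  rintro p ⟨hp, hpj⟩ q ⟨hq, hqj⟩
  by_contra hpq
  have far : ∀ {x}, x ∈ Q → Far G v x := fun {x} hx =>
    (hv.component_eq hQ hp ▸ hx : x ∈ {x | Far G v x ∧ Dom G p x}).1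
  have gvmem : ∀ {x}, x ∈ Q → x ∈ gvSet G v := fun hx => mem_gvSet.2 (far hx).not_dom
  -- The pair would be homogeneous. A vertex of `R` adjacent to one of the two lies in the clique
  -- `Q`, and a vertex of N₂ that separated them would distinguish `Q`, hence be adjacent to both.
  -- The pair is not everything because N₂ is nonempty.
  refine hprime {⟨p, gvmem hp⟩, ⟨q, gvmem hq⟩} ⟨Set.nontrivial_pair ?_, ?_, ?_⟩
  · simpa using hpq
  · intro h
    obtain ⟨z, hz⟩ := hne
    have hz' : (⟨z, .inl hz⟩ : gvSet G v) ∈ (Set.univ : Set (gvSet G v)) := trivial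
    rw [← h] at hz'
    rw [mem_level_two] at hz
    rcases hz' with hz' | hz'
    · obtain rfl : z = p := congrArg Subtype.val hz'
      exact hz.1 (far hp)
    · obtain rfl : z = q := congrArg Subtype.val hz'
      exact hz.1 (far hq)
  · rintro ⟨u, hu⟩ hun
    have hup : u ≠ p := by rintro rfl; exact hun (.inl rfl)
    have huq : u ≠ q := by rintro rfl; exact hun (.inr rfl)
    suffices h : G.Adj u p ↔ G.Adj u q by
      by_cases hadj : G.Adj u p
      · left
        rintro _ (rfl | rfl)
        exacts [hadj, h.1 hadj]
      · right
        rintro _ (rfl | rfl)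
        exacts [hadj, fun h' => hadj (h.2 h')]
    have main : ∀ {a b}, a ∈ Q → b ∈ Q → u ≠ b →
        (∀ z ∈ distinguishing G v Q, G.Adj z b) → G.Adj u a → G.Adj u b := by
      intro a b ha hb hub hbj hua
      by_cases hfu : Far G v u
      · have huQ : u ∈ Q := by
          rw [hv.component_eq hQ ha]
          exact ⟨hfu, .inr hua.symm⟩
        have hb' : b ∈ {x | Far G v x ∧ Dom G u x} := hv.component_eq hQ huQ ▸ hb
        exact hb'.2.resolve_left hub
      · by_contra hnb
        exact hnb (hbj u ⟨mem_level_two.2 ⟨hfu, mem_gvSet.1 hu⟩, ⟨a, ha, hua⟩, b, hb, hnb⟩)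
    exact ⟨main hp hq huq hqj, main hq hp hup hpj⟩

/-- The structure of an e.d. with at least three vertices in `N₃(v)`. -/
theorem component_structure [Finite V] (D : Finset V) (hG : IsFree G) (hprime : IsPrime (gv G v))
    (hD : IsED G D) (hvD : v ∈ D) (h₃ : 3 ≤ ((D : Set V) ∩ level G v 3).ncard) (Q : Set V)
    (hQ : IsRestComponent G v Q) :
    G.IsClique Q ∧ ∃ d : V, (D : Set V) ∩ Q = {d} ∧
      (Q = {d} ∨ ((distinguishing G v Q).Nonempty ∧ joined G v Q = {d})) ∧
      ∀ D' : Finset V, IsED G D' → v ∈ D' → (D' : Set V) ∩ Q = {d} := by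
  obtain ⟨d₁, ⟨hd₁, l₁⟩, d₂, ⟨hd₂, l₂⟩, d₃, ⟨hd₃, l₃⟩, h₁₂, h₁₃, h₂₃⟩ :=
    (Set.two_lt_ncard (Set.toFinite _)).1 h₃
  obtain ⟨z₁, hz₁, hdz₁⟩ := exists_of_mem_level_three l₁
  obtain ⟨z₂, hz₂, hdz₂⟩ := exists_of_mem_level_three l₂
  obtain ⟨z₃, hz₃, hdz₃⟩ := exists_of_mem_level_three l₃
  have hne : (level G v 2).Nonempty := ⟨z₁, hz₁⟩
  rw [mem_level_two] at hz₁ hz₂ hz₃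
  -- Each of the three vertices in N₃ dominates a vertex of N₂, which supplies three dominators for
  -- N₂.
  have hv := restCliques_of_three hG hD hvD hz₁.1 hz₁.2 hd₁ (.inr hdz₁.symm) hz₂.1 hz₂.2 hd₂
    (.inr hdz₂.symm) hz₃.1 hz₃.2 hd₃ (.inr hdz₃.symm) h₁₂ h₁₃ h₂₃
  obtain ⟨d, hd, hdz⟩ := exists_inter_component_eq hG hv hQ hD hvD
  have hdQ : d ∈ Q := (hd ▸ Set.mem_singleton d : d ∈ (D : Set V) ∩ Q).2
  have hdj : d ∈ joined G v Q := ⟨hdQ, fun z hz => hdz z hz.1 hz.2.1⟩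
  have hsub := joined_subsingleton hv hprime hne hQ
  have hjoined : joined G v Q = {d} := hsub.eq_singleton_of_mem hdj
  refine ⟨fun a ha b hb hab => ?_, d, hd, ?_, fun D' hD' hvD' => ?_⟩
  · have hb' : b ∈ {x | Far G v x ∧ Dom G a x} := hv.component_eq hQ ha ▸ hb
    exact hb'.2.resolve_left hab
  · by_cases hS : (distinguishing G v Q).Nonempty
    · exact .inr ⟨hS, hjoined⟩
    -- If nothing distinguishes `Q`, the condition on joined vertices is empty, and `joined G v Q`
    -- is all of `Q`.
    · left
      rw [← hjoined]
      rw [Set.not_nonempty_iff_eq_empty] at hS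
      ext q
      simp [joined, hS]
  -- The representative of any other e.d. through `v` is also joined, and there is only one joined
  -- vertex.
  · obtain ⟨d', hd', hdz'⟩ := exists_inter_component_eq hG hv hQ hD' hvD'
    have hdQ' : d' ∈ Q := (hd' ▸ Set.mem_singleton d' : d' ∈ (D' : Set V) ∩ Q).2
    rw [hd', hsub hdj ⟨hdQ', fun z hz => hdz' z hz.1 hz.2.1⟩]

/-- Two nonadjacent vertices of `R` form an e.d. together with `v` if and only if all other
vertices of `G_v` are adjacent to exactly one of them. -/
theorem isED_triple_iff {x y : V} (hx : x ∈ rest G v) (hy : y ∈ rest G v) (hxy : x ≠ y)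
    (hadj : ¬ G.Adj x y) : IsED G {v, x, y} ↔
      ∀ u ∈ gvSet G v, u ≠ x → u ≠ y → Xor (G.Adj x u) (G.Adj y u) := by
  rw [mem_rest] at hx hy
  constructor
  · intro h u hu hux huy
    rw [mem_gvSet] at hu
    obtain ⟨d, hd, hdu⟩ := h.exists_dom u
    have hne : ¬ (G.Adj x u ∧ G.Adj y u) := fun h' =>
      hxy (h.eq_of_dom (by simp) (by simp) (.inr h'.1) (.inr h'.2))
    simp only [Finset.mem_insert, Finset.mem_singleton] at hd
    rcases hd with rfl | rfl | rfl
    · exact absurd hdu hu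
    · have := hdu.resolve_left (Ne.symm hux)
      exact .inl ⟨this, fun h' => hne ⟨this, h'⟩⟩
    · have := hdu.resolve_left (Ne.symm huy)
      exact .inr ⟨this, fun h' => hne ⟨h', this⟩⟩
  · intro h
    have hfar : ∀ u, Dom G x u → ¬ Dom G y u := by
      intro u hxu hyu
      rcases hxu with rfl | hxu
      · exact hyu.elim (fun h => hxy h.symm) (fun h => hadj h.symm)
      rcases hyu with rfl | hyu
      · exact hadj hxu
      have hu : u ∈ gvSet G v := mem_gvSet.2 fun h' => hx u h' (.inr hxu)
      rcases h u hu hxu.ne' hyu.ne' with h' | h'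
      exacts [h'.2 hyu, h'.2 hxu]
    rw [isED_iff]
    constructor
    · intro u
      by_cases hvu : Dom G v u
      · exact ⟨v, by simp, hvu⟩
      by_cases hux : u = x
      · exact ⟨x, by simp, .inl hux.symm⟩
      by_cases huy : u = y
      · exact ⟨y, by simp, .inl huy.symm⟩
      rcases h u (mem_gvSet.2 hvu) hux huy with h' | h'
      · exact ⟨x, by simp, .inr h'.1⟩
      · exact ⟨y, by simp, .inr h'.1⟩
    · intro d hd d' hd' u hu hu'
      simp only [Finset.mem_insert, Finset.mem_singleton] at hd hd'
      rcases hd with rfl | rfl | rfl <;> rcases hd' with rfl | rfl | rfl <;>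
        first
          | rfl
          | exact absurd hu' (hx u hu)
          | exact absurd hu' (hy u hu)
          | exact absurd hu (hx u hu')
          | exact absurd hu (hy u hu')
          | exact absurd hu' (hfar u hu)
          | exact absurd hu (hfar u hu')

/-- The e.d. of `G_v` that avoid `N₂(v)` are the e.d. of `G` that contain `v`, without `v`. -/
theorem isED_gv [DecidableEq V] {D : Finset (gvSet G v)} (hD : IsED (gv G v) D)
    (hfar : ∀ d ∈ D, d.1 ∈ rest G v) :
    IsED G (insert v (D.map (Function.Embedding.subtype _))) := by
  have dom : ∀ {a b : gvSet G v}, Dom (gv G v) a b ↔ Dom G a.1 b.1 := by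
    intro a b
    exact or_congr Subtype.ext_iff Iff.rfl
  rw [isED_iff]
  constructor
  · intro u
    by_cases hu : Dom G v u
    · exact ⟨v, by simp, hu⟩
    · obtain ⟨d, hd, hdu⟩ := hD.exists_dom ⟨u, mem_gvSet.2 hu⟩
      exact ⟨d, by simp [hd], dom.1 hdu⟩
  · intro d hd d' hd' u hu hu'
    simp only [Finset.mem_insert, Finset.mem_map, Function.Embedding.subtype_apply] at hd hd'
    rcases hd with rfl | ⟨d, hd, rfl⟩ <;> rcases hd' with rfl | ⟨d', hd', rfl⟩
    · rfl
    · exact absurd hu' (mem_rest.1 (hfar _ hd') u hu)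
    · exact absurd hu (mem_rest.1 (hfar _ hd) u hu')
    · have hvu : ¬ Dom G v u := fun h => mem_rest.1 (hfar _ hd) u h hu
      exact congrArg _ (hD.eq_of_dom (u := ⟨u, mem_gvSet.2 hvu⟩) hd hd' (dom.2 hu) (dom.2 hu'))

/-- Since `v` is the only member of `D` in N[v], a vertex not dominated by `v` has its dominator
outside N[v]. -/
theorem IsED.gv {D : Finset V} (hD : IsED G D) (hv : v ∈ D) :
    IsED (gv G v) (D.subtype (· ∈ gvSet G v)) := by
  have dom : ∀ {a b : gvSet G v}, Dom (WED.gv G v) a b ↔ Dom G a.1 b.1 := by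
    intro a b
    exact or_congr Subtype.ext_iff Iff.rfl
  rw [isED_iff]
  constructor
  · rintro ⟨u, hu⟩
    obtain ⟨d, hd, hdu⟩ := hD.exists_dom u
    have hdv : d ∈ gvSet G v := by
      refine mem_gvSet.2 fun h => ?_
      obtain rfl := hD.eq_of_dom hv hd h (.refl d)
      exact mem_gvSet.1 hu hdu
    exact ⟨⟨d, hdv⟩, by simpa using hd, dom.2 hdu⟩
  · intro d hd d' hd' u hu hu'
    exact Subtype.ext (hD.eq_of_dom (by simpa using hd) (by simpa using hd') (dom.1 hu)
      (dom.1 hu'))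

end Levels

/-! ### Candidates for an e.d. of minimum weight -/

section Candidates

variable {n : ℕ} {G : SimpleGraph (Fin n)} {w : Fin n → ℕ}

/-- The number of vertices dominated by a vertex. -/
noncomputable def domCard (G : SimpleGraph (Fin n)) (a : Fin n) : ℕ :=
  (Finset.univ.filter fun u => Dom G a u).card

/-- The order in which vertices are preferred: by degree, weight, and number. -/
def Beats (G : SimpleGraph (Fin n)) (w : Fin n → ℕ) (p q : Fin n) : Prop :=
  domCard G q < domCard G p ∨
    (domCard G q = domCard G p ∧ (w p < w q ∨ (w p = w q ∧ p < q)))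

/-- The vertex number breaks all ties, so a clique has a single preferred vertex. -/
theorem eq_of_not_beats {p q : Fin n} (h₁ : ¬ Beats G w p q) (h₂ : ¬ Beats G w q p) : p = q := by
  simp only [Beats] at h₁ h₂
  ext
  simp only [Fin.lt_def] at h₁ h₂
  omega

/-- The preferred vertex is a minimum in a lexicographic order, reversed in the first coordinate
since large degrees are preferred. -/
theorem exists_not_beats {s : Finset (Fin n)} (hs : s.Nonempty) :
    ∃ q ∈ s, ∀ p ∈ s, ¬ Beats G w p q := by
  obtain ⟨q, hq, h⟩ := s.exists_min_image
    (fun p => toLex (OrderDual.toDual (domCard G p), toLex (w p, p))) hs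
  refine ⟨q, hq, fun p hp hb => ?_⟩
  refine (h p hp).not_gt ?_
  rw [Prod.Lex.lt_iff]
  rcases hb with hb | ⟨hb, hw⟩
  · exact .inl hb
  · refine .inr ⟨congrArg OrderDual.toDual hb.symm, ?_⟩
    rw [Prod.Lex.lt_iff]
    exact hw

/-- The set `T`, completed by the preferred vertices among those that are far from `T`. -/
noncomputable def candidate (G : SimpleGraph (Fin n)) (w : Fin n → ℕ) (T : Finset (Fin n)) :
    Finset (Fin n) :=
  Finset.univ.filter fun q => q ∈ T ∨ ((∀ t ∈ T, Far G t q) ∧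
    ∀ p, Dom G q p → (∀ t ∈ T, Far G t p) → ¬ Beats G w p q)

/-- By `hN`, a far vertex `q` dominated by `d` satisfies N[q] ⊆ N[d], so the preferred vertex `f d`,
which dominates at least as many vertices as `d`, has the same closed neighbourhood. Exchanging `d`
for `f d` thus keeps all dominations, and the second criterion makes `f d` no heavier. Transitivity,
`hT`, lets the preferred vertex be recognised within its own neighbourhood, without knowledge of
`D`. -/
theorem candidate_spec {D T : Finset (Fin n)} (hD : IsED G D)
    (hE : IsED G (T ∪ D.filter fun d => ∀ t ∈ T, Far G t d))
    (hN : ∀ q, (∀ t ∈ T, Far G t q) → ∀ d ∈ D, Dom G d q →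
      (∀ t ∈ T, Far G t d) ∧ ∀ u, Dom G q u → Dom G d u)
    (hT : ∀ a b c, (∀ t ∈ T, Far G t a) → (∀ t ∈ T, Far G t b) → (∀ t ∈ T, Far G t c) →
      Dom G a b → Dom G b c → Dom G a c) :
    IsED G (candidate G w T) ∧ ∑ d ∈ candidate G w T, w d ≤
      ∑ d ∈ T, w d + ∑ d ∈ D.filter (fun d => ∀ t ∈ T, Far G t d), w d := by
  set M : Fin n → Prop := fun q => ∀ t ∈ T, Far G t q with hM
  have choose : ∀ d : Fin n, ∃ q, d ∈ D → M d → M q ∧ Dom G d q ∧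
      ∀ p, M p → Dom G d p → ¬ Beats G w p q := by
    intro d
    by_cases hd : d ∈ D ∧ M d
    · obtain ⟨q, hq, h⟩ := exists_not_beats (G := G) (w := w)
        (s := Finset.univ.filter fun q => M q ∧ Dom G d q) ⟨d, by simp [hd.2, Dom.refl]⟩
      simp only [Finset.mem_filter, Finset.mem_univ, true_and] at hq h
      exact ⟨q, fun _ _ => ⟨hq.1, hq.2, fun p h₁ h₂ => h p ⟨h₁, h₂⟩⟩⟩
    · exact ⟨d, fun h₁ h₂ => absurd ⟨h₁, h₂⟩ hd⟩
  choose f hf using choose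
  have fdom : ∀ d ∈ D, M d → ∀ u, Dom G (f d) u ↔ Dom G d u := by
    intro d hd hMd
    obtain ⟨h₁, h₂, h₃⟩ := hf d hd hMd
    have sub : (Finset.univ.filter fun u => Dom G (f d) u) ⊆
        Finset.univ.filter fun u => Dom G d u := fun u hu => by
      simp only [Finset.mem_filter, Finset.mem_univ, true_and] at hu ⊢
      exact (hN _ h₁ d hd h₂).2 u hu
    have hb := h₃ d hMd (.refl d)
    simp only [Beats, not_or, not_lt] at hb
    have := Finset.eq_of_subset_of_card_le sub hb.1
    intro u
    simpa using Finset.ext_iff.1 this u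
  have fw : ∀ d ∈ D, M d → w (f d) ≤ w d := by
    intro d hd hMd
    obtain ⟨h₁, h₂, h₃⟩ := hf d hd hMd
    have hcard : domCard G (f d) = domCard G d := by
      simp only [domCard, fdom d hd hMd]
    have hb := h₃ d hMd (.refl d)
    simp only [Beats, not_or, not_and, not_lt] at hb
    exact (hb.2 hcard).1
  have hcand : candidate G w T = T ∪ (D.filter M).image f := by
    ext q
    simp only [candidate, Finset.mem_filter, Finset.mem_univ, true_and, Finset.mem_union,
      Finset.mem_image]
    refine or_congr Iff.rfl ⟨?_, ?_⟩
    · rintro ⟨hMq, hq⟩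
      obtain ⟨d, hd, hdq⟩ := hD.exists_dom q
      have hMd : M d := (hN q hMq d hd hdq).1
      obtain ⟨h₁, h₂, h₃⟩ := hf d hd hMd
      -- `q` and `f d` are preferred in the same clique, so neither beats the other.
      exact ⟨d, ⟨hd, hMd⟩, eq_of_not_beats
        (hq _ (hT q d _ hMq hMd h₁ hdq.symm h₂) h₁) (h₃ q hMq hdq)⟩
    · rintro ⟨d, ⟨hd, hMd⟩, rfl⟩
      obtain ⟨h₁, h₂, h₃⟩ := hf d hd hMd
      exact ⟨h₁, fun p hp hMp => h₃ p hMp ((hN _ h₁ d hd h₂).2 p hp)⟩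
  rw [hcand]
  constructor
  · rw [isED_iff] at hE ⊢
    obtain ⟨hE₁, hE₂⟩ := hE
    simp only [Finset.mem_union, Finset.mem_filter] at hE₁ hE₂
    have back : ∀ q ∈ T ∪ (D.filter M).image f, ∃ d, (d ∈ T ∨ d ∈ D ∧ M d) ∧
        (d ∈ T ∧ q = d ∨ (d ∈ D ∧ M d) ∧ q = f d) ∧ ∀ u, Dom G q u → Dom G d u := by
      intro q hq
      rcases Finset.mem_union.1 hq with hq | hq
      · exact ⟨q, .inl hq, .inl ⟨hq, rfl⟩, fun u hu => hu⟩
      · obtain ⟨d, hd, rfl⟩ := Finset.mem_image.1 hq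
        rw [Finset.mem_filter] at hd
        exact ⟨d, .inr hd, .inr ⟨hd, rfl⟩, fun u hu => (fdom d hd.1 hd.2 u).1 hu⟩
    constructor
    · intro u
      obtain ⟨d, hd, hdu⟩ := hE₁ u
      rcases hd with hd | hd
      · exact ⟨d, Finset.mem_union_left _ hd, hdu⟩
      · exact ⟨f d, Finset.mem_union_right _ (Finset.mem_image_of_mem _ (Finset.mem_filter.2 hd)),
          (fdom d hd.1 hd.2 u).2 hdu⟩
    · intro q hq q' hq' u hu hu'
      obtain ⟨d, h₁, h₂, h₃⟩ := back q hq
      obtain ⟨d', h₁', h₂', h₃'⟩ := back q' hq'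
      obtain rfl := hE₂ d h₁ d' h₁' u (h₃ u hu) (h₃' u hu')
      have disj : ∀ {d}, d ∈ T → M d → False := fun h h' => not_far_self _ (h' _ h)
      rcases h₂ with ⟨h₂, rfl⟩ | ⟨h₂, rfl⟩ <;> rcases h₂' with ⟨h₂', h⟩ | ⟨h₂', h⟩
      · exact h.symm
      · exact (disj h₂ h₂'.2).elim
      · exact (disj h₂' h₂.2).elim
      · exact h.symm
  · refine le_trans (le_of_le_of_eq (Nat.le_add_right _ _) Finset.sum_union_inter)
      (Nat.add_le_add_left ?_ _)
    refine (Finset.sum_image_le_of_nonneg fun _ _ => Nat.zero_le _).trans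
      (Finset.sum_le_sum fun d hd => ?_)
    rw [Finset.mem_filter] at hd
    exact fw d hd.1 hd.2

/-- Let `d` dominate a vertex `q` far from `r`. The neighbours of `q` far from `r` lie in the clique
of `d`, and the others are dominated by `d` by `dom_of_adj_of_far`. This is the inclusion N[q] ⊆
N[d] that the exchange requires. -/
theorem candidate_singleton (hG : IsFree G) {D : Finset (Fin n)} (hD : IsED G D) {r : Fin n}
    (hr : r ∈ D) (hrest : RestCliques G r) :
    IsED G (candidate G w {r}) ∧ ∑ d ∈ candidate G w {r}, w d ≤ ∑ d ∈ D, w d := by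
  have hunion : {r} ∪ D.filter (fun d => ∀ t ∈ ({r} : Finset (Fin n)), Far G t d) = D := by
    ext d
    simp only [Finset.mem_union, Finset.mem_singleton, Finset.mem_filter, forall_eq]
    constructor
    · rintro (rfl | h)
      exacts [hr, h.1]
    · intro hd
      by_cases h : d = r
      · exact .inl h
      · exact .inr ⟨hd, hD.far hr hd (Ne.symm h)⟩
  have hdisj : Disjoint {r} (D.filter fun d => ∀ t ∈ ({r} : Finset (Fin n)), Far G t d) := by
    rw [Finset.disjoint_singleton_left]
    intro h
    exact not_far_self r ((Finset.mem_filter.1 h).2 r (by simp))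
  have := candidate_spec (w := w) (T := {r}) hD (by rwa [hunion]) ?_ ?_
  · rwa [← Finset.sum_union hdisj, hunion] at this
  · simp only [Finset.mem_singleton, forall_eq]
    intro q hq d hd hdq
    have hrd := hD.far_of_dom hr hq hd hdq
    refine ⟨hrd, fun u hqu => ?_⟩
    rcases hqu with rfl | hqu
    · exact hdq
    by_cases hu : Far G r u
    · exact hrest d q u hrd hq hu hdq (.inr hqu)
    · exact dom_of_adj_of_far hG hD hr hq hd hdq hqu hu
  · simp only [Finset.mem_singleton, forall_eq]
    exact hrest

theorem InCliqueComponent.of_dom {a u : Fin n} (h : InCliqueComponent G u) (ha : Dom G u a) :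
    InCliqueComponent G a := by
  intro b hb c
  rw [h a ha] at hb
  rw [h b hb, h a ha]

/-- The vertices far from `T` are exactly those in clique components, where closed neighbourhoods
within a component coincide. So `T` can take over the part of `D` in the other components, while in
each clique component any vertex may serve. -/
theorem candidate_cover {D T : Finset (Fin n)} (hD : IsED G D)
    (hpair : ∀ t ∈ T, ∀ t' ∈ T, t ≠ t' → Far G t t')
    (hTc : ∀ t ∈ T, ¬ InCliqueComponent G t)
    (hcover : ∀ u, ¬ InCliqueComponent G u → ∃ t ∈ T, Dom G t u)
    (hw : ∑ t ∈ T, w t ≤ ∑ d ∈ D.filter (fun d => ¬ InCliqueComponent G d), w d) :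
    IsED G (candidate G w T) ∧ ∑ d ∈ candidate G w T, w d ≤ ∑ d ∈ D, w d := by
  have hM : ∀ q, (∀ t ∈ T, Far G t q) ↔ InCliqueComponent G q := by
    intro q
    constructor
    · intro h
      by_contra hq
      obtain ⟨t, ht, htq⟩ := hcover q hq
      exact (h t ht).not_dom htq
    · intro h t ht
      by_contra hf
      obtain ⟨u, h₁, h₂⟩ := not_far_iff.1 hf
      exact hTc t ht ((h.of_dom h₂).of_dom h₁.symm)
  have := candidate_spec (w := w) (T := T) hD ?_ ?_ ?_
  · refine ⟨this.1, this.2.trans ?_⟩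
    simp only [hM]
    rw [← Finset.sum_filter_add_sum_filter_not D (fun d => InCliqueComponent G d), Nat.add_comm]
    exact Nat.add_le_add_left hw _
  · simp only [hM]
    rw [isED_iff]
    simp only [Finset.mem_union, Finset.mem_filter]
    constructor
    · intro u
      by_cases hu : InCliqueComponent G u
      · obtain ⟨d, hd, hdu⟩ := hD.exists_dom u
        exact ⟨d, .inr ⟨hd, hu.of_dom hdu.symm⟩, hdu⟩
      · obtain ⟨t, ht, htu⟩ := hcover u hu
        exact ⟨t, .inl ht, htu⟩
    · have mixed : ∀ {d d' u}, d ∈ T → InCliqueComponent G d' → Dom G d u → ¬ Dom G d' u :=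
        fun h h' hu hu' => hTc _ h ((h'.of_dom hu').of_dom hu.symm)
      rintro d (hd | hd) d' (hd' | hd') u hu hu'
      · by_contra hne
        exact hpair d hd d' hd' hne u hu hu'
      · exact (mixed hd hd'.2 hu hu').elim
      · exact (mixed hd' hd.2 hu' hu).elim
      · exact hD.eq_of_dom hd.1 hd'.1 hu hu'
  · simp only [hM]
    exact fun q hq d _ hdq => ⟨hq.of_dom hdq.symm, fun u hqu => (hq d hdq.symm u).2 hqu⟩
  · simp only [hM]
    exact fun a b c ha _ _ hab hbc => (ha b hab c).1 hbc

/-- Vertices that are pairwise far and dominate as many vertices as there are outside `X` dominate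
exactly the vertices outside `X`. -/
theorem exists_dom_of_sum_eq {T X : Finset (Fin n)}
    (hpair : ∀ t ∈ T, ∀ t' ∈ T, t ≠ t' → Far G t t')
    (hTX : ∀ t ∈ T, ∀ u, Dom G t u → u ∉ X) (hsum : ∑ t ∈ T, domCard G t + X.card = n) :
    ∀ u, u ∉ X → ∃ t ∈ T, Dom G t u := by
  have hdisj : (T : Set (Fin n)).PairwiseDisjoint
      fun t => Finset.univ.filter fun u => Dom G t u := by
    intro t ht t' ht' hne
    rw [Function.onFun, Finset.disjoint_left]
    simp only [Finset.mem_filter, Finset.mem_univ, true_and]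
    exact hpair t ht t' ht' hne
  have hcard := Finset.card_biUnion hdisj
  have hsub : T.biUnion (fun t => Finset.univ.filter fun u => Dom G t u) ⊆ Xᶜ := by
    intro u hu
    simp only [Finset.mem_biUnion, Finset.mem_filter, Finset.mem_univ, true_and] at hu
    obtain ⟨t, ht, htu⟩ := hu
    exact Finset.mem_compl.2 (hTX t ht u htu)
  have hX : Xᶜ.card = n - X.card := by rw [Finset.card_compl, Fintype.card_fin]
  -- The closed neighbourhoods are disjoint subsets of `Xᶜ` whose sizes add up to that of `Xᶜ`.
  have heq := Finset.eq_of_subset_of_card_le hsub (by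
    rw [hcard, hX]
    simp only [domCard] at hsum
    omega)
  intro u hu
  have : u ∈ T.biUnion (fun t => Finset.univ.filter fun u => Dom G t u) := by
    rw [heq]
    exact Finset.mem_compl.2 hu
  simpa using this

/-- The converse of `exists_dom_of_sum_eq`: here the closed neighbourhoods partition `Xᶜ`. -/
theorem sum_domCard_eq {T X : Finset (Fin n)}
    (hpair : ∀ t ∈ T, ∀ t' ∈ T, t ≠ t' → Far G t t')
    (hTX : ∀ t ∈ T, ∀ u, Dom G t u → u ∉ X) (hcover : ∀ u, u ∉ X → ∃ t ∈ T, Dom G t u) :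
    ∑ t ∈ T, domCard G t + X.card = n := by
  have hdisj : (T : Set (Fin n)).PairwiseDisjoint
      fun t => Finset.univ.filter fun u => Dom G t u := by
    intro t ht t' ht' hne
    rw [Function.onFun, Finset.disjoint_left]
    simp only [Finset.mem_filter, Finset.mem_univ, true_and]
    exact hpair t ht t' ht' hne
  have heq : T.biUnion (fun t => Finset.univ.filter fun u => Dom G t u) = Xᶜ := by
    ext u
    simp only [Finset.mem_biUnion, Finset.mem_filter, Finset.mem_univ, true_and,
      Finset.mem_compl]
    exact ⟨fun ⟨t, ht, htu⟩ => hTX t ht u htu, hcover u⟩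
  have := Finset.card_biUnion hdisj
  rw [heq] at this
  simp only [domCard]
  rw [← this, Finset.card_compl_add_card, Fintype.card_fin]

end Candidates


/-! ### Derived expressions and commands -/

namespace Expr

def not (a : Expr) : Expr := .lt a (.const 1)

def and (a b : Expr) : Expr := .ite a b (.const 0)

def or (a b : Expr) : Expr := .ite a (.const 1) b

def eq (a b : Expr) : Expr := (not (.lt a b)).and (not (.lt b a))

def iff (a b : Expr) : Expr := (not a).eq (not b)

def all (i : ℕ) (a : Expr) : Expr := not (.sum i (not a))

def count (i : ℕ) (a : Expr) : Expr := .sum i (.ite a (.const 1) (.const 0))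

/-- The truth of an expression. -/
def Holds (m : ℕ) (e : Expr) (s : Store) : Prop := e.eval m s ≠ 0

variable {m : ℕ} {a b c : Expr} {s : Store} {i k : ℕ}

@[simp] theorem eval_const : (const k).eval m s = k := rfl

@[simp] theorem eval_var : (var k).eval m s = s.var k := rfl

@[simp] theorem eval_add : (add a b).eval m s = a.eval m s + b.eval m s := rfl

@[simp] theorem eval_sub : (sub a b).eval m s = a.eval m s - b.eval m s := rfl

@[simp] theorem eval_sum : (sum i a).eval m s = ∑ k ∈ Finset.range m, a.eval m (s.set i k) := rfl

@[simp] theorem holds_low : (low a).Holds m s ↔ a.eval m s < m * m ∧ s.low (a.eval m s) ≠ 0 := by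
  rw [Holds, eval]
  split_ifs with h <;> simp [h]

@[simp] theorem holds_lt : (lt a b).Holds m s ↔ a.eval m s < b.eval m s := by
  simp [Holds, eval]

@[simp] theorem holds_not : (not a).Holds m s ↔ ¬ a.Holds m s := by
  simp [Holds, not, eval]

theorem eval_not : (not a).eval m s = if a.Holds m s then 0 else 1 := by
  by_cases h : a.eval m s = 0 <;> simp [not, eval, Holds, h]

@[simp] theorem holds_and : (and a b).Holds m s ↔ a.Holds m s ∧ b.Holds m s := by
  simp [Holds, and, eval]

@[simp] theorem holds_or : (or a b).Holds m s ↔ a.Holds m s ∨ b.Holds m s := by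
  by_cases h : a.eval m s = 0 <;> simp [Holds, or, eval, h]

@[simp] theorem holds_eq : (eq a b).Holds m s ↔ a.eval m s = b.eval m s := by
  rw [eq, holds_and, holds_not, holds_not, holds_lt, holds_lt]
  omega

@[simp] theorem holds_iff : (iff a b).Holds m s ↔ (a.Holds m s ↔ b.Holds m s) := by
  rw [iff, holds_eq, eval_not, eval_not]
  by_cases h₁ : a.Holds m s <;> by_cases h₂ : b.Holds m s <;> simp [h₁, h₂]

@[simp] theorem holds_all : (all i a).Holds m s ↔ ∀ k < m, a.Holds m (s.set i k) := by
  rw [all, holds_not, Holds, eval, not_not, Finset.sum_eq_zero_iff]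
  refine forall_congr' fun k => ?_
  rw [Finset.mem_range, eval_not]
  simp

@[simp] theorem eval_count : (count i a).eval m s =
    ∑ k ∈ Finset.range m, if a.Holds m (s.set i k) then 1 else 0 := by
  rw [count, eval]
  refine Finset.sum_congr rfl fun k _ => ?_
  by_cases h : a.eval m (s.set i k) = 0 <;> simp [eval, Holds, h]

@[simp] theorem eval_ite : (ite c a b).eval m s =
    if c.Holds m s then a.eval m s else b.eval m s := by
  by_cases h : c.eval m s = 0 <;> simp [eval, Holds, h]

@[simp] theorem holds_get {a b : Expr} : (get k a b).Holds m s ↔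
    (a.eval m s < m ∧ b.eval m s < m) ∧ s.arr k (a.eval m s) (b.eval m s) ≠ 0 := by
  rw [Holds, eval]
  split_ifs with h <;> simp [h]

/-- Whether an expression refers to the array `k`. -/
def reads (k : ℕ) : Expr → Bool
  | .const _ => false
  | .var _ => false
  | .add a b => a.reads k || b.reads k
  | .sub a b => a.reads k || b.reads k
  | .lt a b => a.reads k || b.reads k
  | .ite c a b => c.reads k || (a.reads k || b.reads k)
  | .get l i j => l == k || (i.reads k || j.reads k)
  | .low a => a.reads k
  | .sum _ a => a.reads k

/-- Allows an expression to be evaluated while the array `k` is being filled with its values. -/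
theorem eval_setArr {e : Expr} (h : e.reads k = false) (s : Store) (f : ℕ → ℕ → ℕ) :
    e.eval m (s.setArr k f) = e.eval m s := by
  induction e generalizing s with
  | const => rfl
  | var => rfl
  | get l i j ihi ihj =>
    simp only [reads, Bool.or_eq_false_iff, beq_eq_false_iff_ne] at h
    simp only [eval, ihi h.2.1, ihj h.2.2]
    simp only [Store.setArr, Function.update_of_ne h.1]
  | sum i a ih =>
    simp only [eval]
    exact Finset.sum_congr rfl fun x _ => ih h (s.set i x)
  | low a ih =>
    simp only [eval, ih h]
    rfl
  | _ =>
    simp only [reads, Bool.or_eq_false_iff] at h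
    simp only [eval, *]

end Expr

namespace Store

variable (s : Store) (r x k a : ℕ) (f : ℕ → ℕ → ℕ)

@[simp] theorem set_var (r' : ℕ) : (s.set r x).var r' = if r' = r then x else s.var r' := by
  simp [set, Function.update_apply]

@[simp] theorem set_arr : (s.set r x).arr = s.arr := by cases s; simp only [set]

@[simp] theorem set_low : (s.set r x).low = s.low := by cases s; simp only [set]

@[simp] theorem setArr_var : (s.setArr k f).var = s.var := by cases s; simp only [setArr]

@[simp] theorem setArr_arr (k' : ℕ) : (s.setArr k f).arr k' = if k' = k then f else s.arr k' := by
  simp [setArr, Function.update_apply]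

theorem setArr_set : (s.setArr k f).set r x = (s.set r x).setArr k f := rfl

@[simp] theorem set_self : s.set r (s.var r) = s := by
  simp [set]

end Store

namespace Cmd

def skip : Cmd := .set 0 (.var 0)

/-- Fills a row of an array. -/
def fillRow (k : ℕ) (r : Expr) (i : ℕ) (e : Expr) : Cmd := .loop i (.put k r (.var i) e)

/-- Fills the first row of an array. -/
def fill (k i : ℕ) (e : Expr) : Cmd := fillRow k (.const 0) i e

/-- Fills an array. -/
def fillArr (k i j : ℕ) (e : Expr) : Cmd := .loop i (fillRow k (.var i) j e)

variable {m : ℕ} {s : Store}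

theorem eval_skip : skip.eval m s = s := by
  simp [skip, eval, Expr.eval]

theorem eval_ite {c : Expr} {p q : Cmd} : (ite c p q).eval m s =
    if c.Holds m s then p.eval m s else q.eval m s := by
  by_cases h : c.eval m s = 0 <;> simp [eval, Expr.Holds, h]

/-- Gives a loop in closed form: `g k s` is the store after `k` rounds, up to the value of the loop
variable. -/
theorem iter_eq {f : ℕ → Store → Store} {g : ℕ → Store → Store} {i : ℕ} {s : Store}
    (h₀ : g 0 s = s) (hf : ∀ k < m, ∀ x, f k ((g k s).set i x) = (g (k + 1) s).set i k) :
    (iter f m s).set i (s.var i) = (g m s).set i (s.var i) := by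
  suffices h : ∀ k ≤ m, ∃ x, iter f k s = (g k s).set i x by
    obtain ⟨x, hx⟩ := h m le_rfl
    rw [hx, Store.set_set]
  intro k
  induction k with
  | zero => exact fun _ => ⟨(g 0 s).var i, by simp [iter, h₀]⟩
  | succ k ih =>
    intro hk
    obtain ⟨x, hx⟩ := ih (by omega)
    exact ⟨k, by rw [iter, hx, hf k (by omega)]⟩

theorem eval_fillRow {k i : ℕ} {r e : Expr} (hr : ∀ x, r.eval m (s.set i x) = r.eval m s)
    (hrk : r.reads k = false) (he : e.reads k = false) (hm : r.eval m s < m) :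
    (fillRow k r i e).eval m s = s.setArr k (Function.update (s.arr k) (r.eval m s)
      fun b => if b < m then e.eval m (s.set i b) else s.arr k (r.eval m s) b) := by
  rw [fillRow, eval, iter_eq (g := fun l s => s.setArr k (Function.update (s.arr k) (r.eval m s)
      fun b => if b < l then e.eval m (s.set i b) else s.arr k (r.eval m s) b))]
  · rw [Store.setArr_set, Store.set_self]
  · simp [Store.setArr]
  · intro l hl x
    rw [Store.set_set, Store.setArr_set]
    simp only [eval, Expr.eval_setArr hrk, Expr.eval_setArr he, hr, Expr.eval]
    have hv : (((s.set i l).setArr k (Function.update (s.arr k) (r.eval m s)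
      fun b => if b < l then e.eval m (s.set i b) else s.arr k (r.eval m s) b))).var i = l := by
      simp
    rw [hv, if_pos ⟨hm, hl⟩]
    simp only [Store.setArr, Store.set, Function.update_self, Function.update_idem]
    congr 2
    congr 1
    funext b
    by_cases hb : b = l
    · subst hb
      simp
    · rw [Function.update_of_ne hb]
      by_cases hbl : b < l
      · rw [if_pos hbl, if_pos (by omega)]
      · rw [if_neg hbl, if_neg (by omega)]

theorem eval_fill {k i : ℕ} {e : Expr} (he : e.reads k = false) (hm : 0 < m) :
    (fill k i e).eval m s = s.setArr k (Function.update (s.arr k) 0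
      fun b => if b < m then e.eval m (s.set i b) else s.arr k 0 b) :=
  eval_fillRow (fun _ => rfl) rfl he hm

theorem eval_fillArr {k i j : ℕ} {e : Expr} (he : e.reads k = false) (hij : i ≠ j) :
    (fillArr k i j e).eval m s = s.setArr k fun a b =>
      if a < m ∧ b < m then e.eval m ((s.set i a).set j b) else s.arr k a b := by
  rw [fillArr, eval, iter_eq (g := fun l s => s.setArr k fun a b =>
      if a < l ∧ b < m then e.eval m ((s.set i a).set j b) else s.arr k a b)]
  · rw [Store.setArr_set, Store.set_self]
  · simp [Store.setArr]
  · intro l hl x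
    rw [Store.set_set, Store.setArr_set]
    have hv : ∀ f, Expr.eval m (.var i) ((s.set i l).setArr k f) = l := by
      intro f
      simp [Expr.eval]
    rw [eval_fillRow (fun x => by simp [Expr.eval, hij]) rfl he (by rw [hv]; exact hl), hv]
    simp only [Store.setArr_set, Expr.eval_setArr he]
    simp only [Store.setArr, Store.set, Function.update_self, Function.update_idem]
    congr 2
    funext a b
    by_cases ha : a = l
    · subst ha
      simp
    · rw [Function.update_of_ne ha]
      have : a < l ↔ a < l + 1 := by omega
      simp [this]

/-- An induction principle for loops: `R` is an invariant, and the round `k` achieves `P k`. -/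
theorem loop_spec {i : ℕ} {p : Cmd} {s : Store} (R : Store → Prop) (P : ℕ → Store → Prop)
    (h₀ : R s)
    (step : ∀ k < m, ∀ t, R t → R ((p.eval m (t.set i k)).set i (s.var i)) ∧
      P k ((p.eval m (t.set i k)).set i (s.var i)) ∧
      ∀ l, P l t → P l ((p.eval m (t.set i k)).set i (s.var i))) :
    R ((loop i p).eval m s) ∧ ∀ k < m, P k ((loop i p).eval m s) := by
  rw [eval]
  suffices h : ∀ l ≤ m, R ((iter (fun k s => p.eval m (s.set i k)) l s).set i (s.var i)) ∧
      ∀ k < l, P k ((iter (fun k s => p.eval m (s.set i k)) l s).set i (s.var i)) from h m le_rfl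
  intro l
  induction l with
  | zero => exact fun _ => ⟨by rwa [iter, Store.set_self], fun k hk => by omega⟩
  | succ l ih =>
    intro hl
    obtain ⟨h₁, h₂⟩ := ih (by omega)
    obtain ⟨h₃, h₄, h₅⟩ := step l (by omega) _ h₁
    rw [Store.set_set] at h₃ h₄ h₅
    refine ⟨h₃, fun k hk => ?_⟩
    by_cases hkl : k = l
    · subst hkl
      exact h₄
    · exact h₅ k (h₂ k (by omega))

end Cmd


/-! ### The programs

The variables `0`, `1`, `2`, `3`, `4` hold the number `n` of vertices, the argument, `n²`, a number
that exceeds all finite weights, and the number of vertices that are to be dominated by a triple.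
The variables `5`–`8` hold the weight and the vertices of the best triple, `9` the weight of the
best set, `10`–`12` the present triple, and `13` the weight of the present set. The number `n`
serves as a dummy vertex, which is isolated and has weight `0`.

The arrays are: `0` domination, `1` being far, `2` degrees, `3` weights, `4` vertices not allowed
in triples, `5` vertices far from the present triple, `6` the present set, `7` the best set. -/

section Numbers

variable {n : ℕ}

/-- Extension of a function on the vertices by `0`. -/
noncomputable def extend (f : Fin n → ℕ) (i : ℕ) : ℕ := if h : i < n then f ⟨i, h⟩ else 0

theorem extend_of_lt (f : Fin n → ℕ) {i : ℕ} (h : i < n) : extend f i = f ⟨i, h⟩ := dif_pos h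

@[simp] theorem extend_val (f : Fin n → ℕ) (i : Fin n) : extend f i = f i := dif_pos i.2

@[simp] theorem extend_self (f : Fin n → ℕ) : extend f n = 0 := dif_neg (lt_irrefl n)

/-- The index `n` belongs to the dummy vertex, which must contribute nothing. -/
theorem sum_range_eq {F : ℕ → ℕ} {f : Fin n → ℕ} (h₀ : F n = 0) (h : ∀ i : Fin n, F i = f i) :
    ∑ k ∈ Finset.range (n + 1), F k = ∑ i, f i := by
  rw [Finset.sum_range_succ, h₀, Nat.add_zero, Finset.sum_range]
  exact Finset.sum_congr rfl fun i _ => h i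

theorem sum_range_ite_lt {m i : ℕ} (c : ℕ) (h : i ≤ m) :
    (∑ k ∈ Finset.range m, if k < i then c else 0) = i * c := by
  rw [← Finset.sum_filter, Finset.sum_const, smul_eq_mul]
  congr 1
  have : (Finset.range m).filter (· < i) = Finset.range i := by
    ext k
    simp only [Finset.mem_filter, Finset.mem_range]
    omega
  rw [this, Finset.card_range]

/-- `a` dominates `b`, for numbers of vertices. -/
def DomN (G : SimpleGraph (Fin n)) (a b : ℕ) : Prop :=
  ∃ (ha : a < n) (hb : b < n), Dom G ⟨a, ha⟩ ⟨b, hb⟩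

/-- `a` and `b` are far, for numbers of vertices. -/
def FarN (G : SimpleGraph (Fin n)) (a b : ℕ) : Prop := ∀ u, ¬ (DomN G a u ∧ DomN G b u)

/-- The function `g` describes the set `D`. -/
def Describes (g : ℕ → ℕ) (D : Finset (Fin n)) : Prop :=
  ∀ i < n + 1, g i ≠ 0 ↔ ∃ h : i < n, ⟨i, h⟩ ∈ D

variable {G : SimpleGraph (Fin n)}

@[simp] theorem domN_val (a b : Fin n) : DomN G a b ↔ Dom G a b :=
  ⟨fun ⟨_, _, h⟩ => h, fun h => ⟨a.2, b.2, h⟩⟩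

theorem not_domN_left (b : ℕ) : ¬ DomN G n b := fun ⟨h, _⟩ => lt_irrefl n h

theorem not_domN_right (a : ℕ) : ¬ DomN G a n := fun ⟨_, h, _⟩ => lt_irrefl n h

/-- The dummy vertex dominates nothing. Therefore it can pad a triple without violating pairwise
farness. -/
theorem farN_left (b : ℕ) : FarN G n b := fun u h => not_domN_left u h.1

theorem farN_right (a : ℕ) : FarN G a n := fun u h => not_domN_left u h.2

theorem farN_val (a b : Fin n) : FarN G a b ↔ Far G a b := by
  constructor
  · exact fun h u h₁ h₂ => h u ⟨(domN_val a u).2 h₁, (domN_val b u).2 h₂⟩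
  · rintro h u ⟨⟨_, hu, h₁⟩, ⟨_, _, h₂⟩⟩
    exact h ⟨u, hu⟩ h₁ h₂

/-- The array `g` describes the domination in `G`. -/
def AdjacencyArray (G : SimpleGraph (Fin n)) (g : ℕ → ℕ → ℕ) : Prop :=
  ∀ i < n + 1, ∀ j < n + 1, g i j ≠ 0 ↔ DomN G i j

theorem eq_or_exists_fin {i : ℕ} (hi : i < n + 1) : i = n ∨ ∃ a : Fin n, i = a :=
  (Nat.lt_succ_iff_lt_or_eq.1 hi).symm.imp id fun h => ⟨⟨i, h⟩, rfl⟩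

end Numbers

/-! ### Preparation -/

namespace Cmd

/-- The numbers `n²` and `i * n` are computed as sums, for want of a multiplication. The diagonal is
included, so the array describes domination. -/
def loadGraph : Cmd :=
  .seq (.set 2 (.sum 20 (.ite (.lt (.var 20) (.var 0)) (.var 0) (.const 0))))
    (fillArr 0 20 21 (.and (.and (.lt (.var 20) (.var 0)) (.lt (.var 21) (.var 0)))
      (.or (.eq (.var 20) (.var 21)) (.low (.add
        (.sum 22 (.ite (.lt (.var 22) (.var 20)) (.var 0) (.const 0))) (.var 21))))))

/-- The code of the weight of the vertex `20`. -/
def code : Expr := .low (.add (.var 2) (.var 20))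

/-- One more than the sum of all codes exceeds every finite weight of a vertex set. -/
def loadBound : Cmd :=
  .set 3 (.add (.const 1) (.sum 20 (.ite (.lt (.var 20) (.var 0)) code (.const 0))))

/-- The weights are the codes. -/
def loadWeights : Cmd :=
  .seq loadBound (fill 3 20 (.ite (.lt (.var 20) (.var 0)) code (.const 0)))

/-- The weights are given by the codes; the argument gets weight `0` and its neighbours become
unavailable. -/
def loadRootedWeights : Cmd :=
  .seq loadBound (fill 3 20 (.ite (.lt (.var 20) (.var 0))
    (.ite (.eq (.var 20) (.var 1)) (.const 0)
      (.ite (.or (.get 0 (.var 1) (.var 20)) code.not) (.var 3) (.sub code (.const 1))))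
    (.const 0)))

def loadDegrees : Cmd := fill 2 20 (.count 21 (.get 0 (.var 20) (.var 21)))

def loadFar : Cmd := fillArr 1 20 21
  (.all 22 (.not (.and (.get 0 (.var 20) (.var 22)) (.get 0 (.var 21) (.var 22)))))

/-- Triples must avoid the components that are cliques. -/
def excludeCliques : Cmd := fill 4 20
  (.all 21 (.or (.not (.get 0 (.var 20) (.var 21)))
    (.all 22 (.iff (.get 0 (.var 21) (.var 22)) (.get 0 (.var 20) (.var 22))))))

/-- All vertices are allowed in triples. -/
def excludeNone : Cmd := fill 4 20 (.eq (.var 20) (.var 0))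

/-- Array `4` also marks the dummy vertex; adding `1` to `n` compensates for this. -/
def loadTarget : Cmd :=
  .set 4 (.sub (.add (.var 0) (.const 1)) (.count 20 (.get 4 (.const 0) (.var 20))))

def prepare (weights exclude : Cmd) : Cmd :=
  .seq loadGraph (.seq weights (.seq loadDegrees (.seq loadFar (.seq exclude loadTarget))))

end Cmd

section Preparation

variable {n : ℕ} {G : SimpleGraph (Fin n)} {w : Fin n → ℕ} {X : Finset (Fin n)} {bound x : ℕ}
  {s : Store}

/-- The store after the graph has been loaded. -/
structure Loaded (G : SimpleGraph (Fin n)) (code : Fin n → ℕ) (x : ℕ) (s : Store) : Prop where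
  size : s.var 0 = n
  arg : s.var 1 = x
  square : s.var 2 = n * n
  code : ∀ i : Fin n, s.low (n * n + i) = code i
  adj : AdjacencyArray G (s.arr 0)
  mark : ∀ i, s.arr 5 0 i = 0

/-- The store after the preparation. -/
structure Ready (G : SimpleGraph (Fin n)) (w : Fin n → ℕ) (X : Finset (Fin n)) (bound x : ℕ)
    (s : Store) : Prop where
  size : s.var 0 = n
  arg : s.var 1 = x
  bound : s.var 3 = bound
  target : s.var 4 + X.card = n
  adj : AdjacencyArray G (s.arr 0)
  far : ∀ i < n + 1, ∀ j < n + 1, s.arr 1 i j ≠ 0 ↔ FarN G i j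
  deg : ∀ i < n + 1, s.arr 2 0 i = extend (domCard G) i
  weight : ∀ i < n + 1, s.arr 3 0 i = extend w i
  excluded : ∀ i < n + 1, s.arr 4 0 i ≠ 0 ↔ i = n ∨ ∃ h : i < n, ⟨i, h⟩ ∈ X

theorem inputMem_adj (G : SimpleGraph (Fin n)) (code : Fin n → ℕ) (i j : Fin n) :
    inputMem G code (i * n + j) ≠ 0 ↔ G.Adj i j := by
  have hlt := entry_lt i.2 j.2
  rw [inputMem]
  by_cases h : G.Adj i j
  · rw [if_pos ⟨i, j, rfl, h⟩]
    simp [h]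
  · rw [if_neg, dif_neg (by omega)]
    · simp [h]
    · rintro ⟨i', j', h₁, h₂⟩
      obtain ⟨h₃, h₄⟩ := entry_inj j.2 j'.2 h₁
      rw [Fin.ext h₃, Fin.ext h₄] at h
      exact h h₂

theorem inputMem_code (G : SimpleGraph (Fin n)) (code : Fin n → ℕ) (i : Fin n) :
    inputMem G code (n * n + i) = code i := by
  rw [inputMem, if_neg, dif_pos ⟨by omega, by omega⟩]
  · congr 1
    ext
    simp
  · rintro ⟨i', j', h, -⟩
    have := entry_lt i'.2 j'.2
    omega

theorem loadGraph_spec (G : SimpleGraph (Fin n)) (code : Fin n → ℕ) (x : ℕ) :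
    Loaded G code x (Cmd.loadGraph.eval (n + 1) (initialStore n x (inputMem G code))) := by
  rw [Cmd.loadGraph, Cmd.eval, Cmd.eval_fillArr rfl (by decide), Cmd.eval]
  have hsq : Expr.eval (n + 1) (.sum 20 (.ite (.lt (.var 20) (.var 0)) (.var 0) (.const 0)))
      (initialStore n x (inputMem G code)) = n * n := by
    rw [← sum_range_ite_lt n (Nat.le_succ n), Expr.eval_sum]
    refine Finset.sum_congr rfl fun k _ => ?_
    simp [initialStore]
  refine ⟨by simp [initialStore], by simp [initialStore], by simpa using hsq,
    inputMem_code G code, fun i hi j hj => ?_, fun i => by simp [initialStore]⟩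
  simp only [Store.setArr_arr, if_true, hi, hj, and_self, hsq]
  rw [← Expr.Holds]
  simp [initialStore, sum_range_ite_lt n hi.le]
  constructor
  · rintro ⟨⟨h₁, h₂⟩, h₃⟩
    refine ⟨h₁, h₂, ?_⟩
    rcases h₃ with rfl | h₃
    · exact .refl _
    · exact .inr ((inputMem_adj G code ⟨i, h₁⟩ ⟨j, h₂⟩).1 h₃.2)
  · rintro ⟨h₁, h₂, h₃⟩
    refine ⟨⟨h₁, h₂⟩, h₃.imp (congrArg Fin.val) fun h => ⟨?_, ?_⟩⟩
    · have := entry_lt h₁ h₂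
      rw [Nat.succ_mul, Nat.mul_succ]
      omega
    · exact (inputMem_adj G code ⟨i, h₁⟩ ⟨j, h₂⟩).2 h

theorem Loaded.eval_code {c : Fin n → ℕ} (hs : Loaded G c x s) (i : Fin n) (t : Store)
    (ht : t.low = s.low) (h₂ : t.var 2 = n * n) (hi : t.var 20 = i) :
    Cmd.code.eval (n + 1) t = c i := by
  have : n * n + i < (n + 1) * (n + 1) := by
    rw [Nat.succ_mul, Nat.mul_succ]
    omega
  simp only [Cmd.code, Expr.eval, h₂, hi, this, if_true, ht, hs.code]

theorem Loaded.eval_loadBound {c : Fin n → ℕ} (hs : Loaded G c x s) :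
    Cmd.loadBound.eval (n + 1) s = s.set 3 (1 + ∑ i, c i) := by
  rw [Cmd.loadBound, Cmd.eval, Expr.eval_add, Expr.eval_sum, sum_range_eq (f := c)]
  · simp
  · simp [hs.size]
  · intro i
    simp only [Expr.eval_ite, Expr.holds_lt, Expr.eval_var, Store.set_var, hs.size, if_true,
      if_false, OfNat.zero_ne_ofNat, i.2]
    exact hs.eval_code i _ rfl (by simp [hs.square]) (by simp)

theorem holds_adj (G : SimpleGraph (Fin n)) (a b : Expr) (s : Store)
    (h : AdjacencyArray G (s.arr 0)) :
    (Expr.get 0 a b).Holds (n + 1) s ↔ DomN G (a.eval (n + 1) s) (b.eval (n + 1) s) := by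
  rw [Expr.holds_get]
  constructor
  · exact fun h' => (h _ h'.1.1 _ h'.1.2).1 h'.2
  · intro h'
    obtain ⟨h₁, h₂, -⟩ := id h'
    exact ⟨⟨by omega, by omega⟩, (h _ (by omega) _ (by omega)).2 h'⟩

/-- A command that loads the weights `w` and a bound on the finite weights. -/
def LoadsWeights (p : Cmd) (w : Fin n → ℕ) (bound : ℕ) (s : Store) : Prop :=
  ∃ f, p.eval (n + 1) s = (s.set 3 bound).setArr 3 f ∧ ∀ i < n + 1, f 0 i = extend w i

/-- A command that excludes the vertices in `X` from triples. -/
def Excludes (p : Cmd) (G : SimpleGraph (Fin n)) (X : Finset (Fin n)) : Prop :=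
  ∀ s : Store, s.var 0 = n → (AdjacencyArray G (s.arr 0)) →
    ∃ f, p.eval (n + 1) s = s.setArr 4 f ∧
      ∀ i < n + 1, f 0 i ≠ 0 ↔ i = n ∨ ∃ h : i < n, ⟨i, h⟩ ∈ X

theorem Loaded.loadWeights {c : Fin n → ℕ} (hs : Loaded G c x s) :
    LoadsWeights Cmd.loadWeights c (1 + ∑ i, c i) s := by
  refine ⟨_, by rw [Cmd.loadWeights, Cmd.eval, hs.eval_loadBound,
    Cmd.eval_fill rfl (by omega)], fun i hi => ?_⟩
  rw [Function.update_self, if_pos hi]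
  rcases eq_or_exists_fin hi with rfl | ⟨i, rfl⟩
  · simp [hs.size]
  · simp only [Expr.eval_ite, Expr.holds_lt, Expr.eval_var, Store.set_var, hs.size, if_true,
      if_false, OfNat.zero_ne_ofNat, i.2, extend_val]
    exact hs.eval_code i _ rfl (by simp [hs.square]) (by simp)

/-- The weights for the sets that contain the vertex `v`. -/
noncomputable def rootedWeight (G : SimpleGraph (Fin n)) (c : Fin n → ℕ) (v : Fin n)
    (bound : ℕ) (i : Fin n) : ℕ :=
  if i = v then 0 else if Dom G v i ∨ c i = 0 then bound else c i - 1

theorem Loaded.loadRootedWeights {c : Fin n → ℕ} {v : Fin n} (hs : Loaded G c v s) :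
    LoadsWeights Cmd.loadRootedWeights (rootedWeight G c v (1 + ∑ i, c i)) (1 + ∑ i, c i) s := by
  refine ⟨_, by rw [Cmd.loadRootedWeights, Cmd.eval, hs.eval_loadBound,
    Cmd.eval_fill rfl (by omega)], fun i hi => ?_⟩
  rw [Function.update_self, if_pos hi]
  rcases eq_or_exists_fin hi with rfl | ⟨i, rfl⟩
  · simp [hs.size]
  · have hcode := hs.eval_code i (((s.set 3 (1 + ∑ i, c i))).set 20 i) rfl (by simp [hs.square])
      (by simp)
    have hcode' : Cmd.code.Holds (n + 1) ((s.set 3 (1 + ∑ i, c i)).set 20 i) ↔ c i ≠ 0 := by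
      rw [Expr.Holds, hcode]
    have hadj : s.arr 0 v i ≠ 0 ↔ Dom G v i := by
      rw [hs.adj _ (by omega) _ (by omega), domN_val]
    simp [hs.size, rootedWeight, hcode, hcode', hs.arg, ← hadj, Fin.val_inj]

theorem excludes_none : Excludes Cmd.excludeNone G ∅ := by
  intro s h₀ hadj
  refine ⟨_, by rw [Cmd.excludeNone, Cmd.eval_fill rfl (by omega)], fun i hi => ?_⟩
  rw [Function.update_self, if_pos hi, ← Expr.Holds]
  simp [h₀]

theorem excludes_cliques : Excludes Cmd.excludeCliques G
    (Finset.univ.filter fun u => InCliqueComponent G u) := by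
  intro s h₀ hadj
  refine ⟨_, by rw [Cmd.excludeCliques, Cmd.eval_fill rfl (by omega)], fun i hi => ?_⟩
  rw [Function.update_self, if_pos hi, ← Expr.Holds]
  simp [holds_adj G, hadj, -Expr.holds_get, -Order.lt_add_one_iff]
  rcases eq_or_exists_fin hi with rfl | ⟨i, rfl⟩
  · simp [not_domN_left]
  · simp only [i.2.ne, false_or, i.2, exists_true_left, Fin.eta]
    constructor
    · intro h a ha b
      have h₁ := (h a (by omega)).resolve_left (not_not.2 ((domN_val i a).2 ha)) b (by omega)
      rwa [domN_val, domN_val] at h₁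
    · intro h a ha
      refine or_iff_not_imp_left.2 fun hia b hb => ?_
      obtain ⟨_, ha, hia⟩ := not_not.1 hia
      rcases eq_or_exists_fin hb with rfl | ⟨b, rfl⟩
      · simp [not_domN_right]
      · rw [domN_val, ← h ⟨a, ha⟩ hia b, ← domN_val]

/-- That array `5` is still zero matters when `select` runs without `markFar`: then nothing is added
to the triple. -/
theorem Loaded.prepare {c : Fin n → ℕ} (hs : Loaded G c x s) {p q : Cmd}
    (hp : LoadsWeights p w bound s) (hq : Excludes q G X) {t : Store}
    (ht : (Cmd.seq p (.seq Cmd.loadDegrees (.seq Cmd.loadFar (.seq q Cmd.loadTarget)))).eval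
      (n + 1) s = t) :
    Ready G w X bound x t ∧ ∀ i, t.arr 5 0 i = 0 := by
  obtain ⟨f, hf, hw⟩ := hp
  rw [Cmd.eval, Cmd.eval, Cmd.eval, Cmd.eval, hf, Cmd.loadDegrees,
    Cmd.eval_fill rfl (by omega), Cmd.loadFar, Cmd.eval_fillArr rfl (by decide)] at ht
  generalize hs₁ : Store.setArr _ 1 _ = s₁ at ht
  obtain ⟨g, hg, hX⟩ := hq s₁ (by simp [← hs₁, hs.size]) (by simpa [← hs₁] using hs.adj)
  rw [hg, Cmd.loadTarget, Cmd.eval] at ht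
  subst ht hs₁
  have hadj := hs.adj
  refine ⟨⟨?_, ?_, ?_, ?_, ?_, ?_, ?_, ?_, ?_⟩, ?_⟩
  · simp [hs.size]
  · simp [hs.arg]
  · simp
  · have hcount : (∑ k ∈ Finset.range (n + 1), if g 0 k ≠ 0 then 1 else 0) = X.card + 1 := by
      rw [Finset.sum_range_succ, if_pos ((hX n (by omega)).2 (.inl rfl)), Finset.sum_range,
        Finset.sum_boole, Nat.cast_id]
      congr 2
      ext i
      rw [Finset.mem_filter, hX i (by omega)]
      simp [i.2.ne]
    have hle : X.card ≤ n := by simpa using Finset.card_le_univ X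
    have hcnt : ∀ t : Store, t.arr 4 = g →
        (Expr.count 20 (.get 4 (.const 0) (.var 20))).eval (n + 1) t = X.card + 1 := by
      intro t ht
      rw [← hcount, Expr.eval_count]
      refine Finset.sum_congr rfl fun k hk => ?_
      simp [Finset.mem_range.1 hk, -Order.lt_add_one_iff, ht]
    rw [Store.set_var, if_pos rfl, Expr.eval_sub, hcnt _ (by simp)]
    simp [hs.size]
    omega
  · simpa using hs.adj
  · intro i hi j hj
    simp only [Store.set_arr, Store.setArr_arr]
    rw [if_neg (by decide)]
    simp only [if_true, hi, hj, and_self]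
    rw [← Expr.Holds]
    simp [holds_adj G, hadj, -Expr.holds_get, -Order.lt_add_one_iff]
    constructor
    · rintro h u ⟨h₁, h₂⟩
      obtain ⟨_, hu, _⟩ := id h₁
      exact h u (by omega) h₁ h₂
    · exact fun h u _ h₁ h₂ => h u ⟨h₁, h₂⟩
  · intro i hi
    simp [hi, holds_adj G, hadj, -Expr.holds_get, -Order.lt_add_one_iff, -Finset.sum_boole]
    rcases eq_or_exists_fin hi with rfl | ⟨i, rfl⟩
    · simp [not_domN_left]
    · rw [sum_range_eq (f := fun u => if Dom G i u then 1 else 0), extend_val, domCard,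
        Finset.sum_boole, Nat.cast_id]
      · exact if_neg (not_domN_right _)
      · intro u
        simp
  · intro i hi
    simp [hw i hi]
  · intro i hi
    simpa using hX i hi
  · simp [hs.mark]

end Preparation


/-! ### Triples -/

section Triples

variable {n : ℕ} {G : SimpleGraph (Fin n)} {w : Fin n → ℕ} {X T : Finset (Fin n)} {x y z : ℕ}

/-- The set of the vertices with the numbers `x`, `y`, `z`. -/
noncomputable def triple (n x y z : ℕ) : Finset (Fin n) :=
  Finset.univ.filter fun i : Fin n => (i : ℕ) = x ∨ (i : ℕ) = y ∨ (i : ℕ) = z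

@[simp] theorem mem_triple {i : Fin n} :
    i ∈ triple n x y z ↔ (i : ℕ) = x ∨ (i : ℕ) = y ∨ (i : ℕ) = z := by
  simp [triple]

/-- The vertices in `T` are pairwise far, not in `X`, and dominate all vertices that are not
in `X`. -/
structure IsCover (G : SimpleGraph (Fin n)) (X T : Finset (Fin n)) : Prop where
  far : ∀ t ∈ T, ∀ t' ∈ T, t ≠ t' → Far G t t'
  notMem : ∀ t ∈ T, t ∉ X
  sum : ∑ t ∈ T, domCard G t + X.card = n

/-- The condition that is tested for a triple. -/
structure TripleTest (G : SimpleGraph (Fin n)) (X : Finset (Fin n)) (x y z : ℕ) : Prop where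
  far_xy : FarN G x y
  far_xz : FarN G x z
  far_yz : FarN G y z
  notMem : ∀ i : Fin n, ((i : ℕ) = x ∨ (i : ℕ) = y ∨ (i : ℕ) = z) → i ∉ X
  sum : extend (domCard G) x + extend (domCard G) y + extend (domCard G) z + X.card = n

/-- A vertex is never far from itself, so only the dummy can be repeated in a triple of pairwise far
entries. -/
theorem FarN.ne {i : Fin n} (h : FarN G x y) (hx : (i : ℕ) = x) : (i : ℕ) ≠ y := by
  rintro rfl
  rw [← hx, farN_val] at h
  exact not_far_self _ h

theorem sum_ite_val_eq (f : Fin n → ℕ) (x : ℕ) :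
    (∑ i : Fin n, if (i : ℕ) = x then f i else 0) = extend f x := by
  by_cases h : x < n
  · rw [Finset.sum_eq_single ⟨x, h⟩]
    · simp [extend_of_lt f h]
    · intro i _ hi
      exact if_neg fun h' => hi (Fin.ext h')
    · simp
  · rw [extend, dif_neg h]
    exact Finset.sum_eq_zero fun i _ => if_neg (by omega)

theorem sum_triple (h₁ : FarN G x y) (h₂ : FarN G x z) (h₃ : FarN G y z) (f : Fin n → ℕ) :
    ∑ t ∈ triple n x y z, f t = extend f x + extend f y + extend f z := by
  rw [triple, Finset.sum_filter, ← sum_ite_val_eq, ← sum_ite_val_eq, ← sum_ite_val_eq,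
    ← Finset.sum_add_distrib, ← Finset.sum_add_distrib]
  refine Finset.sum_congr rfl fun i _ => ?_
  have h₁ : (i : ℕ) = x → (i : ℕ) ≠ y := h₁.ne
  have h₂ : (i : ℕ) = x → (i : ℕ) ≠ z := h₂.ne
  have h₃ : (i : ℕ) = y → (i : ℕ) ≠ z := h₃.ne
  by_cases hx : (i : ℕ) = x
  · rw [if_pos (.inl hx), if_pos hx, if_neg (h₁ hx), if_neg (h₂ hx), Nat.add_zero]
  · by_cases hy : (i : ℕ) = y
    · rw [if_pos (.inr (.inl hy)), if_neg hx, if_pos hy, if_neg (h₃ hy), Nat.add_zero, Nat.zero_add]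
    · simp only [hx, hy, false_or, if_false, Nat.zero_add]

theorem TripleTest.isCover (h : TripleTest G X x y z) : IsCover G X (triple n x y z) := by
  refine ⟨?_, fun t ht => h.notMem t (mem_triple.1 ht), ?_⟩
  · intro t ht t' ht' hne
    have hne : (t : ℕ) ≠ t' := fun h => hne (Fin.ext h)
    rw [← farN_val]
    obtain ⟨h₁, h₂, h₃, -, -⟩ := h
    have symm : ∀ {a b}, FarN G a b → FarN G b a := fun h u hu => h u hu.symm
    rcases mem_triple.1 ht with e | e | e <;> rcases mem_triple.1 ht' with e' | e' | e' <;>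
      rw [e, e'] at hne ⊢ <;>
      first | exact absurd rfl hne | assumption | exact symm (by assumption)
  · rw [sum_triple h.far_xy h.far_xz h.far_yz, h.sum]

/-- Smaller sets are padded with the dummy `n`. -/
theorem exists_triple_eq (hT : T.card ≤ 3)
    (hfar : ∀ t ∈ T, ∀ t' ∈ T, t ≠ t' → Far G t t') :
    ∃ x < n + 1, ∃ y < n + 1, ∃ z < n + 1, triple n x y z = T ∧ FarN G x y ∧ FarN G x z ∧
      FarN G y z := by
  have hn : ∀ i : Fin n, (i : ℕ) < n + 1 := fun i => by omega
  have hne : ∀ i : Fin n, (i : ℕ) ≠ n := fun i => i.2.ne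
  obtain h | h | h | h : T.card = 0 ∨ T.card = 1 ∨ T.card = 2 ∨ T.card = 3 := by omega
  · rw [Finset.card_eq_zero] at h
    subst h
    exact ⟨n, by omega, n, by omega, n, by omega, by ext i; simp [hne], farN_left _, farN_left _,
      farN_left _⟩
  · obtain ⟨a, rfl⟩ := Finset.card_eq_one.1 h
    exact ⟨a, hn a, n, by omega, n, by omega, by ext i; simp [hne, Fin.ext_iff], farN_right _,
      farN_right _, farN_left _⟩
  · obtain ⟨a, b, hab, rfl⟩ := Finset.card_eq_two.1 h
    exact ⟨a, hn a, b, hn b, n, by omega, by ext i; simp [hne, Fin.ext_iff],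
      (farN_val _ _).2 (hfar _ (by simp) _ (by simp) hab), farN_right _, farN_right _⟩
  · obtain ⟨a, b, c, hab, hac, hbc, rfl⟩ := Finset.card_eq_three.1 h
    exact ⟨a, hn a, b, hn b, c, hn c, by ext i; simp [Fin.ext_iff],
      (farN_val _ _).2 (hfar _ (by simp) _ (by simp) hab),
      (farN_val _ _).2 (hfar _ (by simp) _ (by simp) hac),
      (farN_val _ _).2 (hfar _ (by simp) _ (by simp) hbc)⟩

theorem IsCover.exists_triple (h : IsCover G X T) (hT : T.card ≤ 3) :
    ∃ x < n + 1, ∃ y < n + 1, ∃ z < n + 1, triple n x y z = T ∧ TripleTest G X x y z := by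
  obtain ⟨x, hx, y, hy, z, hz, rfl, h₁, h₂, h₃⟩ := exists_triple_eq hT h.far
  exact ⟨x, hx, y, hy, z, hz, rfl, h₁, h₂, h₃, fun i hi => h.notMem i (mem_triple.2 hi),
    by rw [← sum_triple h₁ h₂ h₃, h.sum]⟩

end Triples

namespace Cmd

/-- The entry of the vertex `i` in the row `k`. -/
def row (k i : ℕ) : Expr := .get k (.const 0) (.var i)

/-- The sum of the entries of the vertices `20`, `21`, `22` in the row `k`. -/
def tripleSum (k : ℕ) : Expr := .add (.add (row k 20) (row k 21)) (row k 22)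

/-- Farness and degrees are tabulated, and coverage is checked by counting, so there is no inner
loop and all triples can be tried in cubic time. The dummy is marked in row `4` but remains
admissible. -/
def tripleTest : Expr :=
  .and (.and (.and (.get 1 (.var 20) (.var 21)) (.get 1 (.var 20) (.var 22)))
    (.get 1 (.var 21) (.var 22)))
    (.and (.and (.and (.or (.eq (.var 20) (.var 0)) (row 4 20).not)
      (.or (.eq (.var 21) (.var 0)) (row 4 21).not)) (.or (.eq (.var 22) (.var 0)) (row 4 22).not))
      (.and (.eq (tripleSum 2) (.var 4)) (.lt (tripleSum 3) (.var 5))))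

def tryTriple : Cmd := .ite tripleTest
  (.seq (.set 5 (tripleSum 3)) (.seq (.set 6 (.var 20)) (.seq (.set 7 (.var 21))
    (.set 8 (.var 22))))) skip

def bestTriple : Cmd :=
  .seq (.set 5 (.var 3)) (.seq (.set 6 (.var 0)) (.seq (.set 7 (.var 0)) (.seq (.set 8 (.var 0))
    (.loop 20 (.loop 21 (.loop 22 tryTriple))))))

end Cmd

/-! ### Correctness of the search for the best triple -/

section BestTriple

variable {n : ℕ} {G : SimpleGraph (Fin n)} {w : Fin n → ℕ} {X T : Finset (Fin n)}
  {bound v : ℕ} {s : Store} {m : ℕ}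

theorem Ready.congr (h : Ready G w X bound v s) {t : Store} (hv : ∀ i < 5, t.var i = s.var i)
    (ha : ∀ i < 5, t.arr i = s.arr i) : Ready G w X bound v t := by
  obtain ⟨h₀, h₁, h₂, h₃, h₄, h₅, h₆, h₇, h₈⟩ := h
  rw [← hv _ (by omega)] at h₀ h₁ h₂ h₃
  rw [← ha _ (by omega)] at h₄
  simp only [← ha _ (show 1 < 5 by omega)] at h₅
  simp only [← ha _ (show 2 < 5 by omega)] at h₆
  simp only [← ha _ (show 3 < 5 by omega)] at h₇
  simp only [← ha _ (show 4 < 5 by omega)] at h₈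
  exact ⟨h₀, h₁, h₂, h₃, h₄, h₅, h₆, h₇, h₈⟩

theorem Ready.set (h : Ready G w X bound v s) {r : ℕ} (hr : 5 ≤ r) (a : ℕ) :
    Ready G w X bound v (s.set r a) :=
  h.congr (fun i hi => by rw [Store.set_var, if_neg (by omega)]) fun _ _ => rfl

theorem Ready.setArr (h : Ready G w X bound v s) {k : ℕ} (hk : 5 ≤ k) (f : ℕ → ℕ → ℕ) :
    Ready G w X bound v (s.setArr k f) :=
  h.congr (fun _ _ => rfl) fun i hi => by rw [Store.setArr_arr, if_neg (by omega)]

@[simp] theorem Cmd.eval_row {k i : ℕ} : (Cmd.row k i).eval m s =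
    if 0 < m ∧ s.var i < m then s.arr k 0 (s.var i) else 0 := rfl

@[simp] theorem Cmd.holds_row {k i : ℕ} : (Cmd.row k i).Holds m s ↔
    (0 < m ∧ s.var i < m) ∧ s.arr k 0 (s.var i) ≠ 0 := by
  rw [Cmd.row, Expr.holds_get]
  rfl

theorem Ready.eval_weightSum (h : Ready G w X bound v s) {x y z : ℕ} (hx : x < n + 1)
    (hy : y < n + 1) (hz : z < n + 1) (vx : s.var 20 = x) (vy : s.var 21 = y) (vz : s.var 22 = z) :
    (Cmd.tripleSum 3).eval (n + 1) s = extend w x + extend w y + extend w z := by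
  simp only [Cmd.tripleSum, Expr.eval_add, Cmd.eval_row, vx, vy, vz, hx, hy, hz, Nat.succ_pos,
    and_self, if_true, h.weight]

theorem Ready.allowed_iff (h : Ready G w X bound v s) {x : ℕ} (hx : x < n + 1) :
    x = n ∨ ¬ s.arr 4 0 x ≠ 0 ↔ ∀ i : Fin n, (i : ℕ) = x → i ∉ X := by
  rw [h.excluded x hx]
  rcases eq_or_exists_fin hx with rfl | ⟨a, rfl⟩
  · simp only [true_or, true_iff]
    exact fun i hi => absurd hi i.2.ne
  · simp [a.2.ne, Fin.val_inj]

theorem Ready.holds_tripleTest (h : Ready G w X bound v s) {x y z : ℕ} (hx : x < n + 1)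
    (hy : y < n + 1) (hz : z < n + 1) (vx : s.var 20 = x) (vy : s.var 21 = y) (vz : s.var 22 = z) :
    Cmd.tripleTest.Holds (n + 1) s ↔
      TripleTest G X x y z ∧ extend w x + extend w y + extend w z < s.var 5 := by
  rw [Cmd.tripleTest]
  simp only [Expr.holds_and, Expr.holds_or, Expr.holds_eq, Expr.holds_not, Expr.holds_lt,
    Expr.holds_get, h.eval_weightSum hx hy hz vx vy vz]
  simp only [Cmd.tripleSum, Expr.eval_add, Cmd.eval_row, Cmd.holds_row, Expr.eval_var, vx, vy, vz,
    hx, hy, hz, Nat.succ_pos, and_self, if_true, h.deg, true_and, h.far x hx y hy,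
    h.far x hx z hz, h.far y hy z hz, h.size, h.allowed_iff hx, h.allowed_iff hy, h.allowed_iff hz]
  have hsum : ∀ a, a = s.var 4 ↔ a + X.card = n := fun a => by
    have := h.target
    omega
  rw [hsum]
  constructor
  · rintro ⟨⟨⟨h₁, h₂⟩, h₃⟩, ⟨⟨h₄, h₅⟩, h₆⟩, h₇, h₈⟩
    exact ⟨⟨h₁, h₂, h₃, fun i hi => hi.elim (h₄ i) fun hi => hi.elim (h₅ i) (h₆ i), h₇⟩, h₈⟩
  · rintro ⟨⟨h₁, h₂, h₃, h₄, h₅⟩, h₆⟩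
    exact ⟨⟨⟨h₁, h₂⟩, h₃⟩, ⟨⟨fun i hi => h₄ i (.inl hi), fun i hi => h₄ i (.inr (.inl hi))⟩,
      fun i hi => h₄ i (.inr (.inr hi))⟩, h₅, h₆⟩

/-- The variables `5`–`8` hold a triple that passes the test, and its weight. -/
structure TripleState (G : SimpleGraph (Fin n)) (w : Fin n → ℕ) (X : Finset (Fin n))
    (bound v : ℕ) (f : ℕ → ℕ → ℕ) (b : ℕ) (s : Store) : Prop where
  ready : Ready G w X bound v s
  arr : s.arr 5 = f
  le : s.var 5 ≤ b
  lt_x : s.var 6 < n + 1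
  lt_y : s.var 7 < n + 1
  lt_z : s.var 8 < n + 1
  test : s.var 5 = bound ∨ (TripleTest G X (s.var 6) (s.var 7) (s.var 8) ∧
    s.var 5 = extend w (s.var 6) + extend w (s.var 7) + extend w (s.var 8))

theorem TripleState.set {f : ℕ → ℕ → ℕ} {b : ℕ} (h : TripleState G w X bound v f b s) {r : ℕ}
    (hr : 9 ≤ r) (a : ℕ) : TripleState G w X bound v f b (s.set r a) := by
  obtain ⟨h₀, h₁, h₂, h₃, h₄, h₅, h₆⟩ := h
  have : ∀ i < 9, (s.set r a).var i = s.var i := fun i hi => by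
    rw [Store.set_var, if_neg (by omega)]
  rw [← this _ (by omega)] at h₂ h₃ h₄ h₅
  simp only [← this _ (show 5 < 9 by omega), ← this _ (show 6 < 9 by omega),
    ← this _ (show 7 < 9 by omega), ← this _ (show 8 < 9 by omega)] at h₆
  exact ⟨h₀.set (by omega) a, h₁, h₂, h₃, h₄, h₅, h₆⟩

theorem TripleState.mono {f : ℕ → ℕ → ℕ} {b b' : ℕ} (h : TripleState G w X bound v f b s)
    (hb : s.var 5 ≤ b') : TripleState G w X bound v f b' s :=
  { h with le := hb }

/-- The weight in the variable `5` is at most the weight of the triple. -/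
def TripleBound (G : SimpleGraph (Fin n)) (w : Fin n → ℕ) (X : Finset (Fin n)) (x y z b : ℕ) :
    Prop :=
  TripleTest G X x y z → b ≤ extend w x + extend w y + extend w z

theorem TripleBound.mono {x y z b b' : ℕ} (h : TripleBound G w X x y z b) (hb : b' ≤ b) :
    TripleBound G w X x y z b' :=
  fun ht => hb.trans (h ht)

theorem TripleState.tryTriple {f : ℕ → ℕ → ℕ} {b : ℕ} (h : TripleState G w X bound v f b s)
    {x y z : ℕ} (hx : x < n + 1) (hy : y < n + 1) (hz : z < n + 1) (vx : s.var 20 = x)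
    (vy : s.var 21 = y) (vz : s.var 22 = z) :
    TripleState G w X bound v f (s.var 5) (Cmd.tryTriple.eval (n + 1) s) ∧
      (∀ r, 9 ≤ r → (Cmd.tryTriple.eval (n + 1) s).var r = s.var r) ∧
      TripleBound G w X x y z ((Cmd.tryTriple.eval (n + 1) s).var 5) := by
  rw [Cmd.tryTriple, Cmd.eval_ite, h.ready.holds_tripleTest hx hy hz vx vy vz]
  split_ifs with hc
  · simp only [Cmd.eval, h.ready.eval_weightSum hx hy hz vx vy vz, Expr.eval_var]
    refine ⟨⟨(((h.ready.set ?_ _).set ?_ _).set ?_ _).set ?_ _, ?_, ?_, ?_, ?_, ?_, ?_⟩, ?_, ?_⟩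
    · omega
    · omega
    · omega
    · omega
    · simp [h.arr]
    · simpa using hc.2.le
    · simpa [vx] using hx
    · simpa [vy] using hy
    · simpa [vz] using hz
    · right
      simpa [vx, vy, vz] using hc.1
    · intro r hr
      simp [show r ≠ 5 by omega, show r ≠ 6 by omega, show r ≠ 7 by omega, show r ≠ 8 by omega]
    · intro _
      simp
  · rw [Cmd.eval_skip]
    exact ⟨h.mono le_rfl, fun _ _ => rfl, fun ht => not_lt.1 fun hlt => hc ⟨ht, hlt⟩⟩

/-- Variable `5` never increases, so the bounds achieved by earlier triples persist. The two outer
loops follow the same pattern. -/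
theorem TripleState.loop_z {f : ℕ → ℕ → ℕ} {b : ℕ} (h : TripleState G w X bound v f b s)
    {x y : ℕ} (hx : x < n + 1) (hy : y < n + 1) (vx : s.var 20 = x) (vy : s.var 21 = y) :
    let t := (Cmd.loop 22 Cmd.tryTriple).eval (n + 1) s
    (TripleState G w X bound v f (s.var 5) t ∧ t.var 20 = x ∧ t.var 21 = y) ∧
      ∀ z < n + 1, TripleBound G w X x y z (t.var 5) := by
  refine Cmd.loop_spec (fun t => TripleState G w X bound v f (s.var 5) t ∧ t.var 20 = x ∧
    t.var 21 = y) (fun z t => TripleBound G w X x y z (t.var 5)) ⟨h.mono le_rfl, vx, vy⟩ ?_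
  rintro z hz t ⟨ht, tx, ty⟩
  obtain ⟨h₁, h₂, h₃⟩ := (ht.set (r := 22) (by omega) z).tryTriple hx hy hz (by simpa using tx)
    (by simpa using ty) (by simp)
  refine ⟨⟨(h₁.mono (h₁.le.trans ?_)).set (by omega) _, ?_, ?_⟩, ?_, fun l hl => hl.mono ?_⟩
  · simpa using ht.le
  · simpa [h₂] using tx
  · simpa [h₂] using ty
  · simpa using h₃
  · simpa using h₁.le

theorem TripleState.loop_y {f : ℕ → ℕ → ℕ} {b : ℕ} (h : TripleState G w X bound v f b s)
    {x : ℕ} (hx : x < n + 1) (vx : s.var 20 = x) :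
    let t := (Cmd.loop 21 (.loop 22 Cmd.tryTriple)).eval (n + 1) s
    (TripleState G w X bound v f (s.var 5) t ∧ t.var 20 = x) ∧
      ∀ y < n + 1, ∀ z < n + 1, TripleBound G w X x y z (t.var 5) := by
  refine Cmd.loop_spec (fun t => TripleState G w X bound v f (s.var 5) t ∧ t.var 20 = x)
    (fun y t => ∀ z < n + 1, TripleBound G w X x y z (t.var 5)) ⟨h.mono le_rfl, vx⟩ ?_
  rintro y hy t ⟨ht, tx⟩
  obtain ⟨⟨h₁, h₂, -⟩, h₃⟩ := (ht.set (r := 21) (by omega) y).loop_z hx hy (by simpa using tx)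
    (by simp)
  refine ⟨⟨(h₁.mono (h₁.le.trans ?_)).set (by omega) _, ?_⟩, fun z hz => ?_,
    fun l hl z hz => (hl z hz).mono ?_⟩
  · simpa using ht.le
  · simpa using h₂
  · simpa using h₃ z hz
  · simpa using h₁.le

theorem TripleState.loop_x {f : ℕ → ℕ → ℕ} {b : ℕ} (h : TripleState G w X bound v f b s) :
    let t := (Cmd.loop 20 (.loop 21 (.loop 22 Cmd.tryTriple))).eval (n + 1) s
    TripleState G w X bound v f (s.var 5) t ∧
      ∀ x < n + 1, ∀ y < n + 1, ∀ z < n + 1, TripleBound G w X x y z (t.var 5) := by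
  refine Cmd.loop_spec (fun t => TripleState G w X bound v f (s.var 5) t)
    (fun x t => ∀ y < n + 1, ∀ z < n + 1, TripleBound G w X x y z (t.var 5)) (h.mono le_rfl) ?_
  intro x hx t ht
  obtain ⟨⟨h₁, -⟩, h₃⟩ := (ht.set (r := 20) (by omega) x).loop_y hx (by simp)
  refine ⟨(h₁.mono (h₁.le.trans ?_)).set (by omega) _, fun y hy z hz => ?_,
    fun l hl y hy z hz => (hl y hy z hz).mono ?_⟩
  · simpa using ht.le
  · simpa using h₃ y hy z hz
  · simpa using h₁.le

/-- The variables `6`–`8` hold a lightest cover with at most three vertices. -/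
structure HasBestTriple (G : SimpleGraph (Fin n)) (w : Fin n → ℕ) (X : Finset (Fin n)) (bound : ℕ)
    (s : Store) : Prop where
  lt_x : s.var 6 < n + 1
  lt_y : s.var 7 < n + 1
  lt_z : s.var 8 < n + 1
  best : ∀ T, IsCover G X T → T.card ≤ 3 → ∑ t ∈ T, w t < bound →
    IsCover G X (triple n (s.var 6) (s.var 7) (s.var 8)) ∧
      ∑ t ∈ triple n (s.var 6) (s.var 7) (s.var 8), w t ≤ ∑ t ∈ T, w t

theorem Ready.bestTriple (h : Ready G w X bound v s) :
    let t := Cmd.bestTriple.eval (n + 1) s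
    Ready G w X bound v t ∧ t.arr 5 = s.arr 5 ∧ HasBestTriple G w X bound t := by
  suffices key : ∀ s₁, TripleState G w X bound v (s.arr 5) bound s₁ →
      let t := (Cmd.loop 20 (.loop 21 (.loop 22 Cmd.tryTriple))).eval (n + 1) s₁
      Ready G w X bound v t ∧ t.arr 5 = s.arr 5 ∧ HasBestTriple G w X bound t by
    refine key ((((s.set 5 (s.var 3)).set 6 (s.var 0)).set 7 (s.var 0)).set 8 (s.var 0))
      ⟨(((h.set ?_ _).set ?_ _).set ?_ _).set ?_ _, ?_, ?_, ?_, ?_, ?_, ?_⟩ <;>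
      simp [h.size, h.bound]
  intro s₁ h₁
  obtain ⟨h₂, h₃⟩ := h₁.loop_x
  refine ⟨h₂.ready, h₂.arr, h₂.lt_x, h₂.lt_y, h₂.lt_z, ?_⟩
  intro T hT hcard hlt
  obtain ⟨x, hx, y, hy, z, hz, rfl, hxyz⟩ := hT.exists_triple hcard
  have hle := h₃ x hx y hy z hz hxyz
  rw [← sum_triple hxyz.far_xy hxyz.far_xz hxyz.far_yz] at hle
  rcases h₂.test with h₄ | ⟨h₄, h₅⟩
  -- Variable `5` still holds the bound, although `T` is lighter: a contradiction.
  · omega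
  · refine ⟨h₄.isCover, ?_⟩
    rw [sum_triple h₄.far_xy h₄.far_xz h₄.far_yz, ← h₅]
    exact hle

end BestTriple


/-! ### Selection and test of a set -/

namespace Cmd

/-- Marks the vertices that are far from the present triple. -/
def markFar : Cmd := fill 5 20 (.and (.lt (.var 20) (.var 0))
  (.and (.get 1 (.var 10) (.var 20)) (.and (.get 1 (.var 11) (.var 20))
    (.get 1 (.var 12) (.var 20)))))

/-- Whether the vertex `21` is preferred to the vertex `20`. -/
def beats : Expr :=
  .or (.lt (row 2 20) (row 2 21)) (.and (.eq (row 2 20) (row 2 21))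
    (.or (.lt (row 3 21) (row 3 20)) (.and (.eq (row 3 21) (row 3 20))
      (.lt (.var 21) (.var 20)))))

def select : Cmd := fill 6 20 (.and (.lt (.var 20) (.var 0))
  (.or (.or (.eq (.var 20) (.var 10)) (.or (.eq (.var 20) (.var 11)) (.eq (.var 20) (.var 12))))
    (.and (row 5 20) (.all 21 (.not
      (.and (.get 0 (.var 20) (.var 21)) (.and (row 5 21) beats)))))))

def isED : Expr := .all 20 (.or (.not (.lt (.var 20) (.var 0)))
  (.eq (.count 21 (.and (row 6 21) (.get 0 (.var 21) (.var 20)))) (.const 1)))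

/-- Keeps the selected set if it is an efficient dominating set that is lighter than the best
one. -/
def test : Cmd := .seq (.set 13 (.sum 20 (.ite (row 6 20) (row 3 20) (.const 0))))
  (.ite (.and isED (.lt (.var 13) (.var 9))) (.seq (.set 9 (.var 13)) (fill 7 20 (row 6 20))) skip)

/-- Makes the best triple the present triple. -/
def useTriple : Cmd := .seq (.set 10 (.var 6)) (.seq (.set 11 (.var 7)) (.set 12 (.var 8)))

def choose : Cmd := .ite (.lt (.var 23) (.var 0))
  (.seq (.set 10 (.var 23)) (.seq (.set 11 (.var 0)) (.set 12 (.var 0)))) useTriple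

/-- Round `k < n` tries the singleton `{k}`; the extra round `n` tries the best triple. Each round
is quadratic. -/
def search : Cmd := .seq (.set 9 (.var 3))
  (.loop 23 (.seq choose (.seq markFar (.seq select test))))

def searchTriple : Cmd := .seq (.set 9 (.var 3)) (.seq useTriple (.seq select test))

/-- Removes the argument from the best set. -/
def removeArgument : Cmd := .seq (fill 6 20 (row 7 20))
  (fill 7 20 (.and (row 6 20) (.not (.eq (.var 20) (.var 1)))))

def output : Cmd :=
  .seq (.loop 20 (.ite (.lt (.var 20) (.var 0))
    (.putLow (.var 20) (.ite (row 7 20) (.const 1) (.const 0))) skip))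
    (.set 0 (.lt (.var 9) (.var 3)))

end Cmd

section Selection

variable {n : ℕ} {G : SimpleGraph (Fin n)} {w : Fin n → ℕ} {X T M D : Finset (Fin n)}
  {bound v : ℕ} {s : Store} {m : ℕ} {K : Finset (Fin n) → Prop}

theorem Ready.holds_adj (h : Ready G w X bound v s) (a b : Expr) :
    (Expr.get 0 a b).Holds (n + 1) s ↔ DomN G (a.eval (n + 1) s) (b.eval (n + 1) s) :=
  WED.holds_adj G a b s h.adj

theorem Describes.iff_mem {g : ℕ → ℕ} (h : Describes g D) (i : Fin n) : g i ≠ 0 ↔ i ∈ D := by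
  rw [h i (by omega)]
  simp

theorem Ready.markFar (h : Ready G w X bound v s) (hx : s.var 10 < n + 1) (hy : s.var 11 < n + 1)
    (hz : s.var 12 < n + 1) : ∃ f, Cmd.markFar.eval (n + 1) s = s.setArr 5 f ∧
      Describes (f 0) (Finset.univ.filter fun q =>
        ∀ t ∈ triple n (s.var 10) (s.var 11) (s.var 12), Far G t q) := by
  refine ⟨_, by rw [Cmd.markFar, Cmd.eval_fill rfl (by omega)], fun i hi => ?_⟩
  have hfar : ∀ {x q}, x < n + 1 → (∀ t : Fin n, (t : ℕ) = x → FarN G t q) → FarN G x q := by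
    intro x q hx h
    rcases eq_or_exists_fin hx with rfl | ⟨a, rfl⟩
    · exact farN_left _
    · exact h a rfl
  rw [Function.update_self, if_pos hi, ← Expr.Holds]
  simp only [Expr.holds_and, Expr.holds_lt, Expr.holds_get, Expr.eval_var, Store.set_var,
    Store.set_arr, if_true, if_false, hx, hy, hz, hi, and_self, true_and,
    h.far _ hx _ hi, h.far _ hy _ hi, h.far _ hz _ hi, h.size, Nat.reduceEqDiff,
    OfNat.zero_ne_ofNat, Finset.mem_filter, Finset.mem_univ, mem_triple]
  constructor
  · rintro ⟨hin, h₁, h₂, h₃⟩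
    refine ⟨hin, fun t ht => ?_⟩
    rw [← farN_val]
    rcases ht with e | e | e <;> rw [e] <;> assumption
  · rintro ⟨hin, ht⟩
    refine ⟨hin, hfar hx fun t e => ?_, hfar hy fun t e => ?_, hfar hz fun t e => ?_⟩
    · exact (farN_val _ _).2 (ht t (.inl e))
    · exact (farN_val _ _).2 (ht t (.inr (.inl e)))
    · exact (farN_val _ _).2 (ht t (.inr (.inr e)))

/-- The selected set. -/
noncomputable def selection (G : SimpleGraph (Fin n)) (w : Fin n → ℕ) (T M : Finset (Fin n)) :
    Finset (Fin n) :=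
  Finset.univ.filter fun q => q ∈ T ∨ (q ∈ M ∧ ∀ p, Dom G q p → p ∈ M → ¬ Beats G w p q)

theorem selection_empty : selection G w T ∅ = T := by
  ext
  simp [selection]

theorem selection_far :
    selection G w T (Finset.univ.filter fun q => ∀ t ∈ T, Far G t q) = candidate G w T := by
  ext
  simp [selection, candidate]

theorem Ready.holds_beats (h : Ready G w X bound v s) {q p : Fin n} (hq : s.var 20 = q)
    (hp : s.var 21 = p) : Cmd.beats.Holds (n + 1) s ↔ Beats G w p q := by
  have hq' : (q : ℕ) < n + 1 := by omega
  have hp' : (p : ℕ) < n + 1 := by omega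
  simp only [Cmd.beats, Expr.holds_or, Expr.holds_and, Expr.holds_lt, Expr.holds_eq,
    Cmd.eval_row, Expr.eval_var, hq, hp, hq', hp', Nat.succ_pos, and_self, if_true, h.deg,
    h.weight, extend_val, Beats, Fin.lt_def]

theorem Ready.select (h : Ready G w X bound v s) (hM : Describes (s.arr 5 0) M) :
    ∃ f, Cmd.select.eval (n + 1) s = s.setArr 6 f ∧
      Describes (f 0) (selection G w (triple n (s.var 10) (s.var 11) (s.var 12)) M) := by
  refine ⟨_, by rw [Cmd.select, Cmd.eval_fill rfl (by omega)], fun i hi => ?_⟩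
  rw [Function.update_self, if_pos hi, ← Expr.Holds]
  simp only [Expr.holds_and, Expr.holds_or, Expr.holds_lt, Expr.holds_eq, Expr.holds_all,
    Expr.holds_not, Expr.eval_var, Cmd.holds_row, Store.set_var, Store.set_arr, if_true,
    Nat.reduceEqDiff, if_false, OfNat.zero_ne_ofNat, h.size, Nat.succ_pos, hi, true_and]
  rcases eq_or_exists_fin hi with rfl | ⟨i, rfl⟩
  · simp
  · simp only [i.2, true_and, exists_true_left, Fin.eta, selection, Finset.mem_filter,
      Finset.mem_univ, mem_triple, hM.iff_mem]
    refine or_congr Iff.rfl (and_congr Iff.rfl ?_)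
    have key : ∀ p : Fin n, Cmd.beats.Holds (n + 1) ((s.set 20 i).set 21 p) ↔ Beats G w p i :=
      fun p => ((h.set (r := 20) (by omega) i).set (r := 21) (by omega) p).holds_beats (by simp)
        (by simp)
    have hadj : ∀ p, (Expr.get 0 (.var 20) (.var 21)).Holds (n + 1) ((s.set 20 i).set 21 p) ↔
        DomN G i p := by
      intro p
      rw [((h.set (r := 20) (by omega) i).set (r := 21) (by omega) p).holds_adj]
      simp
    simp only [hadj]
    constructor
    · intro h p hd hp hb
      exact h p (by omega) ⟨(domN_val _ _).2 hd, ⟨by omega, (hM.iff_mem p).2 hp⟩, (key p).2 hb⟩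
    · rintro h p - ⟨⟨h₁, hp, hd⟩, ⟨-, h₂⟩, h₃⟩
      exact h ⟨p, hp⟩ hd ((hM.iff_mem ⟨p, hp⟩).1 h₂) ((key ⟨p, hp⟩).1 h₃)

theorem isED_iff_card : IsED G D ↔ ∀ u, (D.filter fun d => Dom G d u).card = 1 := by
  refine forall_congr' fun u => ?_
  rw [Finset.card_eq_one]
  constructor
  · rintro ⟨d, hd, hu⟩
    refine ⟨d, Finset.ext fun a => ?_⟩
    rw [Finset.mem_filter, Finset.mem_singleton]
    exact ⟨hu a, fun h => h ▸ hd⟩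
  · rintro ⟨d, hd⟩
    simp only [Finset.ext_iff, Finset.mem_filter, Finset.mem_singleton] at hd
    exact ⟨d, (hd d).2 rfl, fun a => (hd a).1⟩

theorem Ready.holds_isED (h : Ready G w X bound v s) (hD : Describes (s.arr 6 0) D) :
    Cmd.isED.Holds (n + 1) s ↔ IsED G D := by
  rw [isED_iff_card]
  simp only [Cmd.isED, Expr.holds_all, Expr.holds_or, Expr.holds_not, Expr.holds_lt,
    Expr.eval_var, Store.set_var, if_true, OfNat.zero_ne_ofNat, if_false, h.size]
  have key : ∀ u : Fin n, (Expr.eq (.count 21 (.and (Cmd.row 6 21) (.get 0 (.var 21) (.var 20))))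
      (.const 1)).Holds (n + 1) (s.set 20 u) ↔ (D.filter fun d => Dom G d u).card = 1 := by
    intro u
    rw [Expr.holds_eq, Expr.eval_const, Expr.eval_count,
      sum_range_eq (f := fun d => if d ∈ D ∧ Dom G d u then 1 else 0), Finset.sum_boole,
      Nat.cast_id, ← Finset.filter_filter, Finset.filter_mem_eq_inter, Finset.univ_inter]
    · refine if_neg ?_
      rw [Expr.holds_and, ((h.set (r := 20) (by omega) _).set (r := 21) (by omega) _).holds_adj]
      simp [not_domN_left]
    · intro d
      rw [Expr.holds_and, ((h.set (r := 20) (by omega) _).set (r := 21) (by omega) _).holds_adj]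
      have hd : (d : ℕ) < n + 1 := by omega
      simp only [Cmd.holds_row, Expr.eval_var, Store.set_var, if_true, Nat.reduceEqDiff, if_false,
        Store.set_arr, hd, Nat.succ_pos, and_self, true_and, hD.iff_mem, domN_val]
  constructor
  · exact fun h u => (key u).1 ((h u (by omega)).resolve_left (not_not.2 u.2))
  · exact fun h u _ => or_iff_not_imp_left.2 fun hu => (key ⟨u, not_not.1 hu⟩).2 (h _)

/-- The variable `9` holds the weight of the best set found so far. -/
structure Best (K : Finset (Fin n) → Prop) (G : SimpleGraph (Fin n)) (w : Fin n → ℕ)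
    (X : Finset (Fin n)) (bound v : ℕ) (s : Store) : Prop where
  ready : Ready G w X bound v s
  le : s.var 9 ≤ bound
  sound : s.var 9 < bound → ∃ D, K D ∧ IsED G D ∧ ∑ d ∈ D, w d = s.var 9 ∧ Describes (s.arr 7 0) D

theorem Best.set (h : Best K G w X bound v s) {r : ℕ} (hr : 10 ≤ r) (a : ℕ) :
    Best K G w X bound v (s.set r a) := by
  have : (s.set r a).var 9 = s.var 9 := by rw [Store.set_var, if_neg (by omega)]
  exact ⟨h.ready.set (by omega) a, by rw [this]; exact h.le, by rw [this]; exact h.sound⟩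

theorem Best.setArr (h : Best K G w X bound v s) {k : ℕ} (hk : k = 5 ∨ k = 6) (f : ℕ → ℕ → ℕ) :
    Best K G w X bound v (s.setArr k f) := by
  have : (s.setArr k f).arr 7 = s.arr 7 := by rw [Store.setArr_arr, if_neg (by omega)]
  exact ⟨h.ready.setArr (by omega) f, h.le, by rw [this]; exact h.sound⟩

/-- Only sets that pass the test for an e.d. are recorded, so soundness holds for every graph. -/
theorem Best.test (h : Best K G w X bound v s) (hD : Describes (s.arr 6 0) D) (hK : K D) :
    let t := Cmd.test.eval (n + 1) s
    Best K G w X bound v t ∧ t.var 9 ≤ s.var 9 ∧ (IsED G D → t.var 9 ≤ ∑ d ∈ D, w d) ∧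
      ∀ r, r ≠ 9 → r ≠ 13 → t.var r = s.var r := by
  have hsum : (Expr.sum 20 (.ite (Cmd.row 6 20) (Cmd.row 3 20) (.const 0))).eval (n + 1) s =
      ∑ d ∈ D, w d := by
    rw [Expr.eval_sum, sum_range_eq (f := fun d => if d ∈ D then w d else 0), ← Finset.sum_filter,
      Finset.filter_mem_eq_inter, Finset.univ_inter]
    · have : ¬ s.arr 6 0 n ≠ 0 := by
        rw [hD n (by omega)]
        simp
      simp [not_not.1 this]
    · intro i
      have hi : (i : ℕ) < n + 1 := by omega
      simp only [Expr.eval_ite, Cmd.holds_row, Cmd.eval_row, Store.set_var, if_true, hi,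
        Nat.succ_pos, and_self, true_and, Store.set_arr, hD.iff_mem, h.ready.weight, extend_val,
        Expr.eval_const]
  intro t
  have ht : t = Cmd.test.eval (n + 1) s := rfl
  clear_value t
  rw [Cmd.test, Cmd.eval, Cmd.eval, hsum, Cmd.eval_ite, Expr.holds_and,
    (h.ready.set (r := 13) (by omega) _).holds_isED (D := D) (by simpa using hD)] at ht
  split_ifs at ht with hc
  · obtain ⟨hE, hlt⟩ := hc
    rw [Cmd.eval, Cmd.eval, Cmd.eval_fill rfl (by omega)] at ht
    have hlt : ∑ d ∈ D, w d < s.var 9 := by simpa using hlt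
    have h9 : t.var 9 = ∑ d ∈ D, w d := by simp [ht]
    rw [h9]
    refine ⟨⟨?_, ?_, fun _ => ⟨D, hK, hE, h9.symm, fun i hi => ?_⟩⟩, hlt.le, fun _ => le_rfl,
      fun r h₁ h₂ => ?_⟩
    · rw [ht]
      exact ((h.ready.set (by omega) _).set (by omega) _).setArr (by omega) _
    · rw [h9]
      exact hlt.le.trans h.le
    · rw [ht, Store.setArr_arr, if_pos rfl, Function.update_self, if_pos hi, ← Expr.Holds]
      simpa only [Cmd.holds_row, Store.set_var, if_true, hi, Nat.succ_pos, and_self, true_and,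
        Store.set_arr] using hD i hi
    · simp [ht, h₁, h₂]
  · rw [Cmd.eval_skip] at ht
    subst ht
    refine ⟨h.set (by omega) _, by simp, fun hE => ?_, fun r h₁ h₂ => by simp [h₂]⟩
    have hnl : ¬ ∑ d ∈ D, w d < s.var 9 := fun hlt => hc ⟨hE, by simpa using hlt⟩
    simpa using hnl

theorem Best.selectTest (h : Best K G w X bound v s) (hM : Describes (s.arr 5 0) M)
    (hK : K (selection G w (triple n (s.var 10) (s.var 11) (s.var 12)) M)) :
    let t := (Cmd.seq Cmd.select Cmd.test).eval (n + 1) s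
    Best K G w X bound v t ∧ t.var 9 ≤ s.var 9 ∧
      (IsED G (selection G w (triple n (s.var 10) (s.var 11) (s.var 12)) M) →
        t.var 9 ≤ ∑ d ∈ selection G w (triple n (s.var 10) (s.var 11) (s.var 12)) M, w d) ∧
      ∀ r, r ≠ 9 → r ≠ 13 → t.var r = s.var r := by
  obtain ⟨f, hf, hD⟩ := h.ready.select hM
  rw [Cmd.eval, hf]
  exact (h.setArr (.inr rfl) f).test (by simpa using hD) hK

theorem Best.markSelectTest (h : Best (fun _ => True) G w X bound v s) (hx : s.var 10 < n + 1)
    (hy : s.var 11 < n + 1) (hz : s.var 12 < n + 1)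
    (hT : triple n (s.var 10) (s.var 11) (s.var 12) = T) :
    let t := (Cmd.seq Cmd.markFar (.seq Cmd.select Cmd.test)).eval (n + 1) s
    Best (fun _ => True) G w X bound v t ∧ t.var 9 ≤ s.var 9 ∧
      (IsED G (candidate G w T) → t.var 9 ≤ ∑ d ∈ candidate G w T, w d) ∧
      ∀ r, r ≠ 9 → r ≠ 13 → t.var r = s.var r := by
  obtain ⟨f, hf, hM⟩ := h.ready.markFar hx hy hz
  rw [Cmd.eval, hf]
  rw [hT] at hM
  have := (h.setArr (.inl rfl) f).selectTest (by simpa using hM) trivial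
  simp only [Store.setArr_var, hT, selection_far] at this
  exact this

end Selection


/-! ### Optimality of the searches and the output -/

section Search

variable {n : ℕ} {G : SimpleGraph (Fin n)} {w c : Fin n → ℕ} {X T D : Finset (Fin n)}
  {bound v : ℕ} {s : Store} {K : Finset (Fin n) → Prop}

theorem triple_singleton (i : Fin n) : triple n i n n = {i} := by
  ext j
  simp [Fin.ext_iff, j.2.ne]

theorem card_triple_le (n x y z : ℕ) : (triple n x y z).card ≤ 3 := by
  rw [← Finset.card_map Fin.valEmbedding]
  refine (Finset.card_le_card (t := {x, y, z}) ?_).trans Finset.card_le_three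
  intro i hi
  obtain ⟨j, hj, rfl⟩ := Finset.mem_map.1 hi
  simpa using hj

theorem Ready.best (h : Ready G w X bound v s) : Best K G w X bound v (s.set 9 (s.var 3)) :=
  ⟨h.set (by omega) _, by simp [h.bound], fun hlt => by simp [h.bound] at hlt⟩

theorem Ready.search (h : Ready G w X bound v s) (hx : s.var 6 < n + 1) (hy : s.var 7 < n + 1)
    (hz : s.var 8 < n + 1) (hT : triple n (s.var 6) (s.var 7) (s.var 8) = T) :
    let t := Cmd.search.eval (n + 1) s
    Best (fun _ => True) G w X bound v t ∧
      (∀ i, IsED G (candidate G w {i}) → t.var 9 ≤ ∑ d ∈ candidate G w {i}, w d) ∧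
      (IsED G (candidate G w T) → t.var 9 ≤ ∑ d ∈ candidate G w T, w d) := by
  intro t
  have key := Cmd.loop_spec (m := n + 1) (i := 23)
    (p := .seq .choose (.seq .markFar (.seq .select .test))) (s := s.set 9 (s.var 3))
    (fun t => Best (fun _ => True) G w X bound v t ∧ t.var 6 = s.var 6 ∧ t.var 7 = s.var 7 ∧
      t.var 8 = s.var 8)
    (fun k t => ∀ S, (if k < n then triple n k n n else T) = S → IsED G (candidate G w S) →
      t.var 9 ≤ ∑ d ∈ candidate G w S, w d) ⟨h.best, by simp⟩ ?_
  · obtain ⟨⟨h₁, -⟩, h₂⟩ := key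
    refine ⟨h₁, fun i hi => ?_, fun hE => ?_⟩
    · exact h₂ i (by omega) {i} (by rw [if_pos i.2, triple_singleton]) hi
    · exact h₂ n (by omega) T (if_neg (lt_irrefl n)) hE
  · rintro k hk t ⟨ht, t₆, t₇, t₈⟩
    obtain ⟨x, y, z, hx, hy, hz, hxyz, hch⟩ : ∃ x y z, x < n + 1 ∧ y < n + 1 ∧ z < n + 1 ∧
        triple n x y z = (if k < n then triple n k n n else T) ∧
        Cmd.choose.eval (n + 1) (t.set 23 k) =
          (((t.set 23 k).set 10 x).set 11 y).set 12 z := by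
      rw [Cmd.choose, Cmd.eval_ite]
      have hc : (Expr.lt (.var 23) (.var 0)).Holds (n + 1) (t.set 23 k) ↔ k < n := by
        simp [ht.ready.size]
      rw [hc]
      split_ifs with hkn
      · exact ⟨k, n, n, hk, by omega, by omega, rfl, by simp [Cmd.eval, ht.ready.size]⟩
      · exact ⟨s.var 6, s.var 7, s.var 8, hx, hy, hz, hT,
          by simp [Cmd.useTriple, Cmd.eval, t₆, t₇, t₈]⟩
    rw [Cmd.eval, hch]
    obtain ⟨h₁, h₂, h₃, h₄⟩ := ((((ht.set (r := 23) (by omega) k).set (r := 10) (by omega) x).set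
      (r := 11) (by omega) y).set (r := 12) (by omega) z).markSelectTest
      (T := if k < n then triple n k n n else T) (by simpa using hx) (by simpa using hy)
      (by simpa using hz) (by simpa using hxyz)
    have h₉ : ∀ t : Store, (t.set 23 ((s.set 9 (s.var 3)).var 23)).var 9 = t.var 9 := by simp
    refine ⟨⟨h₁.set (by omega) _, ?_, ?_, ?_⟩, ?_, ?_⟩
    · simpa [h₄] using t₆
    · simpa [h₄] using t₇
    · simpa [h₄] using t₈
    · rintro S rfl hS
      rw [h₉]
      exact h₃ hS
    · intro l hl S hS hE
      rw [h₉]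
      exact (h₂.trans (by simp)).trans (hl S hS hE)

theorem Ready.searchTriple (h : Ready G w X bound v s) (hM : ∀ i, s.arr 5 0 i = 0)
    (hT : triple n (s.var 6) (s.var 7) (s.var 8) = T) :
    let t := Cmd.searchTriple.eval (n + 1) s
    Best (fun D => D.card ≤ 3) G w X bound v t ∧ (IsED G T → t.var 9 ≤ ∑ d ∈ T, w d) := by
  suffices key : ∀ s₁, Best (fun D => D.card ≤ 3) G w X bound v s₁ → s₁.arr 5 = s.arr 5 →
      triple n (s₁.var 10) (s₁.var 11) (s₁.var 12) = T →
      let t := (Cmd.seq Cmd.select Cmd.test).eval (n + 1) s₁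
      Best (fun D => D.card ≤ 3) G w X bound v t ∧ (IsED G T → t.var 9 ≤ ∑ d ∈ T, w d) by
    refine key ((((s.set 9 (s.var 3)).set 10 (s.var 6)).set 11 (s.var 7)).set 12 (s.var 8))
      (((h.best.set ?_ _).set ?_ _).set ?_ _) ?_ ?_ <;> simp [hT]
  intro s₁ h₁ h₅ h₂
  have := h₁.selectTest (M := ∅) (fun i _ => by simp [h₅, hM])
    (by rw [selection_empty]; exact card_triple_le _ _ _ _)
  rw [selection_empty, h₂] at this
  exact ⟨this.1, this.2.2.1⟩

theorem IsCover.exists_dom (h : IsCover G X T)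
    (hX : ∀ a u, Dom G a u → u ∈ X → a ∈ X) : ∀ u, u ∉ X → ∃ t ∈ T, Dom G t u :=
  exists_dom_of_sum_eq h.far (fun t ht u hu hX' => h.notMem t ht (hX t u hu hX')) h.sum

/-- The condition on `X` says that it is a union of components, so the part of `D` outside `X`
dominates exactly the vertices outside `X`. -/
theorem IsED.isCover (hD : IsED G D) (hX : ∀ a u, Dom G a u → (u ∈ X ↔ a ∈ X)) :
    IsCover G X (D.filter fun d => d ∉ X) := by
  have hfar : ∀ t ∈ D.filter fun d => d ∉ X, ∀ t' ∈ D.filter fun d => d ∉ X, t ≠ t' →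
      Far G t t' := fun t ht t' ht' =>
    hD.far (Finset.mem_filter.1 ht).1 (Finset.mem_filter.1 ht').1
  have hnot : ∀ t ∈ D.filter fun d => d ∉ X, t ∉ X := fun t ht => (Finset.mem_filter.1 ht).2
  refine ⟨hfar, hnot, sum_domCard_eq hfar (fun t ht u hu => by rw [hX t u hu]; exact hnot t ht)
    fun u hu => ?_⟩
  obtain ⟨d, hd, hdu⟩ := hD.exists_dom u
  exact ⟨d, Finset.mem_filter.2 ⟨hd, by rwa [← hX d u hdu]⟩, hdu⟩

/-- By the dichotomy, the candidate of some `{r}` or that of the best triple is as good as `D`. In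
the second case the vertices of `D` outside clique components are themselves a cover by at most
three vertices, so the best triple is no heavier than they are. -/
theorem HasBestTriple.search_le (h : Ready G w
    (Finset.univ.filter fun u => InCliqueComponent G u) bound v s)
    (hs : HasBestTriple G w (Finset.univ.filter fun u => InCliqueComponent G u) bound s)
    (hG : IsFree G) (hD : IsED G D) (hlt : ∑ d ∈ D, w d < bound) :
    (Cmd.search.eval (n + 1) s).var 9 ≤ ∑ d ∈ D, w d := by
  obtain ⟨-, h₁, h₂⟩ := h.search hs.lt_x hs.lt_y hs.lt_z rfl
  rcases exists_restCliques_or_card_le hG hD with ⟨r, hr, hrest⟩ | hcard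
  · obtain ⟨h₃, h₄⟩ := candidate_singleton (w := w) hG hD hr hrest
    exact (h₁ r h₃).trans h₄
  · have hX : ∀ a u, Dom G a u → (u ∈ Finset.univ.filter (fun u => InCliqueComponent G u) ↔
        a ∈ Finset.univ.filter fun u => InCliqueComponent G u) := by
      intro a u hau
      simp only [Finset.mem_filter, Finset.mem_univ, true_and]
      exact ⟨fun h => h.of_dom hau.symm, fun h => h.of_dom hau⟩
    have hcov := hD.isCover hX
    simp only [Finset.mem_filter, Finset.mem_univ, true_and] at hcov
    obtain ⟨h₃, h₄⟩ := hs.best _ hcov hcard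
      ((Finset.sum_le_sum_of_subset (Finset.filter_subset _ _)).trans_lt hlt)
    obtain ⟨h₅, h₆⟩ := candidate_cover hD h₃.far
      (fun t ht => by simpa using h₃.notMem t ht)
      (fun u hu => h₃.exists_dom (fun a u h => (hX a u h).1) u (by simpa using hu)) h₄
    exact (h₂ h₅).trans h₆

/-- For empty `X`, covers and e.d. are the same, so the best triple needs no completion. -/
theorem HasBestTriple.searchTriple_le (h : Ready G w ∅ bound v s) (hM : ∀ i, s.arr 5 0 i = 0)
    (hs : HasBestTriple G w ∅ bound s) (hD : IsED G D) (hcard : D.card ≤ 3)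
    (hlt : ∑ d ∈ D, w d < bound) :
    (Cmd.searchTriple.eval (n + 1) s).var 9 ≤ ∑ d ∈ D, w d := by
  obtain ⟨-, h₁⟩ := h.searchTriple hM rfl
  have hcov := hD.isCover (X := ∅) (by simp)
  simp only [Finset.notMem_empty, not_false_eq_true, Finset.filter_true] at hcov
  obtain ⟨h₂, h₃⟩ := hs.best D hcov hcard hlt
  refine (h₁ (isED_iff.2 ⟨fun u => ?_, fun d hd d' hd' u hu hu' => ?_⟩)).trans h₃
  · exact h₂.exists_dom (by simp) u (by simp)
  · by_contra hne
    exact h₂.far d hd d' hd' hne u hu hu'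

theorem Cmd.eval_output (hs : s.var 0 = n) :
    let t := Cmd.output.eval (n + 1) s
    t.var 0 = (if s.var 9 < s.var 3 then 1 else 0) ∧
      ∀ i : Fin n, t.low i = if s.arr 7 0 i ≠ 0 then 1 else 0 := by
  have key := Cmd.loop_spec (m := n + 1) (i := 20)
    (p := .ite (.lt (.var 20) (.var 0))
      (.putLow (.var 20) (.ite (row 7 20) (.const 1) (.const 0))) skip) (s := s)
    (fun t => t.var 0 = n ∧ t.var 3 = s.var 3 ∧ t.var 9 = s.var 9 ∧ t.arr 7 = s.arr 7)
    (fun k t => k < n → t.low k = if s.arr 7 0 k ≠ 0 then 1 else 0) ⟨hs, rfl, rfl, rfl⟩ ?_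
  · obtain ⟨⟨h₀, h₃, h₉, h₇⟩, h⟩ := key
    refine ⟨?_, fun i => h i (by omega) i.2⟩
    rw [Cmd.output, Cmd.eval, Cmd.eval, Store.set_var, if_pos rfl]
    simp only [Expr.eval, h₃, h₉]
  · rintro k hk t ⟨h₀, h₃, h₉, h₇⟩
    have hc : (Expr.lt (.var 20) (.var 0)).Holds (n + 1) (t.set 20 k) ↔ k < n := by simp [h₀]
    rw [Cmd.eval_ite, hc]
    by_cases hkn : k < n
    · have hval : (Expr.ite (row 7 20) (.const 1) (.const 0)).eval (n + 1) (t.set 20 k) =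
          if s.arr 7 0 k ≠ 0 then 1 else 0 := by
        simp only [Expr.eval_ite, holds_row, Store.set_var, if_true, hk, Nat.succ_pos, and_self,
          true_and, Store.set_arr, h₇, Expr.eval_const]
      have hv : (t.set 20 k).var 20 = k := by simp
      rw [if_pos hkn, Cmd.eval, hval, Expr.eval_var, hv, if_pos (by nlinarith)]
      refine ⟨by simp [Store.setLow, h₀, h₃, h₉, h₇], fun _ => by simp [Store.setLow],
        fun l hl hln => ?_⟩
      by_cases hlk : l = k
      · subst hlk
        simp [Store.setLow]
      · simpa [Store.setLow, Function.update_of_ne hlk] using hl hln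
    · rw [if_neg hkn, Cmd.eval_skip]
      exact ⟨by simp [h₀, h₃, h₉, h₇], fun h => absurd h hkn,
        fun l hl hln => by simpa using hl hln⟩

theorem Best.output (h : Best K G w X bound v s) :
    let t := Cmd.output.eval (n + 1) s
    (t.var 0 = 1 ∧ ∃ D, K D ∧ IsED G D ∧ ∑ d ∈ D, w d = s.var 9 ∧ s.var 9 < bound ∧
        ∀ i : Fin n, t.low i = if i ∈ D then 1 else 0) ∨
      (t.var 0 = 0 ∧ bound ≤ s.var 9) := by
  obtain ⟨h₁, h₂⟩ := Cmd.eval_output h.ready.size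
  rw [h.ready.bound] at h₁
  by_cases hlt : s.var 9 < bound
  · obtain ⟨D, hK, hE, hw, hD⟩ := h.sound hlt
    exact .inl ⟨by rw [h₁, if_pos hlt], D, hK, hE, hw, hlt,
      fun i => by simp only [h₂, hD.iff_mem]⟩
  · exact .inr ⟨by rw [h₁, if_neg hlt], not_lt.1 hlt⟩

theorem Best.removeArgument_output {v : Fin n} (h : Best K G w X bound v s) :
    let t := (Cmd.seq Cmd.removeArgument Cmd.output).eval (n + 1) s
    (t.var 0 = 1 ∧ ∃ D, K D ∧ IsED G D ∧ ∑ d ∈ D, w d = s.var 9 ∧ s.var 9 < bound ∧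
        ∀ i : Fin n, t.low i = if i ∈ D.erase v then 1 else 0) ∨
      (t.var 0 = 0 ∧ bound ≤ s.var 9) := by
  intro t
  have ht : t = (Cmd.seq Cmd.removeArgument Cmd.output).eval (n + 1) s := rfl
  clear_value t
  rw [Cmd.eval, Cmd.removeArgument, Cmd.eval, Cmd.eval_fill rfl (by omega),
    Cmd.eval_fill rfl (by omega)] at ht
  generalize hg : Function.update (s.arr 6) 0 _ = g at ht
  generalize hf : Function.update ((s.setArr 6 g).arr 7) 0 _ = f at ht
  obtain ⟨h₁, h₂⟩ := Cmd.eval_output (s := (s.setArr 6 g).setArr 7 f) (n := n) h.ready.size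
  rw [← ht] at h₁ h₂
  simp only [Store.setArr_var, h.ready.bound] at h₁
  by_cases hlt : s.var 9 < bound
  · obtain ⟨D, hK, hE, hw, hD⟩ := h.sound hlt
    refine .inl ⟨by rw [h₁, if_pos hlt], D, hK, hE, hw, hlt, fun i => ?_⟩
    have hi : (i : ℕ) < n + 1 := by omega
    have hgi : g 0 i ≠ 0 ↔ i ∈ D := by
      rw [← hg, Function.update_self, if_pos hi, ← Expr.Holds]
      simp only [Cmd.holds_row, Store.set_var, if_true, hi, Nat.succ_pos, and_self, true_and,
        Store.set_arr, hD.iff_mem]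
    have : ((s.setArr 6 g).setArr 7 f).arr 7 0 i ≠ 0 ↔ i ∈ D.erase v := by
      rw [Store.setArr_arr, if_pos rfl, ← hf, Function.update_self, if_pos hi, ← Expr.Holds]
      simp only [Expr.holds_and, Expr.holds_not, Expr.holds_eq, Cmd.holds_row, Store.set_var,
        if_true, hi, Nat.succ_pos, and_self, true_and, Store.set_arr, Expr.eval_var,
        Store.setArr_arr, Store.setArr_var,
        OfNat.one_ne_ofNat, if_false, h.ready.arg, hgi, Finset.mem_erase, Fin.val_inj,
        and_comm, ne_eq]
    simp only [h₂, this]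
  · exact .inr ⟨by rw [h₁, if_neg hlt], not_lt.1 hlt⟩

end Search


/-! ### The three commands and their results -/

namespace Cmd

def wed : Cmd := .seq (prepare loadWeights excludeCliques) (.seq bestTriple (.seq search output))

def rootedWed : Cmd := .seq (prepare loadRootedWeights excludeCliques)
  (.seq bestTriple (.seq search (.seq removeArgument output)))

def rootedPairs : Cmd := .seq (prepare loadRootedWeights excludeNone)
  (.seq bestTriple (.seq searchTriple (.seq removeArgument output)))

end Cmd

section Programs

variable {n : ℕ} (G : SimpleGraph (Fin n)) (c : Fin n → ℕ)

theorem eval_wed : let t := Cmd.wed.eval (n + 1) (initialStore n 0 (inputMem G c))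
    (t.var 0 = 1 ∧ ∃ D, IsED G D ∧
        (IsFree G → ∀ D', IsED G D' → ∑ d ∈ D, c d ≤ ∑ d ∈ D', c d) ∧
        ∀ i : Fin n, t.low i = if i ∈ D then 1 else 0) ∨
      (t.var 0 = 0 ∧ (IsFree G → ¬ ∃ D, IsED G D)) := by
  intro t
  have hs := loadGraph_spec G c 0
  obtain ⟨h₁, -⟩ := hs.prepare hs.loadWeights excludes_cliques rfl
  obtain ⟨h₂, -, h₃⟩ := h₁.bestTriple
  obtain ⟨h₄, -⟩ := h₂.search h₃.lt_x h₃.lt_y h₃.lt_z rfl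
  have hlt : ∀ D : Finset (Fin n), ∑ d ∈ D, c d < 1 + ∑ i, c i := by
    intro D
    have := Finset.sum_le_sum_of_subset (f := c) (Finset.subset_univ D)
    omega
  rcases h₄.output with ⟨h₅, D, -, hD, hw, -, hl⟩ | ⟨h₅, h₆⟩
  · refine .inl ⟨h₅, D, hD, fun hG D' hD' => ?_, hl⟩
    rw [hw]
    exact h₃.search_le h₂ hG hD' (hlt D')
  · refine .inr ⟨h₅, ?_⟩
    rintro hG ⟨D, hD⟩
    exact (h₆.trans (h₃.search_le h₂ hG hD (hlt D))).not_gt (hlt D)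

theorem eval_rootedWed (v : Fin n) : let b := 1 + ∑ i, c i
    let w := rootedWeight G c v b
    let t := Cmd.rootedWed.eval (n + 1) (initialStore n v (inputMem G c))
    (t.var 0 = 1 ∧ ∃ D, IsED G D ∧ ∑ d ∈ D, w d < b ∧
        (IsFree G → ∀ D', IsED G D' → ∑ d ∈ D', w d < b → ∑ d ∈ D, w d ≤ ∑ d ∈ D', w d) ∧
        ∀ i : Fin n, t.low i = if i ∈ D.erase v then 1 else 0) ∨
      (t.var 0 = 0 ∧ (IsFree G → ¬ ∃ D, IsED G D ∧ ∑ d ∈ D, w d < b)) := by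
  intro b w t
  have hs := loadGraph_spec G c v
  obtain ⟨h₁, -⟩ := hs.prepare hs.loadRootedWeights excludes_cliques rfl
  obtain ⟨h₂, -, h₃⟩ := h₁.bestTriple
  obtain ⟨h₄, -⟩ := h₂.search h₃.lt_x h₃.lt_y h₃.lt_z rfl
  rcases h₄.removeArgument_output with ⟨h₅, D, -, hD, hw, hb, hl⟩ | ⟨h₅, h₆⟩
  · rw [← hw] at hb
    refine .inl ⟨h₅, D, hD, hb, fun hG D' hD' hb' => ?_, hl⟩
    rw [hw]
    exact h₃.search_le h₂ hG hD' hb'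
  · refine .inr ⟨h₅, ?_⟩
    rintro hG ⟨D, hD, hb⟩
    exact (h₆.trans (h₃.search_le h₂ hG hD hb)).not_gt hb

theorem eval_rootedPairs (v : Fin n) : let b := 1 + ∑ i, c i
    let w := rootedWeight G c v b
    let t := Cmd.rootedPairs.eval (n + 1) (initialStore n v (inputMem G c))
    (t.var 0 = 1 ∧ ∃ D, D.card ≤ 3 ∧ IsED G D ∧ ∑ d ∈ D, w d < b ∧
        (∀ D', D'.card ≤ 3 → IsED G D' → ∑ d ∈ D', w d < b → ∑ d ∈ D, w d ≤ ∑ d ∈ D', w d) ∧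
        ∀ i : Fin n, t.low i = if i ∈ D.erase v then 1 else 0) ∨
      (t.var 0 = 0 ∧ ¬ ∃ D, D.card ≤ 3 ∧ IsED G D ∧ ∑ d ∈ D, w d < b) := by
  intro b w t
  have hs := loadGraph_spec G c v
  obtain ⟨h₁, hM⟩ := hs.prepare hs.loadRootedWeights excludes_none rfl
  obtain ⟨h₂, hM', h₃⟩ := h₁.bestTriple
  rw [← hM'] at hM
  obtain ⟨h₄, -⟩ := h₂.searchTriple hM rfl
  rcases h₄.removeArgument_output with ⟨h₅, D, hcard, hD, hw, hb, hl⟩ | ⟨h₅, h₆⟩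
  · rw [← hw] at hb
    refine .inl ⟨h₅, D, hcard, hD, hb, fun D' hcard' hD' hb' => ?_, hl⟩
    rw [hw]
    exact h₃.searchTriple_le h₂ hM hD' hcard' hb'
  · refine .inr ⟨h₅, ?_⟩
    rintro ⟨D, hcard, hD, hb⟩
    exact (h₆.trans (h₃.searchTriple_le h₂ hM hD hcard hb)).not_gt hb

end Programs

/-! ### Efficient dominating sets of `G_v` and weights in `ℕ ∪ {∞}` -/

section Rooted

variable {n : ℕ} {G : SimpleGraph (Fin n)} {v : Fin n} {w : Fin n → ℕ∞}

theorem weightCode_eq_zero {a : ℕ∞} : weightCode a = 0 ↔ a = ⊤ := by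
  rw [weightCode]
  split_ifs with h <;> simp [h]

theorem coe_weightCode_sub_one {a : ℕ∞} (h : a ≠ ⊤) : ((weightCode a - 1 : ℕ) : ℕ∞) = a := by
  rw [weightCode, if_neg h, Nat.add_sub_cancel, ENat.natCast_toNat h]

/-- The natural weights that are used for the vertex `v`. -/
noncomputable def natWeight (G : SimpleGraph (Fin n)) (v : Fin n) (w : Fin n → ℕ∞) : Fin n → ℕ :=
  rootedWeight G (fun i => weightCode (w i)) v (1 + ∑ i, weightCode (w i))

theorem natWeight_self : natWeight G v w v = 0 := if_pos rfl

theorem natWeight_of_finite {d : Fin n} (hd : ¬ Dom G v d) (hw : w d ≠ ⊤) :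
    natWeight G v w d = weightCode (w d) - 1 := by
  rw [natWeight, rootedWeight, if_neg fun h => hd (.inl h.symm),
    if_neg fun h => h.elim hd fun h => hw (weightCode_eq_zero.1 h)]

theorem natWeight_of_infinite {d : Fin n} (hne : d ≠ v) (hd : Dom G v d ∨ w d = ⊤) :
    natWeight G v w d = 1 + ∑ i, weightCode (w i) := by
  rw [natWeight, rootedWeight, if_neg hne, if_pos (hd.imp id weightCode_eq_zero.2)]

/-- Finite weight keeps `D'` away from N₂, so all its vertices are far from `v`, and `v` can be
added at cost zero. The total stays below the bound, which exceeds the sum of all codes. -/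
theorem exists_isED_of_gv (hw : ∀ x ∈ level G v 2, w x = ⊤) {D' : Finset (gvSet G v)}
    (hD' : IsED (gv G v) D') (hfin : ∑ d ∈ D', w d < ⊤) :
    ∃ D, IsED G D ∧ D.card = D'.card + 1 ∧
      ∑ d ∈ D, natWeight G v w d < 1 + ∑ i, weightCode (w i) ∧
      ((∑ d ∈ D, natWeight G v w d : ℕ) : ℕ∞) = ∑ d ∈ D', w d := by
  have hne : ∀ d ∈ D', w d ≠ ⊤ := by
    intro d hd
    exact ((Finset.single_le_sum (f := fun d : gvSet G v => w d) (fun _ _ => bot_le) hd).trans_lt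
      hfin).ne
  have hfar : ∀ d ∈ D', d.1 ∈ rest G v := by
    intro d hd
    exact d.2.resolve_left fun h => hne d hd (hw _ h)
  have hv : v ∉ D'.map (Function.Embedding.subtype _) := by
    intro h
    obtain ⟨d, -, hd⟩ := Finset.mem_map.1 h
    exact mem_gvSet.1 d.2 (.inl hd.symm)
  have hsum : ∑ d ∈ insert v (D'.map (Function.Embedding.subtype _)), natWeight G v w d =
      ∑ d ∈ D', (weightCode (w d) - 1) := by
    rw [Finset.sum_insert hv, natWeight_self, Nat.zero_add, Finset.sum_map]
    exact Finset.sum_congr rfl fun d hd => natWeight_of_finite (mem_gvSet.1 d.2) (hne d hd)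
  refine ⟨_, isED_gv hD' hfar, by rw [Finset.card_insert_of_notMem hv, Finset.card_map], ?_, ?_⟩
  · rw [hsum]
    have h₁ : ∑ d ∈ D', (weightCode (w d) - 1) ≤
        ∑ d ∈ D'.map (Function.Embedding.subtype _), weightCode (w d) := by
      rw [Finset.sum_map]
      exact Finset.sum_le_sum fun d _ => Nat.sub_le _ _
    have h₂ := Finset.sum_le_sum_of_subset (f := fun d => weightCode (w d))
      (Finset.subset_univ (D'.map (Function.Embedding.subtype _)))
    omega
  · rw [hsum, Nat.cast_sum]
    exact Finset.sum_congr rfl fun d hd => coe_weightCode_sub_one (hne d hd)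

/-- A weight below the bound excludes the neighbours of `v` and, apart from `v`, the vertices of
infinite weight. As something in `D` must dominate `v`, it is `v` itself. -/
theorem exists_isED_gv {D : Finset (Fin n)} (hD : IsED G D)
    (hfin : ∑ d ∈ D, natWeight G v w d < 1 + ∑ i, weightCode (w i)) :
    ∃ D' : Finset (gvSet G v), IsED (gv G v) D' ∧ D.card = D'.card + 1 ∧
      ((∑ d ∈ D, natWeight G v w d : ℕ) : ℕ∞) = ∑ d ∈ D', w d ∧
      D'.map (Function.Embedding.subtype _) = D.erase v := by
  have hlt : ∀ d ∈ D, d ≠ v → ¬ Dom G v d ∧ w d ≠ ⊤ := by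
    intro d hd hne
    rw [← not_or]
    intro h
    rw [← natWeight_of_infinite hne h] at hfin
    exact (Finset.single_le_sum (fun _ _ => Nat.zero_le _) hd).not_gt hfin
  have hv : v ∈ D := by
    obtain ⟨d, hd, hdv⟩ := hD.exists_dom v
    by_contra hv
    exact (hlt d hd fun h => hv (h ▸ hd)).1 hdv.symm
  have hmap : (D.subtype (· ∈ gvSet G v)).map (Function.Embedding.subtype _) = D.erase v := by
    rw [Finset.subtype_map]
    ext d
    rw [Finset.mem_filter, Finset.mem_erase, mem_gvSet, and_comm]
    exact and_congr_left fun hd => ⟨fun h h' => h (.inl h'.symm), fun h => (hlt d hd h).1⟩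
  refine ⟨_, hD.gv hv, ?_, ?_, hmap⟩
  · rw [← Finset.card_map (Function.Embedding.subtype _) (s := D.subtype _), hmap,
      Finset.card_erase_add_one hv]
  · have hsum := Finset.sum_map (D.subtype (· ∈ gvSet G v)) (Function.Embedding.subtype _) w
    rw [hmap] at hsum
    refine Eq.trans ?_ hsum
    rw [← Finset.add_sum_erase _ _ hv,
      natWeight_self, Nat.zero_add, Nat.cast_sum]
    refine Finset.sum_congr rfl fun d hd => ?_
    obtain ⟨h₁, h₂⟩ := hlt d (Finset.mem_of_mem_erase hd) (Finset.ne_of_mem_erase hd)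
    rw [natWeight_of_finite h₁ h₂, coe_weightCode_sub_one h₂]

end Rooted

/-! ### The algorithms -/

theorem wed_program :
    ∃ (p : Program) (C : ℕ), ∀ (n : ℕ) (G : SimpleGraph (Fin n)) (w : Fin n → ℕ),
      0 < n → IsFree G →
      ∃ (t : ℕ) (s : State), Run p (input G w 0) t s ∧
        t ≤ C * max 1 G.minDegree * n ^ 3 ∧
        ((∃ D : Finset (Fin n), IsED G D ∧
            (∀ D' : Finset (Fin n), IsED G D' → ∑ d ∈ D, w d ≤ ∑ d ∈ D', w d) ∧
            Reports s D) ∨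
          (ReportsNone s ∧ ¬ ∃ D : Finset (Fin n), IsED G D)) := by
  obtain ⟨C, hC⟩ := Cmd.exists_run Cmd.wed (by decide)
  refine ⟨Cmd.wed.program, C, fun n G w hn hG => ?_⟩
  obtain ⟨t, s, hrun, ht, hs₀, hs⟩ := hC n G w 0 hn
  refine ⟨t, s, hrun, ht.trans ?_, ?_⟩
  · rw [Nat.mul_assoc]
    -- The time is cubic, and the factor `max 1 G.minDegree` is at least one.
    exact Nat.mul_le_mul_left _ (Nat.le_mul_of_pos_left _ (by positivity))
  · rcases eval_wed G w with ⟨h₁, D, hD, hmin, hl⟩ | ⟨h₁, h₂⟩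
    · exact .inl ⟨D, hD, hmin hG, hs₀.trans h₁, fun i => (hs i i.2).trans (hl i)⟩
    · exact .inr ⟨hs₀.trans h₁, h₂ hG⟩

theorem rooted_program :
    ∃ (p : Program) (C : ℕ), ∀ (n : ℕ) (G : SimpleGraph (Fin n)) (v : Fin n)
      (w : Fin n → ℕ∞), (∀ x ∈ level G v 2, w x = ⊤) →
      ∃ (t : ℕ) (s : State), Run p (input G (fun i => weightCode (w i)) v) t s ∧
        t ≤ C * n ^ 3 ∧
        ((∃ D : Finset (gvSet G v), IsED (gv G v) D ∧ ∑ d ∈ D, w d < ⊤ ∧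
            (IsFree G → ∀ D' : Finset (gvSet G v), IsED (gv G v) D' →
              ∑ d ∈ D, w d ≤ ∑ d ∈ D', w d) ∧
            Reports s (D.map (Function.Embedding.subtype _))) ∨
          (ReportsNone s ∧
            (IsFree G → ¬ ∃ D : Finset (gvSet G v),
              IsED (gv G v) D ∧ ∑ d ∈ D, w d < ⊤))) := by
  obtain ⟨C, hC⟩ := Cmd.exists_run Cmd.rootedWed (by decide)
  refine ⟨Cmd.rootedWed.program, C, fun n G v w hw => ?_⟩
  obtain ⟨t, s, hrun, ht, hs₀, hs⟩ := hC n G (fun i => weightCode (w i)) v v.pos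
  refine ⟨t, s, hrun, ht, ?_⟩
  rcases eval_rootedWed G (fun i => weightCode (w i)) v with
    ⟨h₁, D, hD, hb, hmin, hl⟩ | ⟨h₁, h₂⟩
  · obtain ⟨D', hD', -, hsum, hmap⟩ := exists_isED_gv hD hb
    refine .inl ⟨D', hD', ?_, fun hG E' hE' => ?_, hs₀.trans h₁, fun i => ?_⟩
    · rw [← hsum]
      exact ENat.natCast_lt_top _
    · rcases eq_or_ne (∑ d ∈ E', w d) ⊤ with h | h
      · rw [h]
        exact le_top
      · obtain ⟨E, hE, -, hEb, hEs⟩ := exists_isED_of_gv hw hE' h.lt_top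
        rw [← hsum, ← hEs, Nat.cast_le]
        exact hmin hG E hE hEb
    · rw [hmap]
      exact (hs i i.2).trans (hl i)
  · refine .inr ⟨hs₀.trans h₁, ?_⟩
    rintro hG ⟨E', hE', h⟩
    obtain ⟨E, hE, -, hEb, -⟩ := exists_isED_of_gv hw hE' h
    exact h₂ hG ⟨E, hE, hEb⟩

/-- Together with `v`, two vertices of G_v make three vertices of G, so the enumeration of triples
is exhaustive. -/
theorem rootedPairs_program :
    ∃ (p : Program) (C : ℕ), ∀ (n : ℕ) (G : SimpleGraph (Fin n)) (v : Fin n)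
      (w : Fin n → ℕ∞), (∀ x ∈ level G v 2, w x = ⊤) →
      ∃ (t : ℕ) (s : State), Run p (input G (fun i => weightCode (w i)) v) t s ∧
        t ≤ C * n ^ 3 ∧
        ((∃ D : Finset (gvSet G v), IsED (gv G v) D ∧ D.card ≤ 2 ∧
            ∑ d ∈ D, w d < ⊤ ∧
            (∀ D' : Finset (gvSet G v), IsED (gv G v) D' → D'.card ≤ 2 →
              ∑ d ∈ D, w d ≤ ∑ d ∈ D', w d) ∧
            Reports s (D.map (Function.Embedding.subtype _))) ∨
          (ReportsNone s ∧
            ¬ ∃ D : Finset (gvSet G v),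
              IsED (gv G v) D ∧ D.card ≤ 2 ∧ ∑ d ∈ D, w d < ⊤)) := by
  obtain ⟨C, hC⟩ := Cmd.exists_run Cmd.rootedPairs (by decide)
  refine ⟨Cmd.rootedPairs.program, C, fun n G v w hw => ?_⟩
  obtain ⟨t, s, hrun, ht, hs₀, hs⟩ := hC n G (fun i => weightCode (w i)) v v.pos
  refine ⟨t, s, hrun, ht, ?_⟩
  rcases eval_rootedPairs G (fun i => weightCode (w i)) v with
    ⟨h₁, D, hcard, hD, hb, hmin, hl⟩ | ⟨h₁, h₂⟩
  · obtain ⟨D', hD', hcard', hsum, hmap⟩ := exists_isED_gv hD hb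
    refine .inl ⟨D', hD', by omega, ?_, fun E' hE' hEcard' => ?_, hs₀.trans h₁, fun i => ?_⟩
    · rw [← hsum]
      exact ENat.natCast_lt_top _
    · rcases eq_or_ne (∑ d ∈ E', w d) ⊤ with h | h
      · rw [h]
        exact le_top
      · obtain ⟨E, hE, hEcard, hEb, hEs⟩ := exists_isED_of_gv hw hE' h.lt_top
        rw [← hsum, ← hEs, Nat.cast_le]
        exact hmin E (by omega) hE hEb
    · rw [hmap]
      exact (hs i i.2).trans (hl i)
  · refine .inr ⟨hs₀.trans h₁, ?_⟩
    rintro ⟨E', hE', hEcard', h⟩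
    obtain ⟨E, hE, hEcard, hEb, -⟩ := exists_isED_of_gv hw hE' h
    exact h₂ ⟨E, by omega, hE, hEb⟩

end WED

theorem mainTheorem5 :
    -- WED on `(2P₃, S_{1,2,2})`-free graphs in time `O(max(1, δ(G)) n³)`
    (∃ (p : WED.Program) (C : ℕ), ∀ (n : ℕ) (G : SimpleGraph (Fin n)) (w : Fin n → ℕ),
      0 < n → WED.IsFree G →
      ∃ (t : ℕ) (s : WED.State), WED.Run p (WED.input G w 0) t s ∧
        t ≤ C * max 1 G.minDegree * n ^ 3 ∧
        ((∃ D : Finset (Fin n), WED.IsED G D ∧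
            (∀ D' : Finset (Fin n), WED.IsED G D' → ∑ d ∈ D, w d ≤ ∑ d ∈ D', w d) ∧
            WED.Reports s D) ∨
          (WED.ReportsNone s ∧ ¬ ∃ D : Finset (Fin n), WED.IsED G D))) ∧
    -- the problem on a prime graph `G_v`, with weights in `ℕ ∪ {∞}`, in time `O(n³)`
    (∃ (p : WED.Program) (C : ℕ), ∀ (n : ℕ) (G : SimpleGraph (Fin n)) (v : Fin n)
      (w : Fin n → ℕ∞), G.Connected → WED.IsPrime (WED.gv G v) →
      (∀ x ∈ WED.level G v 2, w x = ⊤) →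
      ∃ (t : ℕ) (s : WED.State), WED.Run p (WED.input G (fun i => WED.weightCode (w i)) v) t s ∧
        t ≤ C * n ^ 3 ∧
        ((∃ D : Finset (WED.gvSet G v), WED.IsED (WED.gv G v) D ∧ ∑ d ∈ D, w d < ⊤ ∧
            (WED.IsFree G → ∀ D' : Finset (WED.gvSet G v), WED.IsED (WED.gv G v) D' →
              ∑ d ∈ D, w d ≤ ∑ d ∈ D', w d) ∧
            WED.Reports s (D.map (Function.Embedding.subtype _))) ∨
          (WED.ReportsNone s ∧
            (WED.IsFree G → ¬ ∃ D : Finset (WED.gvSet G v),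
              WED.IsED (WED.gv G v) D ∧ ∑ d ∈ D, w d < ⊤)))) ∧
    -- if `D` has at least three vertices in `N₃(v)`, then the components of `G[R]` are cliques,
    -- each of them contains exactly one vertex of `D`, and that vertex is forced
    (∀ (V : Type*) [Finite V] (G : SimpleGraph V) (v : V) (D : Finset V),
      G.Connected → WED.IsFree G → WED.IsPrime (WED.gv G v) →
      WED.IsED G D → v ∈ D → 3 ≤ ((D : Set V) ∩ WED.level G v 3).ncard →
      ∀ Q : Set V, WED.IsRestComponent G v Q →
        G.IsClique Q ∧ ∃ d : V, (D : Set V) ∩ Q = {d} ∧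
          (Q = {d} ∨
            ((WED.distinguishing G v Q).Nonempty ∧ WED.joined G v Q = {d})) ∧
          ∀ D' : Finset V, WED.IsED G D' → v ∈ D' → (D' : Set V) ∩ Q = {d}) ∧
    -- two nonadjacent vertices of `R` form an e.d. together with `v` if and only if
    -- all other vertices of `G_v` are adjacent to exactly one of them
    (∀ (V : Type*) [Finite V] (G : SimpleGraph V) (v x y : V),
      x ∈ WED.rest G v → y ∈ WED.rest G v → x ≠ y → ¬ G.Adj x y →
      (WED.IsED G {v, x, y} ↔
        ∀ u ∈ WED.gvSet G v, u ≠ x → u ≠ y → Xor (G.Adj x u) (G.Adj y u))) ∧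
    -- a minimum weight e.d. of `G_v` among those with at most two vertices, in time `O(n³)`
    (∃ (p : WED.Program) (C : ℕ), ∀ (n : ℕ) (G : SimpleGraph (Fin n)) (v : Fin n)
      (w : Fin n → ℕ∞), (∀ x ∈ WED.level G v 2, w x = ⊤) →
      ∃ (t : ℕ) (s : WED.State), WED.Run p (WED.input G (fun i => WED.weightCode (w i)) v) t s ∧
        t ≤ C * n ^ 3 ∧
        ((∃ D : Finset (WED.gvSet G v), WED.IsED (WED.gv G v) D ∧ D.card ≤ 2 ∧
            ∑ d ∈ D, w d < ⊤ ∧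
            (∀ D' : Finset (WED.gvSet G v), WED.IsED (WED.gv G v) D' → D'.card ≤ 2 →
              ∑ d ∈ D, w d ≤ ∑ d ∈ D', w d) ∧
            WED.Reports s (D.map (Function.Embedding.subtype _))) ∨
          (WED.ReportsNone s ∧
            ¬ ∃ D : Finset (WED.gvSet G v),
              WED.IsED (WED.gv G v) D ∧ D.card ≤ 2 ∧ ∑ d ∈ D, w d < ⊤))) := by
  refine ⟨WED.wed_program, ?_, ?_, ?_, WED.rootedPairs_program⟩
  · obtain ⟨p, C, h⟩ := WED.rooted_program
    exact ⟨p, C, fun n G v w _ _ hw => h n G v w hw⟩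
  · intro V _ G v D _ hG hprime hD hvD h₃ Q hQ
    exact WED.component_structure D hG hprime hD hvD h₃ Q hQ
  · intro V _ G v x y hx hy hxy hadj
    exact WED.isED_triple_iff hx hy hxy hadj
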